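/- **Setting.** For each $n\ge 1$ let $(\mathcal H_n(x))_{x\in\{-1,1\}^n}$ be independent centred Gaussian random variables of variance $n$, all defined on one probability space $(\Omega,\mathcal F,\mathbb P)$ (nothing is assumed about their joint law for different $n$). For $\beta>0$ put $\tau_n(x)=e^{-\beta\mathcal H_n(x)}$. For a fixed realization of $\tau_n$, let $X_n$ be the continuous-time Markov jump process on $\{-1,1\}^n$ that jumps from $x$ to $y$ at rate $(n\tau_n(x))^{-1}$ if $x$ and $y$ differ in exactly one coordinate and at rate $0$ otherwise, started from the uniform distribution, and let $\mathcal P$ be its law (given the environment $\tau_n$). For a time-scale $c_n\to\infty$ define $a_n$ by $a_n\,\mathbb P(\tau_n(x)\ge c_n)=1$, and for $t,s>0$ let $$\mathcal C_n(t,s)=\mathcal P\big(n^{-1}(X_n(c_nt),X_n(c_nu))=1\ \text{ for all } t\le u<t+s\big),$$ where $(\cdot,\cdot)$ is the inner product of $\mathbb R^n$. **Theorem 1.4 (High temperature critical line).** Let $0<\varepsilon\le 1$ and $\beta=\beta_c(\varepsilon)=\sqrt{\varepsilon\, 2\log 2}$. Let $c_n$ be an intermediate time-scale with exponent $\varepsilon$,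 that is, $c_n\to\infty$, $$\lim_{n\to\infty}\frac{\log a_n}{n\log 2}=\varepsilon\quad\text{and}\quad\lim_{n\to\infty}\frac{a_n}{2^n}=0,$$ and assume that for some constant $\theta\in(-\infty,\infty)$ $$\lim_{n\to\infty}\Big(\frac{\log c_n}{\beta\sqrt n}-\beta\sqrt n\Big)=\theta .$$ Then for all $t,s>0$, $\mathbb P$-almost surely if $\sum_n a_n/2^n<\infty$ and in $\mathbb P$-probability if $\sum_n a_n/2^n=\infty$, $$\lim_{n\to\infty}\sqrt n\,\mathcal C_n(t,s)=\frac{e^{-\theta^2/2}}{\Phi(\theta)}\,\log\Big(1+\frac ts\Big)\frac1{\beta\sqrt{2\pi}},$$ where $\Phi$ is the standard Gaussian distribution function. In particular, in the same mode of convergence, $\mathcal C_n(t,s)\to 0$ for all $t,s>0$ (so that there is no dynamical ultrametricity on this line). -/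

import Mathlib

open MeasureTheory ProbabilityTheory Filter Topology
open scoped NNReal ENNReal

/-! ### Markov jump processes on a finite state space

The process with given rates and initial distribution is built in the standard way: run the
embedded jump chain, and stay in each visited state for an independent exponential time whose
parameter is the total rate of leaving that state. -/

namespace JumpProcess

variable {V : Type*} [Fintype V]

/-- The total rate `λ(x) = ∑ y, λ(x, y)` of leaving the state `x`. -/
noncomputable def exitRate (q : V → V → ℝ≥0) (x : V) : ℝ≥0 := ∑ y, q x y

/-- One step of the embedded jump chain from `x`: go to `y` with probability `λ(x, y) / λ(x)`
(and stay put if `x` is absorbing, i.e. `λ(x) = 0`). -/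
noncomputable def stepPMF (q : V → V → ℝ≥0) (x : V) : PMF V :=
  open Classical in
  if h : exitRate q x = 0 then PMF.pure x
  else PMF.ofFintype (fun y => ((q x y / exitRate q x : ℝ≥0) : ℝ≥0∞)) (by
    rw [← ENNReal.ofNNReal_finsetSum, ← Finset.sum_div]
    have h1 : (∑ y, q x y) / exitRate q x = 1 := div_self h
    rw [h1, ENNReal.coe_one])

variable [MeasurableSpace V] [MeasurableSingletonClass V]

/-- The transition kernel of the embedded jump chain. -/
noncomputable def stepKernel (q : V → V → ℝ≥0) : Kernel V V :=
  Kernel.ofFunOfCountable fun x => (stepPMF q x).toMeasure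

instance (q : V → V → ℝ≥0) : IsMarkovKernel (stepKernel q) :=
  ⟨fun x => inferInstanceAs (IsProbabilityMeasure (stepPMF q x).toMeasure)⟩

/-- The step at time `k` of the embedded jump chain, as a kernel on the past: it depends only on
the present state. -/
noncomputable def historyKernel (q : V → V → ℝ≥0) (k : ℕ) :
    Kernel ((i : Finset.Iic k) → (fun _ : ℕ => V) i) V :=
  (stepKernel q).comap (fun h => h ⟨k, Finset.mem_Iic.2 le_rfl⟩) (measurable_pi_apply _)

instance (q : V → V → ℝ≥0) (k : ℕ) : IsMarkovKernel (historyKernel q k) := by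
  unfold historyKernel; infer_instance

/-- The law of the whole trajectory `J 0, J 1, …` of the embedded jump chain with initial
distribution `μ₀`. -/
noncomputable def chainLaw (q : V → V → ℝ≥0) (μ₀ : Measure V) : Measure (ℕ → V) :=
  (μ₀.map fun x (_ : Finset.Iic 0) => x).bind
    (Kernel.traj (X := fun _ : ℕ => V) (historyKernel q) 0)

/-- A sequence of i.i.d. exponential random variables of mean one. -/
noncomputable def expLaw : Measure (ℕ → ℝ) :=
  haveI : IsProbabilityMeasure (expMeasure 1) := isProbabilityMeasure_expMeasure one_pos
  Measure.infinitePi fun _ : ℕ => expMeasure 1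

/-- The probability measure governing the process: a sample is a pair `(J, e)` of a trajectory of
the jump chain and an independent sequence of i.i.d. mean one exponential variables. -/
noncomputable def law (q : V → V → ℝ≥0) (μ₀ : Measure V) : Measure ((ℕ → V) × (ℕ → ℝ)) :=
  (chainLaw q μ₀).prod expLaw

/-- The time of the `k`-th jump, `∑ i < k, e i / λ(J i)` (infinite after an absorbing state). -/
noncomputable def jumpTime (q : V → V → ℝ≥0) (w : (ℕ → V) × (ℕ → ℝ)) (k : ℕ) : ℝ≥0∞ :=
  ∑ i ∈ Finset.range k, ENNReal.ofReal (w.2 i) / (exitRate q (w.1 i) : ℝ≥0∞)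

/-- The jump process: `X t = J k` when the time `t` lies in `[jumpTime k, jumpTime (k + 1))`, so
that `k` is the number of jumps up to time `t`. -/
noncomputable def X (q : V → V → ℝ≥0) (t : ℝ) (w : (ℕ → V) × (ℕ → ℝ)) : V :=
  w.1 (sSup {k : ℕ | jumpTime q w k ≤ ENNReal.ofReal t})

end JumpProcess

/-! ### The random hopping dynamics of the REM -/

namespace REM

/-- The discrete cube `{-1, 1}ⁿ`. -/
abbrev Cube (n : ℕ) : Type := Fin n → ℤˣ

instance : MeasurableSingletonClass ℤˣ :=
  ⟨fun x => ⟨{(x : ℤ)}, measurableSet_singleton _, by ext y; simp [Units.ext_iff]⟩⟩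

/-- The inner product in `ℝⁿ` of two vertices of the cube. -/
noncomputable def innerProd {n : ℕ} (x y : Cube n) : ℝ := ∑ i, ((x i : ℤ) : ℝ) * ((y i : ℤ) : ℝ)

/-- The Boltzmann weights `τ(x) = exp (-β H(x))` of an energy landscape `H`. -/
noncomputable def tau (β : ℝ) {n : ℕ} (H : Cube n → ℝ) (x : Cube n) : ℝ := Real.exp (-(β * H x))

/-- The rates `(n τ(x))⁻¹` along the edges of the cube (pairs of vertices that differ in exactly
one coordinate), and zero otherwise. -/
noncomputable def rate (β : ℝ) {n : ℕ} (H : Cube n → ℝ) (x y : Cube n) : ℝ≥0 :=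
  if hammingDist x y = 1 then Real.toNNReal ((n * tau β H x)⁻¹) else 0

/-- The uniform distribution on the cube. -/
noncomputable def uniform (n : ℕ) : Measure (Cube n) := (PMF.uniformOfFintype (Cube n)).toMeasure

/-- The no-jump correlation function for a fixed landscape `H` and a time-scale `c`: the
probability, for the dynamics started from the uniform distribution, that
`n⁻¹ (X (c t), X (c u)) = 1` for all `t ≤ u < t + s`. -/
noncomputable def corr (β : ℝ) {n : ℕ} (H : Cube n → ℝ) (c t s : ℝ) : ℝ :=
  (JumpProcess.law (rate β H) (uniform n)).real
    {w | ∀ u, t ≤ u → u < t + s →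
      (n : ℝ)⁻¹ * innerProd (JumpProcess.X (rate β H) (c * t) w)
        (JumpProcess.X (rate β H) (c * u) w) = 1}

/-- The energies `H n x`, `x ∈ {-1, 1}ⁿ`, are independent centred Gaussian variables of
variance `n`, for each `n`. Nothing is assumed on the joint law for different `n`. -/
structure IsHamiltonian {Ω : Type*} [MeasurableSpace Ω] (Pr : Measure Ω)
    (H : (n : ℕ) → Cube n → Ω → ℝ) : Prop where
  indep : ∀ n, iIndepFun (H n) Pr
  law : ∀ n x, HasLaw (H n x) (gaussianReal 0 (n : ℝ≥0)) Pr

/-- `a` is the sequence defined by `a n * Pr (τ_n(x) ≥ c n) = 1` (for `n ≥ 1`; the probability does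
not depend on the vertex `x`). -/
def IsScale {Ω : Type*} [MeasurableSpace Ω] (Pr : Measure Ω)
    (H : (n : ℕ) → Cube n → Ω → ℝ) (β : ℝ) (c a : ℕ → ℝ) : Prop :=
  ∀ n, 1 ≤ n → ∀ x : Cube n, a n * Pr.real {ω | c n ≤ tau β (fun y => H n y ω) x} = 1

/-- The diverging sequence `c` is an intermediate time-scale with exponent `ε`, where `a` is the
sequence attached to `c`. -/
structure IsIntermediate (c a : ℕ → ℝ) (ε : ℝ) : Prop where
  pos : 0 < ε
  le_one : ε ≤ 1
  diverges : Tendsto c atTop atTop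
  log_a : Tendsto (fun n : ℕ => Real.log (a n) / (n * Real.log 2)) atTop (𝓝 ε)
  a_div : Tendsto (fun n : ℕ => a n / 2 ^ n) atTop (𝓝 0)

/-- The critical line `β_c(ε) = √(ε 2 log 2)`. -/
noncomputable def betaC (ε : ℝ) : ℝ := √(ε * 2 * Real.log 2)

/-- The limit `e^{-θ²/2} / Φ(θ) · log (1 + t / s) · 1 / (β √(2π))`, where `Φ` is the standard
Gaussian distribution function. -/
noncomputable def limitValue (β θ t s : ℝ) : ℝ :=
  Real.exp (-θ ^ 2 / 2) / cdf (gaussianReal 0 1) θ * Real.log (1 + t / s)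
    * (1 / (β * √(2 * Real.pi)))

end REM

/-! All rates out of a vertex are equal, so the embedded jump chain is the simple random walk on the
cube whatever the landscape; the environment enters only through the holding times `τ(J i) * e i`.
Since the walk never stands still, the event in the correlation function says, up to a null set,
that a single step of the clock process straddles `[c t, c (t + s)]` (`sum_gap_le_corr`,
`corr_le_sum_gap`).

On the critical line the clock obeys a law of large numbers. Tilting the Gaussian by `exp (-β h)`
shows that the holding times below `c / n ^ 6` have mean `m = mseq ~ exp (n β² / 2) Φ(θ)`
(`lowMean_eq`), while the longer ones contribute a negligible part. With `k = kseq = c / m`, the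
clock after `x k` steps is therefore close to `c x`. One step exceeds `c v` with averaged
probability `siteTrap`, and the substitution `τ = c e^w` gives `√n k siteTrap (c v) → κ / v` with `κ
= tailConst` (`tendsto_kseq_mul_siteTrap`). Hence `√n` times the correlation is close to a Riemann
sum of `∫₀ᵗ κ / (t + s - x) dx = κ log (1 + t / s)` (`tendsto_sum_siteTrap`).

The limit lives on the scale `1 / √n`, so the errors have to be `o(1 / √n)`. A deviation of the
clock at step `i` is therefore only charged jointly with a long holding time at `i`
(`dynLaw_bad_inter_holds_le`). The walk mixes in `n ^ 2` steps, so the clock at step `i - n ^ 2` is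
nearly independent of the present vertex. Within the last `n ^ 2` steps, an excessive delay comes
either from an earlier visit to the present vertex, of probability `O(1 / √n)` (`returnBound_le`),
or from a second deep vertex, which is rare on average (`rare_closePair`).

As for the randomness of the environment, averages over the cube concentrate by Chebyshev's
inequality at rate `√n k / 2 ^ n`, which is `O(a / 2 ^ n)` (`IsScale.sqrt_mul_kseq_le`); the
remaining random errors have first moments small enough to be summable. Both kinds are recorded by
`Rare`, which yields almost sure convergence by Borel–Cantelli when `∑ a / 2 ^ n` converges, and
convergence in probability in general. -/

namespace REM

/-! ### Simple random walk on the cube -/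

section Walk

variable {n : ℕ}

/-- The transition matrix of the simple random walk on the cube. -/
noncomputable def walkMatrix (n : ℕ) : Matrix (Cube n) (Cube n) ℝ :=
  fun x y => if hammingDist x y = 1 then (n : ℝ)⁻¹ else 0

/-- The Walsh function of a set of coordinates. -/
def walsh (A : Finset (Fin n)) (x : Cube n) : ℝ := ∏ i ∈ A, ((x i : ℤ) : ℝ)

/-- The eigenvalue of the random walk at a Walsh function. -/
noncomputable def walshEig (A : Finset (Fin n)) : ℝ := 1 - 2 * A.card / n

/-- The vertex with the `i`-th coordinate flipped. -/
def flip (x : Cube n) (i : Fin n) : Cube n := Function.update x i (-x i)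

lemma flip_apply_ne (x : Cube n) {i j : Fin n} (h : j ≠ i) : flip x i j = x j := by
  simp [flip, h]

lemma flip_apply_self (x : Cube n) (i : Fin n) : flip x i i = -x i := by simp [flip]

lemma neg_ne_self_units (u : ℤˣ) : -u ≠ u := by
  rcases Int.units_eq_one_or u with rfl | rfl <;> decide

lemma units_eq_neg_of_ne {u v : ℤˣ} (h : u ≠ v) : v = -u := by
  rcases Int.units_eq_one_or u with rfl | rfl <;> rcases Int.units_eq_one_or v with rfl | rfl <;>
    simp_all

lemma hammingDist_eq_one_iff (x y : Cube n) : hammingDist x y = 1 ↔ ∃ i, flip x i = y := by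
  rw [hammingDist, Finset.card_eq_one]
  constructor
  · rintro ⟨i, hi⟩
    refine ⟨i, ?_⟩
    ext1 j
    have hj := Finset.ext_iff.1 hi j
    simp only [Finset.mem_filter, Finset.mem_univ, true_and, Finset.mem_singleton] at hj
    by_cases h : j = i
    · subst h
      rw [flip_apply_self, ← units_eq_neg_of_ne (hj.2 rfl)]
    · rw [flip_apply_ne _ h]
      by_contra h2
      exact h (hj.1 h2)
  · rintro ⟨i, rfl⟩
    refine ⟨i, ?_⟩
    ext j
    simp only [Finset.mem_filter, Finset.mem_univ, true_and, Finset.mem_singleton]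
    by_cases h : j = i
    · subst h
      simp [flip_apply_self, (neg_ne_self_units (x j)).symm]
    · simp [flip_apply_ne _ h, h]

lemma flip_injective (x : Cube n) : Function.Injective (flip x) := by
  intro i j h
  by_contra hij
  have := congrFun h i
  rw [flip_apply_self, flip_apply_ne _ hij] at this
  exact neg_ne_self_units _ this

lemma sum_hammingDist_one {M : Type*} [AddCommMonoid M] (x : Cube n) (f : Cube n → M) :
    ∑ y, (if hammingDist x y = 1 then f y else 0) = ∑ i, f (flip x i) := by
  classical
  rw [← Finset.sum_filter, ← Finset.sum_image (s := Finset.univ) (g := flip x)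
    (fun a _ b _ h => flip_injective x h)]
  refine Finset.sum_congr ?_ fun _ _ => rfl
  ext y
  simp [hammingDist_eq_one_iff]

lemma walsh_flip (A : Finset (Fin n)) (x : Cube n) (i : Fin n) :
    walsh A (flip x i) = (if i ∈ A then -1 else 1) * walsh A x := by
  classical
  unfold walsh
  split_ifs with h
  · rw [← Finset.mul_prod_erase _ _ h, ← Finset.mul_prod_erase _ _ h, flip_apply_self]
    have : ∏ j ∈ A.erase i, (((flip x i) j : ℤ) : ℝ) = ∏ j ∈ A.erase i, ((x j : ℤ) : ℝ) :=
      Finset.prod_congr rfl fun j hj => by rw [flip_apply_ne _ (Finset.ne_of_mem_erase hj)]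
    rw [this]; push_cast; ring
  · rw [one_mul]
    exact Finset.prod_congr rfl fun j hj => by
      rw [flip_apply_ne]; rintro rfl; exact h hj

lemma walkMatrix_mul_walsh (hn : 1 ≤ n) (A : Finset (Fin n)) (x : Cube n) :
    ∑ y, walkMatrix n x y * walsh A y = walshEig A * walsh A x := by
  classical
  have h1 : ∀ y, walkMatrix n x y * walsh A y =
      if hammingDist x y = 1 then (n : ℝ)⁻¹ * walsh A y else 0 := by
    intro y; unfold walkMatrix; split_ifs <;> simp
  simp_rw [h1, sum_hammingDist_one, walsh_flip, ← mul_assoc, ← Finset.sum_mul, ← Finset.mul_sum]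
  congr 1
  have hn' : (n : ℝ) ≠ 0 := by positivity
  have h2 : ∀ i : Fin n, (if i ∈ A then (-1 : ℝ) else 1) = 1 - 2 * (if i ∈ A then 1 else 0) := by
    intro i; split_ifs <;> norm_num
  simp_rw [h2, Finset.sum_sub_distrib, ← Finset.mul_sum]
  simp [walshEig]
  field_simp

/-- The sum over `A` is the expansion of `∏ (1 + x i * y i)`, in which any coordinate where `x` and
`y` differ gives a zero factor. -/
lemma sum_walsh_mul (x y : Cube n) :
    ∑ A : Finset (Fin n), walsh A x * walsh A y = if x = y then (2 : ℝ) ^ n else 0 := by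
  classical
  have h := Finset.prod_one_add (s := (Finset.univ : Finset (Fin n)))
    (f := fun i => ((x i : ℤ) : ℝ) * ((y i : ℤ) : ℝ))
  rw [Finset.powerset_univ] at h
  simp_rw [walsh, ← Finset.prod_mul_distrib]
  rw [← h]
  split_ifs with hxy
  · subst hxy
    have : ∀ i, (1 : ℝ) + ((x i : ℤ) : ℝ) * ((x i : ℤ) : ℝ) = 2 := by
      intro i
      rcases Int.units_eq_one_or (x i) with h | h <;> rw [h] <;> norm_num
    simp [this]
  · obtain ⟨i, hi⟩ := Function.ne_iff.1 hxy
    refine Finset.prod_eq_zero (Finset.mem_univ i) ?_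
    rw [units_eq_neg_of_ne hi]
    rcases Int.units_eq_one_or (x i) with h | h <;> rw [h] <;> norm_num

/-- Spectral decomposition: the Walsh functions are eigenfunctions, and their completeness
`sum_walsh_mul` is the case `d = 0`. -/
lemma walkMatrix_pow_apply (hn : 1 ≤ n) (d : ℕ) (x y : Cube n) :
    (walkMatrix n ^ d) x y = (2 ^ n : ℝ)⁻¹ * ∑ A, walshEig A ^ d * (walsh A x * walsh A y) := by
  induction d generalizing x with
  | zero =>
    simp only [pow_zero, one_mul, sum_walsh_mul, Matrix.one_apply]
    split_ifs <;> simp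
  | succ d ih =>
    rw [pow_succ', Matrix.mul_apply]
    simp_rw [ih]
    calc ∑ z, walkMatrix n x z * ((2 ^ n : ℝ)⁻¹ * ∑ A, walshEig A ^ d * (walsh A z * walsh A y))
        = ∑ z, ∑ A, (2 ^ n : ℝ)⁻¹ * (walshEig A ^ d * walsh A y *
            (walkMatrix n x z * walsh A z)) := by
          refine Finset.sum_congr rfl fun z _ => ?_
          rw [Finset.mul_sum, Finset.mul_sum]
          exact Finset.sum_congr rfl fun A _ => by ring
      _ = _ := by
          rw [Finset.sum_comm, Finset.mul_sum]
          refine Finset.sum_congr rfl fun A _ => ?_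
          rw [← Finset.mul_sum, ← Finset.mul_sum, walkMatrix_mul_walsh hn]
          ring

lemma walkMatrix_nonneg (x y : Cube n) : 0 ≤ walkMatrix n x y := by
  unfold walkMatrix; split_ifs <;> positivity

lemma walkMatrix_pow_nonneg (d : ℕ) (x y : Cube n) : 0 ≤ (walkMatrix n ^ d) x y := by
  induction d generalizing x with
  | zero => simp only [pow_zero, Matrix.one_apply]; split_ifs <;> norm_num
  | succ d ih =>
    rw [pow_succ', Matrix.mul_apply]
    exact Finset.sum_nonneg fun z _ => mul_nonneg (walkMatrix_nonneg _ _) (ih _)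

lemma abs_walsh (A : Finset (Fin n)) (x : Cube n) : |walsh A x| = 1 := by
  unfold walsh
  rw [Finset.abs_prod]
  refine Finset.prod_eq_one fun i _ => ?_
  rcases Int.units_eq_one_or (x i) with h | h <;> rw [h] <;> norm_num

lemma abs_walshEig_le_one (hn : 1 ≤ n) (A : Finset (Fin n)) : |walshEig A| ≤ 1 := by
  have h1 : (A.card : ℝ) ≤ n := by exact_mod_cast (Finset.card_le_univ A).trans (by simp)
  have hn' : (0 : ℝ) < n := by exact_mod_cast hn
  have h2 : (A.card : ℝ) / n ≤ 1 := by rw [div_le_one hn']; exact h1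
  have h3 : 0 ≤ (A.card : ℝ) / n := by positivity
  rw [abs_le, walshEig, mul_div_assoc]; constructor <;> linarith

/-- The average of `|λ|^d` over the eigenvalues `λ` of the walk. -/
noncomputable def eigMoment (n d : ℕ) : ℝ := (2 ^ n : ℝ)⁻¹ * ∑ A : Finset (Fin n), |walshEig A| ^ d

lemma eigMoment_nonneg (n d : ℕ) : 0 ≤ eigMoment n d := by unfold eigMoment; positivity

lemma walkMatrix_pow_le_eigMoment (hn : 1 ≤ n) (d : ℕ) (x y : Cube n) :
    (walkMatrix n ^ d) x y ≤ eigMoment n d := by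
  rw [walkMatrix_pow_apply hn, eigMoment]
  gcongr with A
  refine (le_abs_self _).trans ?_
  rw [abs_mul, abs_mul, abs_walsh, abs_walsh, abs_pow]; simp

lemma eigMoment_le_one (hn : 1 ≤ n) (d : ℕ) : eigMoment n d ≤ 1 := by
  unfold eigMoment
  have : ∑ A : Finset (Fin n), |walshEig A| ^ d ≤ ∑ A : Finset (Fin n), 1 :=
    Finset.sum_le_sum fun A _ => pow_le_one₀ (abs_nonneg _) (abs_walshEig_le_one hn A)
  simp only [Finset.sum_const, Finset.card_univ, Fintype.card_finset, Fintype.card_fin,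
    nsmul_eq_mul, mul_one] at this
  push_cast at this
  calc (2 ^ n : ℝ)⁻¹ * ∑ A : Finset (Fin n), |walshEig A| ^ d ≤ (2 ^ n : ℝ)⁻¹ * 2 ^ n := by gcongr
    _ = 1 := by field_simp

/-- The two excluded sets have eigenvalues `1` and `-1`; the second reflects the parity of the walk,
which never disappears. -/
lemma abs_walshEig_le (A : Finset (Fin n)) (h1 : A ≠ ∅) (h2 : A ≠ Finset.univ) :
    |walshEig A| ≤ 1 - 2 / n := by
  have hc1 : 1 ≤ A.card := Finset.card_pos.2 (Finset.nonempty_iff_ne_empty.2 h1)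
  have hc2 : A.card + 1 ≤ n := by
    have := Finset.card_lt_univ_of_notMem (s := A)
      (x := (by
        have : ∃ x, x ∉ A := by
          by_contra! h; exact h2 (Finset.eq_univ_iff_forall.2 h)
        exact this.choose)) (by
        have : ∃ x, x ∉ A := by
          by_contra! h; exact h2 (Finset.eq_univ_iff_forall.2 h)
        exact this.choose_spec)
    simpa using this
  have hn' : (0 : ℝ) < n := by exact_mod_cast (by omega : 0 < n)
  have hc1' : (1 : ℝ) ≤ A.card := by exact_mod_cast hc1
  have hc2' : (A.card : ℝ) + 1 ≤ n := by exact_mod_cast hc2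
  rw [abs_le, walshEig]
  constructor
  · rw [neg_sub, div_sub_one hn'.ne', one_sub_div hn'.ne', div_le_div_iff_of_pos_right hn']; linarith
  · rw [one_sub_div hn'.ne', one_sub_div hn'.ne', div_le_div_iff_of_pos_right hn']; linarith

/-- The eigenvalues `±1` contribute one each. All others satisfy `|λ| ^ d ≤ exp (-2 d / n) ≤ 2 ^
(-n)`, and there are at most `2 ^ n` of them, whence `3`. -/
lemma eigMoment_le_of_sq_le (hn : 1 ≤ n) {d : ℕ} (hd : n ^ 2 ≤ d) :
    eigMoment n d ≤ 3 / 2 ^ n := by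
  classical
  have hn' : (0 : ℝ) < n := by exact_mod_cast hn
  have key : ∀ A : Finset (Fin n), |walshEig A| ^ d ≤
      (if A = ∅ then 1 else 0) + (if A = Finset.univ then 1 else 0) + (2 ^ n : ℝ)⁻¹ := by
    intro A
    have h0 : |walshEig A| ^ d ≤ 1 := pow_le_one₀ (abs_nonneg _) (abs_walshEig_le_one hn A)
    have h2 : (0 : ℝ) ≤ (2 ^ n : ℝ)⁻¹ := by positivity
    by_cases hA : A = ∅
    · rw [if_pos hA]
      have : (0 : ℝ) ≤ if A = Finset.univ then 1 else 0 := by split_ifs <;> norm_num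
      linarith
    by_cases hA2 : A = Finset.univ
    · rw [if_pos hA2]
      have : (0 : ℝ) ≤ if A = ∅ then 1 else 0 := by split_ifs; norm_num
      linarith
    rw [if_neg hA, if_neg hA2, zero_add, zero_add]
    have h3 := abs_walshEig_le A hA hA2
    have h4 : 1 - 2 / (n : ℝ) ≤ Real.exp (-(2 / n)) := by
      have := Real.add_one_le_exp (-(2 / (n : ℝ))); linarith
    calc |walshEig A| ^ d ≤ Real.exp (-(2 / n)) ^ d :=
          pow_le_pow_left₀ (abs_nonneg _) (h3.trans h4) d
      _ = Real.exp (-(d * (2 / n))) := by rw [← Real.exp_nat_mul]; ring_nf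
      _ ≤ Real.exp (-(n : ℝ)) := by
          apply Real.exp_le_exp.2
          have : (n : ℝ) ^ 2 ≤ d := by exact_mod_cast hd
          have : (n : ℝ) ^ 2 * (2 / n) ≤ d * (2 / n) := by gcongr
          have h5 : (n : ℝ) ^ 2 * (2 / n) = 2 * n := by field_simp
          linarith
      _ = (Real.exp 1 ^ n)⁻¹ := by rw [Real.exp_neg, ← Real.exp_nat_mul]; simp
      _ ≤ (2 ^ n : ℝ)⁻¹ := by
          gcongr
          have := Real.add_one_le_exp (1 : ℝ); linarith
  unfold eigMoment
  have := Finset.sum_le_sum fun A (_ : A ∈ (Finset.univ : Finset (Finset (Fin n)))) => key A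
  rw [Finset.sum_add_distrib, Finset.sum_add_distrib] at this
  simp only [Finset.sum_ite_eq', Finset.mem_univ, if_true, Finset.sum_const, Finset.card_univ,
    Fintype.card_finset, Fintype.card_fin, nsmul_eq_mul] at this
  push_cast at this
  rw [mul_inv_cancel₀ (by positivity)] at this
  rw [div_eq_inv_mul]
  gcongr
  linarith

/-- Bound on the moments of the eigenvalues by the moment generating function. -/
lemma eigMoment_le_factorial (hn : 1 ≤ n) (d : ℕ) :
    eigMoment n d ≤ 4 * d.factorial / √n ^ d := by
  have hn' : (0 : ℝ) < n := by exact_mod_cast hn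
  set q : ℝ := √n with hq
  have hq0 : 0 < q := Real.sqrt_pos.2 hn'
  have hqq : q * q = n := Real.mul_self_sqrt hn'.le
  -- This is `x ^ d / d! ≤ exp x` at `x = √n |λ|`; adding both exponentials removes the absolute
  -- value.
  have hA : ∀ A : Finset (Fin n), |walshEig A| ^ d ≤ d.factorial / q ^ d *
      (Real.exp (q * walshEig A) + Real.exp (-(q * walshEig A))) := by
    intro A
    have h1 := Real.pow_div_factorial_le_exp (|q * walshEig A|) (abs_nonneg _) d
    rw [abs_mul, abs_of_pos hq0, mul_pow] at h1
    have h2 : Real.exp (q * |walshEig A|) ≤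
        Real.exp (q * walshEig A) + Real.exp (-(q * walshEig A)) := by
      rcases abs_cases (walshEig A) with ⟨h, _⟩ | ⟨h, _⟩ <;> rw [h]
      · linarith [Real.exp_pos (-(q * walshEig A))]
      · rw [mul_neg]; linarith [Real.exp_pos (q * walshEig A)]
    have h3 := h1.trans h2
    have hf : (0 : ℝ) < d.factorial := by positivity
    rw [div_le_iff₀ hf] at h3
    rw [div_mul_eq_mul_div, le_div_iff₀ (by positivity)]
    linarith
  -- Since `n λ = n - 2 |A|`, this is the binomial theorem. The result `(2 cosh z) ^ n` is at most
  -- `2 ^ n * exp (1 / 2)` at `z² = 1 / n`.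
  have hsum : ∀ z : ℝ, ∑ A : Finset (Fin n), Real.exp (z * (n * walshEig A)) =
      (Real.exp (-z) + Real.exp z) ^ n := by
    intro z
    have h := Finset.sum_pow_mul_eq_add_pow (Real.exp (-z)) (Real.exp z)
      (Finset.univ : Finset (Fin n))
    rw [Finset.powerset_univ] at h
    simp only [Finset.card_univ, Fintype.card_fin] at h
    rw [← h]
    refine Finset.sum_congr rfl fun A _ => ?_
    have hc : A.card ≤ n := by simpa using Finset.card_le_univ A
    rw [← Real.exp_nat_mul, ← Real.exp_nat_mul, ← Real.exp_add, Nat.cast_sub hc, walshEig]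
    congr 1
    field_simp
    ring
  have hcosh : ∀ z : ℝ, z ^ 2 = (n : ℝ)⁻¹ →
      (Real.exp (-z) + Real.exp z) ^ n ≤ 2 ^ n * 2 := by
    intro z hz
    have h1 : Real.exp (-z) + Real.exp z = 2 * Real.cosh z := by rw [Real.cosh_eq]; ring
    rw [h1, mul_pow]
    gcongr
    calc Real.cosh z ^ n ≤ Real.exp (z ^ 2 / 2) ^ n := by
          exact pow_le_pow_left₀ (Real.cosh_pos z).le (Real.cosh_le_exp_half_sq z) n
      _ = Real.exp (1 / 2) := by
          rw [← Real.exp_nat_mul, hz]; congr 1; field_simp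
      _ ≤ 2 := by
          have h := Real.exp_one_lt_d9
          have h2 : Real.exp (1 / 2) ^ 2 = Real.exp 1 := by rw [← Real.exp_nat_mul]; norm_num
          nlinarith [Real.exp_pos (1 / 2)]
  have hz1 : (q⁻¹) ^ 2 = (n : ℝ)⁻¹ := by rw [inv_pow, pow_two, hqq]
  have e1 : ∀ A : Finset (Fin n), q * walshEig A = q⁻¹ * (n * walshEig A) := by
    intro A; rw [← hqq]; field_simp
  have e2 : ∀ A : Finset (Fin n), -(q * walshEig A) = (-q⁻¹) * (n * walshEig A) := by
    intro A; rw [e1]; ring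
  unfold eigMoment
  calc (2 ^ n : ℝ)⁻¹ * ∑ A : Finset (Fin n), |walshEig A| ^ d
      ≤ (2 ^ n : ℝ)⁻¹ * ∑ A : Finset (Fin n), d.factorial / q ^ d *
      (Real.exp (q * walshEig A) + Real.exp (-(q * walshEig A))) := by
        gcongr with A; exact hA A
    _ = (2 ^ n : ℝ)⁻¹ * (d.factorial / q ^ d * ((Real.exp (-q⁻¹) + Real.exp q⁻¹) ^ n +
        (Real.exp (-(-q⁻¹)) + Real.exp (-q⁻¹)) ^ n)) := by
        rw [← Finset.mul_sum, Finset.sum_add_distrib]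
        simp_rw [e2, e1]
        rw [hsum, hsum]
    _ ≤ (2 ^ n : ℝ)⁻¹ * (d.factorial / q ^ d * (2 ^ n * 2 + 2 ^ n * 2)) := by
        gcongr
        · exact hcosh _ hz1
        · exact hcosh _ (by rw [neg_sq, hz1])
    _ = _ := by field_simp; ring

/-- The bound on the probability of a return of the walk in `n ^ 2` steps. -/
noncomputable def returnBound (n : ℕ) : ℝ := ∑ d ∈ Finset.range (n ^ 2), eigMoment n (d + 1)

lemma returnBound_nonneg (n : ℕ) : 0 ≤ returnBound n :=
  Finset.sum_nonneg fun _ _ => eigMoment_nonneg _ _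

lemma eigMoment_antitone (hn : 1 ≤ n) {d e : ℕ} (h : d ≤ e) : eigMoment n e ≤ eigMoment n d := by
  unfold eigMoment
  refine mul_le_mul_of_nonneg_left (Finset.sum_le_sum fun A _ => ?_) (by positivity)
  exact pow_le_pow_of_le_one (abs_nonneg _) (abs_walshEig_le_one hn A) h

/-- The first five terms are at most `eigMoment n 1 ≤ 4 / √n`. The other at most `n ^ 2` terms are
at most `eigMoment n 6 ≤ 4 * 6! / n ^ 3`, so that they add up to `2880 / n`; and `5 * 4 + 2880 =
2900`. -/
lemma returnBound_le (hn : 1 ≤ n) : returnBound n ≤ 2900 / √n := by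
  have hn' : (1 : ℝ) ≤ n := by exact_mod_cast hn
  have hq0 : 0 < √(n : ℝ) := Real.sqrt_pos.2 (by linarith)
  have hq1 : 1 ≤ √(n : ℝ) := Real.one_le_sqrt.2 hn'
  have hqq : √(n : ℝ) * √n = n := Real.mul_self_sqrt (by linarith)
  have h1 : ∀ d, eigMoment n (d + 1) ≤ (if d < 5 then eigMoment n 1 else 0) + eigMoment n 6 := by
    intro d
    have := eigMoment_nonneg n 6
    have := eigMoment_nonneg n 1
    split_ifs with h
    · linarith [eigMoment_antitone hn (show 1 ≤ d + 1 by omega)]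
    · linarith [eigMoment_antitone hn (show 6 ≤ d + 1 by omega)]
  have h2 : returnBound n ≤ 5 * eigMoment n 1 + n ^ 2 * eigMoment n 6 := by
    refine (Finset.sum_le_sum fun d _ => h1 d).trans ?_
    rw [Finset.sum_add_distrib, Finset.sum_const, ← Finset.sum_filter, Finset.sum_const]
    simp only [Finset.card_range, nsmul_eq_mul]
    push_cast
    have h3 : ((Finset.range (n ^ 2)).filter (fun d => d < 5)).card ≤ 5 := by
      calc _ ≤ (Finset.range 5).card := Finset.card_le_card fun d hd => by
              simp only [Finset.mem_filter, Finset.mem_range] at hd ⊢; exact hd.2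
        _ = 5 := by simp
    have h4 : (((Finset.range (n ^ 2)).filter (fun d => d < 5)).card : ℝ) ≤ 5 := by
      exact_mod_cast h3
    gcongr
    exact eigMoment_nonneg _ _
  have h3 := eigMoment_le_factorial hn 1
  have h4 := eigMoment_le_factorial hn 6
  have h5 : √(n : ℝ) ^ 6 = (n : ℝ) ^ 3 := by
    calc √(n : ℝ) ^ 6 = (√(n : ℝ) * √n) ^ 3 := by ring
      _ = (n : ℝ) ^ 3 := by rw [hqq]
  rw [h5] at h4
  have h6 : (n : ℝ) ^ 2 * eigMoment n 6 ≤ 2880 / √n := by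
    calc (n : ℝ) ^ 2 * eigMoment n 6 ≤ (n : ℝ) ^ 2 * (4 * (Nat.factorial 6 : ℕ) / (n : ℝ) ^ 3) := by gcongr
      _ = 2880 / (n : ℝ) := by
          have : (n : ℝ) ≠ 0 := by positivity
          norm_num [Nat.factorial]; field_simp
      _ ≤ 2880 / √n := by
          gcongr
          nlinarith
  have h7 : eigMoment n 1 ≤ 4 / √n := by simpa using h3
  calc returnBound n ≤ 5 * (4 / √n) + 2880 / √n := by linarith
    _ = 2900 / √n := by ring

end Walk

end REM

/-! ### The law of the jump chain -/

namespace JumpProcess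

variable {V : Type*} [Fintype V] [MeasurableSpace V] [MeasurableSingletonClass V]

open Classical in
lemma chainLaw_eq_trajMeasure (q : V → V → ℝ≥0) (μ₀ : Measure V) :
    chainLaw q μ₀ = Kernel.trajMeasure (X := fun _ : ℕ => V) μ₀ (historyKernel q) := rfl

instance (q : V → V → ℝ≥0) (μ₀ : Measure V) [IsProbabilityMeasure μ₀] :
    IsProbabilityMeasure (chainLaw q μ₀) := by
  rw [chainLaw_eq_trajMeasure]; infer_instance

/-- Markov property, tested on a function of the past times a function of the next state. -/
lemma lintegral_chainLaw_succ (q : V → V → ℝ≥0) (μ₀ : Measure V) [IsProbabilityMeasure μ₀] (a : ℕ)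
    (F : ((i : Finset.Iic a) → V) → ℝ≥0∞) (hF : Measurable F) (f : V → ℝ≥0∞) :
    ∫⁻ J, F (Preorder.frestrictLe a J) * f (J (a + 1)) ∂chainLaw q μ₀ =
      ∫⁻ J, F (Preorder.frestrictLe a J) * ∑ y, f y * stepPMF q (J a) y ∂chainLaw q μ₀ := by
  have hf : Measurable f := measurable_of_finite f
  have h := Kernel.map_frestrictLe_trajMeasure_compProd_eq_map_trajMeasure
    (X := fun _ : ℕ => V) (μ₀ := μ₀) (κ := historyKernel q) (a := a)
  rw [← chainLaw_eq_trajMeasure] at h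
  have hm : Measurable fun p : ((i : Finset.Iic a) → V) × V => F p.1 * f p.2 :=
    (hF.comp measurable_fst).mul (hf.comp measurable_snd)
  have hr : Measurable (Preorder.frestrictLe (π := fun _ : ℕ => V) a) :=
    Preorder.measurable_frestrictLe a
  have h1 := congrArg (fun ν => ∫⁻ p, F p.1 * f p.2 ∂ν) h
  rw [Measure.lintegral_compProd hm, lintegral_map hm
    (hr.prodMk (measurable_pi_apply (a + 1))), lintegral_map
    (hm.lintegral_kernel_prod_right' (κ := historyKernel q a)) hr] at h1
  rw [← h1]
  refine lintegral_congr fun J => ?_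
  simp only
  rw [lintegral_const_mul _ hf]
  congr 1
  have e : historyKernel q a (Preorder.frestrictLe a J) = (stepPMF q (J a)).toMeasure := rfl
  rw [e, lintegral_fintype]
  refine Finset.sum_congr rfl fun y _ => ?_
  rw [PMF.toMeasure_apply_singleton _ _ (measurableSet_singleton _)]

lemma map_zero_chainLaw (q : V → V → ℝ≥0) (μ₀ : Measure V) [IsProbabilityMeasure μ₀]
    (f : V → ℝ≥0∞) : ∫⁻ J, f (J 0) ∂chainLaw q μ₀ = ∫⁻ x, f x ∂μ₀ := by
  have hf : Measurable f := measurable_of_finite f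
  have hf0 : Measurable fun J : ℕ → V => f (J 0) := hf.comp (measurable_pi_apply 0)
  rw [chainLaw, Measure.lintegral_bind (Kernel.aemeasurable _) hf0.aemeasurable]
  rw [lintegral_map (Measurable.lintegral_kernel hf0)
    (measurable_of_finite _)]
  refine lintegral_congr fun x => ?_
  rw [Kernel.lintegral_traj (X := fun _ : ℕ => V) _ hf0]
  simp [Function.updateFinset]

lemma chainLaw_congr {q q' : V → V → ℝ≥0} (h : ∀ x, stepPMF q x = stepPMF q' x)
    (μ₀ : Measure V) : chainLaw q μ₀ = chainLaw q' μ₀ := by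
  have h1 : historyKernel q = historyKernel q' := by
    funext k
    unfold historyKernel
    congr 1
    unfold stepKernel
    congr 1
    funext x
    rw [h x]
  simp only [chainLaw, h1]

end JumpProcess

namespace REM

open JumpProcess

section Chain

variable {n : ℕ}

lemma exitRate_rate (hn : 1 ≤ n) (β : ℝ) (H : Cube n → ℝ) (x : Cube n) :
    exitRate (rate β H) x = Real.toNNReal ((tau β H x)⁻¹) := by
  have hn' : (0 : ℝ) < n := by exact_mod_cast hn
  unfold exitRate rate
  rw [sum_hammingDist_one x fun _ => Real.toNNReal ((n * tau β H x)⁻¹)]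
  rw [Finset.sum_const, Finset.card_univ, Fintype.card_fin, nsmul_eq_mul,
    ← Real.toNNReal_natCast, ← Real.toNNReal_mul hn'.le]
  congr 1
  field_simp

lemma tau_pos (β : ℝ) (H : Cube n → ℝ) (x : Cube n) : 0 < tau β H x := Real.exp_pos _

lemma stepPMF_rate (hn : 1 ≤ n) (β : ℝ) (H : Cube n → ℝ) (x y : Cube n) :
    stepPMF (rate β H) x y = ENNReal.ofReal (walkMatrix n x y) := by
  have hn' : (0 : ℝ) < n := by exact_mod_cast hn
  have ht := tau_pos β H x
  have h0 : exitRate (rate β H) x ≠ 0 := by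
    rw [exitRate_rate hn]
    exact (Real.toNNReal_pos.2 (inv_pos.2 ht)).ne'
  rw [stepPMF, dif_neg h0, PMF.ofFintype_apply, exitRate_rate hn, rate, walkMatrix, ENNReal.ofReal]
  split_ifs with h
  · rw [← Real.toNNReal_div (by positivity)]
    congr 2
    field_simp
  · simp

/-- The law of the simple random walk on the cube started from the uniform distribution. -/
noncomputable def walkLaw (n : ℕ) : Measure (ℕ → Cube n) :=
  chainLaw (rate 0 (0 : Cube n → ℝ)) (uniform n)

instance : IsProbabilityMeasure (uniform n) := by unfold uniform; infer_instance

instance : IsProbabilityMeasure (walkLaw n) := by unfold walkLaw; infer_instance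

/-- The factor `τ(x)⁻¹` is common to all rates out of `x` and cancels on division by the exit rate.
The dynamics in every environment can thus be built on one sample space. -/
lemma chainLaw_rate (hn : 1 ≤ n) (β : ℝ) (H : Cube n → ℝ) :
    chainLaw (rate β H) (uniform n) = walkLaw n := by
  refine chainLaw_congr (fun x => ?_) _
  ext y
  rw [stepPMF_rate hn, stepPMF_rate hn]

lemma lintegral_walkLaw_succ (hn : 1 ≤ n) (a : ℕ)
    (F : ((i : Finset.Iic a) → Cube n) → ℝ≥0∞) (hF : Measurable F) (f : Cube n → ℝ≥0∞) :
    ∫⁻ J, F (Preorder.frestrictLe a J) * f (J (a + 1)) ∂walkLaw n =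
      ∫⁻ J, F (Preorder.frestrictLe a J) *
        ∑ y, f y * ENNReal.ofReal (walkMatrix n (J a) y) ∂walkLaw n := by
  unfold walkLaw
  rw [lintegral_chainLaw_succ _ _ _ F hF]
  simp_rw [stepPMF_rate hn]

lemma lintegral_walkLaw_add (hn : 1 ≤ n) (a d : ℕ)
    (F : ((i : Finset.Iic a) → Cube n) → ℝ≥0∞) (hF : Measurable F) (f : Cube n → ℝ≥0∞) :
    ∫⁻ J, F (Preorder.frestrictLe a J) * f (J (a + d)) ∂walkLaw n =
      ∫⁻ J, F (Preorder.frestrictLe a J) *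
        ∑ y, f y * ENNReal.ofReal ((walkMatrix n ^ d) (J a) y) ∂walkLaw n := by
  induction d generalizing f with
  | zero =>
    refine lintegral_congr fun J => ?_
    simp [Matrix.one_apply, apply_ite ENNReal.ofReal]
  | succ d ih =>
    -- `F` is read as a function of the path up to `a + d`, so that the last step can be peeled off;
    -- the induction hypothesis is then used for `f` averaged over one step.
    have h2 : Measurable fun h : ((i : Finset.Iic (a + d)) → Cube n) =>
        F (fun i => h ⟨i.1, Finset.mem_Iic.2 ((Finset.mem_Iic.1 i.2).trans (by omega))⟩) :=
      hF.comp (measurable_pi_lambda _ fun i => measurable_pi_apply _)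
    have h1 := lintegral_walkLaw_succ hn (a + d) _ h2 f
    have h3 := ih fun z => ∑ y, f y * ENNReal.ofReal (walkMatrix n z y)
    refine (h1.trans h3).trans ?_
    refine lintegral_congr fun J => ?_
    congr 1
    simp_rw [Finset.sum_mul]
    rw [Finset.sum_comm]
    refine Finset.sum_congr rfl fun y _ => ?_
    rw [pow_succ, Matrix.mul_apply, ENNReal.ofReal_sum_of_nonneg
      (fun z _ => mul_nonneg (walkMatrix_pow_nonneg _ _ _) (walkMatrix_nonneg _ _)), Finset.mul_sum]
    refine Finset.sum_congr rfl fun z _ => ?_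
    rw [ENNReal.ofReal_mul (walkMatrix_pow_nonneg _ _ _)]
    ring

/-- The total mass of a function on the cube under the uniform distribution. -/
lemma lintegral_uniform (f : Cube n → ℝ≥0∞) :
    ∫⁻ x, f x ∂uniform n = (2 ^ n : ℝ≥0∞)⁻¹ * ∑ x, f x := by
  rw [lintegral_fintype, Finset.mul_sum]
  refine Finset.sum_congr rfl fun x _ => ?_
  rw [uniform, PMF.toMeasure_apply_singleton _ _ (measurableSet_singleton _),
    PMF.uniformOfFintype_apply, mul_comm]
  congr 2
  simp [Fintype.card_pi, Fintype.card_units_int]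

lemma walkMatrix_symm (x y : Cube n) : walkMatrix n x y = walkMatrix n y x := by
  unfold walkMatrix; rw [hammingDist_comm]

lemma sum_walkMatrix (hn : 1 ≤ n) (x : Cube n) : ∑ y, walkMatrix n x y = 1 := by
  have := walkMatrix_mul_walsh hn ∅ x
  simpa [walsh, walshEig] using this

lemma sum_walkMatrix_pow (hn : 1 ≤ n) (d : ℕ) (x : Cube n) :
    ∑ y, (walkMatrix n ^ d) y x = 1 := by
  induction d generalizing x with
  | zero => simp [Matrix.one_apply]
  | succ d ih =>
    simp_rw [pow_succ, Matrix.mul_apply]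
    rw [Finset.sum_comm]
    simp_rw [← Finset.sum_mul, ih, one_mul]
    simp_rw [walkMatrix_symm _ x]
    exact sum_walkMatrix hn x

/-- Stationarity. -/
lemma lintegral_walkLaw_apply (hn : 1 ≤ n) (d : ℕ) (f : Cube n → ℝ≥0∞) :
    ∫⁻ J, f (J d) ∂walkLaw n = (2 ^ n : ℝ≥0∞)⁻¹ * ∑ x, f x := by
  have h := lintegral_walkLaw_add hn 0 d (fun _ => 1) measurable_const f
  simp only [one_mul, zero_add] at h
  rw [h]
  have h2 := map_zero_chainLaw (rate 0 (0 : Cube n → ℝ)) (uniform n)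
    fun x => ∑ y, f y * ENNReal.ofReal ((walkMatrix n ^ d) x y)
  refine (h2.trans (lintegral_uniform _)).trans ?_
  congr 1
  rw [Finset.sum_comm]
  refine Finset.sum_congr rfl fun y _ => ?_
  rw [← Finset.mul_sum, ← ENNReal.ofReal_sum_of_nonneg
    (fun z _ => walkMatrix_pow_nonneg _ _ _), sum_walkMatrix_pow hn]
  simp

lemma measurable_walk_pair {α : Type*} [MeasurableSpace α] (a b : ℕ) (f : Cube n → Cube n → α) :
    Measurable fun J : ℕ → Cube n => f (J a) (J b) := by
  have h : Measurable fun J : ℕ → Cube n => (J a, J b) := by fun_prop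
  exact (measurable_of_finite fun z : Cube n × Cube n => f z.1 z.2).comp h

/-- Joint law at two times. -/
lemma lintegral_walkLaw_apply_two (hn : 1 ≤ n) (a d : ℕ) (f : Cube n → Cube n → ℝ≥0∞) :
    ∫⁻ J, f (J a) (J (a + d)) ∂walkLaw n =
      (2 ^ n : ℝ≥0∞)⁻¹ * ∑ x, ∑ y, f x y * ENNReal.ofReal ((walkMatrix n ^ d) x y) := by
  classical
  have h1 : ∀ J : ℕ → Cube n, f (J a) (J (a + d)) =
      ∑ x, (if J a = x then 1 else 0) * f x (J (a + d)) := by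
    intro J; simp
  simp_rw [h1]
  rw [lintegral_finsetSum]
  · have h2 : ∀ x, ∫⁻ J, (if J a = x then 1 else 0) * f x (J (a + d)) ∂walkLaw n =
        (2 ^ n : ℝ≥0∞)⁻¹ * ∑ z, (if z = x then 1 else 0) *
        ∑ y, f x y * ENNReal.ofReal ((walkMatrix n ^ d) z y) := by
      intro x
      have h3 := lintegral_walkLaw_add hn a d
        (fun h => if h ⟨a, Finset.mem_Iic.2 le_rfl⟩ = x then 1 else 0)
        (measurable_of_finite _) (f x)
      refine h3.trans ?_
      exact lintegral_walkLaw_apply hn a fun z => (if z = x then 1 else 0) *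
        ∑ y, f x y * ENNReal.ofReal ((walkMatrix n ^ d) z y)
    simp_rw [h2, ← Finset.mul_sum]
    congr 1
    simp
  · intro x _
    exact measurable_walk_pair a (a + d) fun z w => (if z = x then 1 else 0) * f x w

/-- Decoupling: after `n ^ 2` steps the walk is nearly independent of its past. -/
lemma lintegral_walkLaw_decouple (hn : 1 ≤ n) {a b : ℕ} (hab : a + n ^ 2 ≤ b)
    (F : ((i : Finset.Iic a) → Cube n) → ℝ≥0∞) (hF : Measurable F) (f : Cube n → ℝ≥0∞) :
    ∫⁻ J, F (Preorder.frestrictLe a J) * f (J b) ∂walkLaw n ≤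
      3 * ((2 ^ n : ℝ≥0∞)⁻¹ * ∑ x, f x) * ∫⁻ J, F (Preorder.frestrictLe a J) ∂walkLaw n := by
  obtain ⟨d, rfl⟩ := Nat.exists_eq_add_of_le (le_of_add_le_left hab)
  have hd : n ^ 2 ≤ d := by omega
  rw [lintegral_walkLaw_add hn a d F hF f]
  have hF' : Measurable fun J : ℕ → Cube n => F (Preorder.frestrictLe a J) :=
    hF.comp (Preorder.measurable_frestrictLe a)
  refine le_of_le_of_eq ?_ (lintegral_const_mul _ hF')
  refine lintegral_mono fun J => ?_
  rw [mul_comm (F _)]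
  refine mul_le_mul' ?_ le_rfl
  rw [Finset.mul_sum, Finset.mul_sum]
  refine Finset.sum_le_sum fun y _ => ?_
  have h := (walkMatrix_pow_le_eigMoment hn d (J a) y).trans (eigMoment_le_of_sq_le hn hd)
  calc f y * ENNReal.ofReal ((walkMatrix n ^ d) (J a) y)
      ≤ f y * ENNReal.ofReal (3 / 2 ^ n) := by gcongr
    _ = _ := by
      rw [ENNReal.ofReal_div_of_pos (by positivity), ENNReal.ofReal_pow (by norm_num),
        ENNReal.div_eq_inv_mul]
      simp only [ENNReal.ofReal_ofNat]
      ring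

/-- The walk moves at each step. -/
lemma ae_walkLaw_step (hn : 1 ≤ n) : ∀ᵐ J ∂walkLaw n, ∀ k, J (k + 1) ≠ J k := by
  rw [ae_all_iff]
  intro k
  classical
  have h := lintegral_walkLaw_apply_two hn k 1 fun x y => if y = x then 1 else 0
  simp only [ite_mul, one_mul, zero_mul, Finset.sum_ite_eq', Finset.mem_univ, if_true, pow_one]
    at h
  have h0 : ∀ x : Cube n, walkMatrix n x x = 0 := by intro x; simp [walkMatrix]
  simp only [h0, ENNReal.ofReal_zero, Finset.sum_const_zero, mul_zero] at h
  rw [lintegral_eq_zero_iff] at h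
  · filter_upwards [h] with J hJ hJ2
    simp [hJ2] at hJ
  · exact measurable_walk_pair k (k + 1) fun z w => if w = z then (1 : ℝ≥0∞) else 0

end Chain

end REM

/-! ### Exponential variables -/

section Exponential

instance isProbabilityMeasure_expMeasure_one : IsProbabilityMeasure (expMeasure 1) :=
  isProbabilityMeasure_expMeasure one_pos

lemma expMeasure_Ici {z : ℝ} (hz : 0 ≤ z) :
    expMeasure 1 (Set.Ici z) = ENNReal.ofReal (Real.exp (-z)) := by
  have : NullSingletonClass (expMeasure 1) := by
    unfold expMeasure gammaMeasure; infer_instance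
  rw [measure_congr Ioi_ae_eq_Ici.symm, ← Set.compl_Iic, prob_compl_eq_one_sub measurableSet_Iic,
    ← ofReal_cdf, cdf_expMeasure_eq one_pos, if_pos hz, ← ENNReal.ofReal_one,
    ← ENNReal.ofReal_sub _ (by simp [hz])]
  simp

lemma ae_pos_expMeasure : ∀ᵐ x ∂expMeasure 1, 0 < x := by
  have h : expMeasure 1 (Set.Iic 0) = 0 := by
    rw [← ofReal_cdf, cdf_expMeasure_eq one_pos]; simp
  rw [ae_iff]
  simp only [not_lt]
  exact h

lemma lintegral_pow_expMeasure (k : ℕ) :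
    ∫⁻ x, ENNReal.ofReal (x ^ k) ∂expMeasure 1 = ENNReal.ofReal k.factorial := by
  have h1 : expMeasure 1 = volume.withDensity (exponentialPDF 1) := rfl
  have hm : Measurable (exponentialPDF 1) := (measurable_exponentialPDFReal 1).ennreal_ofReal
  rw [h1, lintegral_withDensity_eq_lintegral_mul _ hm (by fun_prop)]
  have h2 : ∀ x : ℝ, (exponentialPDF 1 * fun x => ENNReal.ofReal (x ^ k)) x =
      (Set.Ici (0 : ℝ)).indicator (fun x => ENNReal.ofReal (Real.exp (-x) * x ^ k)) x := by
    intro x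
    by_cases hx : 0 ≤ x
    · rw [Set.indicator_of_mem (Set.mem_Ici.2 hx), Pi.mul_apply, exponentialPDF_of_nonneg hx,
        ENNReal.ofReal_mul (Real.exp_pos _).le]
      simp
    · rw [Set.indicator_of_notMem (by simpa using hx), Pi.mul_apply,
        exponentialPDF_of_neg (not_le.1 hx), zero_mul]
  simp_rw [h2]
  rw [lintegral_indicator measurableSet_Ici, setLIntegral_congr Ioi_ae_eq_Ici.symm]
  have h3 : ∀ x : ℝ, Real.exp (-x) * x ^ k = Real.exp (-x) * x ^ (((k : ℝ) + 1) - 1) := by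
    intro x; rw [add_sub_cancel_right, Real.rpow_natCast]
  simp_rw [h3]
  rw [← ofReal_integral_eq_lintegral_ofReal (Real.GammaIntegral_convergent (by positivity)),
    ← Real.Gamma_eq_integral (by positivity), Real.Gamma_nat_eq_factorial]
  filter_upwards [ae_restrict_mem measurableSet_Ioi] with x hx
  have : (0 : ℝ) < x := hx
  positivity

lemma memLp_expMeasure : MemLp (fun x : ℝ => x) 2 (expMeasure 1) := by
  rw [memLp_two_iff_integrable_sq (by fun_prop)]
  refine ⟨by fun_prop, ?_⟩
  rw [hasFiniteIntegral_iff_ofReal (ae_of_all _ fun x => sq_nonneg x), lintegral_pow_expMeasure]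
  exact ENNReal.ofReal_lt_top

lemma integral_expMeasure : ∫ x, x ∂expMeasure 1 = 1 := by
  rw [integral_eq_lintegral_of_nonneg_ae (ae_pos_expMeasure.mono fun x hx => le_of_lt hx)
    (by fun_prop)]
  have := lintegral_pow_expMeasure 1
  simp only [pow_one, Nat.factorial_one, Nat.cast_one] at this
  rw [this]; simp

lemma variance_expMeasure : Var[fun x : ℝ => x; expMeasure 1] = 1 := by
  rw [variance_eq_sub memLp_expMeasure, integral_expMeasure]
  have h : ∫ x, ((fun x : ℝ => x) ^ 2) x ∂expMeasure 1 = 2 := by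
    have h2 := lintegral_pow_expMeasure 2
    simp only [Pi.pow_apply]
    rw [integral_eq_lintegral_of_nonneg_ae (ae_of_all _ fun x => sq_nonneg x) (by fun_prop), h2]
    simp
  rw [h]; norm_num

end Exponential

namespace JumpProcess

instance : IsProbabilityMeasure expLaw := by unfold expLaw; infer_instance

lemma map_expLaw (i : ℕ) : expLaw.map (fun e => e i) = expMeasure 1 := by
  unfold expLaw
  exact Measure.infinitePi_map_eval (fun _ : ℕ => expMeasure 1) i

lemma lintegral_expLaw_apply (i : ℕ) {f : ℝ → ℝ≥0∞} (hf : Measurable f) :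
    ∫⁻ e, f (e i) ∂expLaw = ∫⁻ x, f x ∂expMeasure 1 := by
  rw [← map_expLaw i, lintegral_map hf (measurable_pi_apply i)]

lemma expLaw_le_apply (i : ℕ) {z : ℝ} (hz : 0 ≤ z) :
    expLaw {e | z ≤ e i} = ENNReal.ofReal (Real.exp (-z)) := by
  rw [← expMeasure_Ici hz, ← map_expLaw i, Measure.map_apply (measurable_pi_apply i)
    measurableSet_Ici]
  rfl

lemma ae_expLaw_pos : ∀ᵐ e ∂expLaw, ∀ i, 0 < e i := by
  rw [ae_all_iff]
  intro i
  have h := ae_pos_expMeasure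
  rw [← map_expLaw i] at h
  exact ae_of_ae_map (measurable_pi_apply i).aemeasurable h

lemma iIndepFun_expLaw : iIndepFun (fun (i : ℕ) (e : ℕ → ℝ) => e i) expLaw := by
  unfold expLaw
  exact iIndepFun_infinitePi (P := fun _ : ℕ => expMeasure 1) (X := fun _ x => x)
    fun _ => measurable_id

/-- The variable `e i` is independent of the previous ones. -/
lemma lintegral_expLaw_mul (i a : ℕ) (hai : a ≤ i) (G : (Finset.range a → ℝ) → ℝ≥0∞)
    (hG : Measurable G) (f : ℝ → ℝ≥0∞) (hf : Measurable f) :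
    ∫⁻ e, G (fun j => e j) * f (e i) ∂expLaw =
      (∫⁻ e, G (fun j => e j) ∂expLaw) * ∫⁻ e, f (e i) ∂expLaw := by
  have h := iIndepFun_expLaw.indepFun_finset (Finset.range a) {i}
    (by simp only [Finset.disjoint_singleton_right, Finset.mem_range]; omega)
    fun i => measurable_pi_apply i
  have h2 := h.comp hG (ψ := fun x => f (x ⟨i, Finset.mem_singleton_self i⟩)) (by fun_prop)
  refine lintegral_mul_eq_lintegral_mul_lintegral_of_indepFun ?_ ?_ h2
  · exact hG.comp (by fun_prop)
  · exact hf.comp (measurable_pi_apply i)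

/-- Two exponential variables with different indices. -/
lemma expLaw_le_apply_two {i j : ℕ} (hij : i ≠ j) {y z : ℝ} (hy : 0 ≤ y) (hz : 0 ≤ z) :
    expLaw {e | y ≤ e i ∧ z ≤ e j} =
      ENNReal.ofReal (Real.exp (-y)) * ENNReal.ofReal (Real.exp (-z)) := by
  have h := (iIndepFun_expLaw.indepFun hij).measure_inter_preimage_eq_mul (Set.Ici y) (Set.Ici z)
    measurableSet_Ici measurableSet_Ici
  rw [← expLaw_le_apply i hy, ← expLaw_le_apply j hz]
  exact h

end JumpProcess

namespace REM

open JumpProcess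

/-! ### The clock process -/

section Clock

variable {n : ℕ}

/-- The sample space of the dynamics. -/
abbrev Sample (n : ℕ) : Type := (ℕ → Cube n) × (ℕ → ℝ)

/-- The law of the jump chain and of the holding times. -/
noncomputable def dynLaw (n : ℕ) : Measure (Sample n) := (walkLaw n).prod expLaw

instance : IsProbabilityMeasure (dynLaw n) := by unfold dynLaw; infer_instance

lemma law_rate (hn : 1 ≤ n) (β : ℝ) (H : Cube n → ℝ) :
    law (rate β H) (uniform n) = dynLaw n := by
  rw [law, chainLaw_rate hn, dynLaw]

/-- The clock process: the time of the `k`-th jump when the mean holding times are `τ`. -/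
noncomputable def clock (τ : Cube n → ℝ) (w : Sample n) (k : ℕ) : ℝ :=
  ∑ j ∈ Finset.range k, τ (w.1 j) * w.2 j

lemma clock_succ (τ : Cube n → ℝ) (w : Sample n) (k : ℕ) :
    clock τ w (k + 1) = clock τ w k + τ (w.1 k) * w.2 k := Finset.sum_range_succ _ _

@[fun_prop]
lemma measurable_clock (τ : Cube n → ℝ) (k : ℕ) : Measurable fun w => clock τ w k := by
  unfold clock
  refine Finset.measurable_sum _ fun j _ => ?_
  have h1 : Measurable fun w : Sample n => τ (w.1 j) :=
    (measurable_of_finite τ).comp ((measurable_pi_apply j).comp measurable_fst)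
  have h2 : Measurable fun w : Sample n => w.2 j := (measurable_pi_apply j).comp measurable_snd
  exact h1.mul h2

lemma jumpTime_rate (hn : 1 ≤ n) (β : ℝ) (H : Cube n → ℝ) {w : Sample n} (hw : ∀ i, 0 < w.2 i)
    (k : ℕ) : jumpTime (rate β H) w k = ENNReal.ofReal (clock (tau β H) w k) := by
  unfold jumpTime clock
  rw [ENNReal.ofReal_sum_of_nonneg fun i _ => mul_nonneg (tau_pos β H _).le (hw i).le]
  refine Finset.sum_congr rfl fun i _ => ?_
  have ht := tau_pos β H (w.1 i)
  rw [exitRate_rate hn]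
  change _ / ENNReal.ofReal _ = _
  rw [← ENNReal.ofReal_div_of_pos (inv_pos.2 ht), div_inv_eq_mul, mul_comm]

lemma clock_strictMono {τ : Cube n → ℝ} (hτ : ∀ x, 0 < τ x) {w : Sample n} (hw : ∀ i, 0 < w.2 i) :
    StrictMono (clock τ w) :=
  strictMono_nat_of_lt_succ fun k => by
    rw [clock_succ]; linarith [mul_pos (hτ (w.1 k)) (hw k)]

lemma X_eq_of_clock (hn : 1 ≤ n) (β : ℝ) (H : Cube n → ℝ) {w : Sample n} (hw : ∀ i, 0 < w.2 i)
    {i : ℕ} {u : ℝ} (h1 : clock (tau β H) w i ≤ u) (h2 : u < clock (tau β H) w (i + 1)) :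
    X (rate β H) u w = w.1 i := by
  have hmono := clock_strictMono (tau_pos β H) hw
  have h0 : 0 ≤ u := by
    have : clock (tau β H) w 0 ≤ clock (tau β H) w i := hmono.monotone (Nat.zero_le i)
    simp only [clock, Finset.range_zero, Finset.sum_empty] at this
    exact this.trans h1
  have : {k : ℕ | jumpTime (rate β H) w k ≤ ENNReal.ofReal u} = Set.Iic i := by
    ext k
    simp only [Set.mem_ofPred_eq, Set.mem_Iic, jumpTime_rate hn β H hw,
      ENNReal.ofReal_le_ofReal_iff h0]
    constructor
    · intro h
      by_contra hk
      exact absurd (h.trans_lt h2) (not_lt.2 (hmono.monotone (by omega : i + 1 ≤ k)))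
    · intro h; exact (hmono.monotone h).trans h1
  rw [X, this, csSup_Iic]

/-- `n` minus the inner product is a sum of nonnegative terms `1 - x i * y i`, each vanishing only
when the coordinates agree. -/
lemma innerProd_eq_iff (hn : 1 ≤ n) (x y : Cube n) : (n : ℝ)⁻¹ * innerProd x y = 1 ↔ x = y := by
  have hn' : (n : ℝ) ≠ 0 := by positivity
  have hu : ∀ u v : ℤˣ, 0 ≤ 1 - ((u : ℤ) : ℝ) * ((v : ℤ) : ℝ) ∧
      (1 - ((u : ℤ) : ℝ) * ((v : ℤ) : ℝ) = 0 ↔ u = v) := by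
    intro u v
    rcases Int.units_eq_one_or u with rfl | rfl <;> rcases Int.units_eq_one_or v with rfl | rfl <;>
      norm_num
  have hs : innerProd x y = n - ∑ i, (1 - ((x i : ℤ) : ℝ) * ((y i : ℤ) : ℝ)) := by
    rw [Finset.sum_sub_distrib]; simp [innerProd]
  rw [inv_mul_eq_one₀ hn', hs, eq_comm, sub_eq_self,
    Finset.sum_eq_zero_iff_of_nonneg fun i _ => (hu _ _).1]
  constructor
  · intro h; funext i; exact (hu _ _).2.1 (h i (Finset.mem_univ i))
  · rintro rfl i _; exact (hu _ _).2.2 rfl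

/-- The event that the `i`-th step of the clock process straddles the interval `(p, q)`. -/
def gap (τ : Cube n → ℝ) (p q : ℝ) (i : ℕ) : Set (Sample n) :=
  {w | clock τ w i ≤ p ∧ q ≤ clock τ w (i + 1)}

lemma measurableSet_gap (τ : Cube n → ℝ) (p q : ℝ) (i : ℕ) : MeasurableSet (gap τ p q i) :=
  (measurableSet_le (measurable_clock τ i) measurable_const).inter
    (measurableSet_le measurable_const (measurable_clock τ (i + 1)))

lemma ae_dynLaw_good (hn : 1 ≤ n) :
    ∀ᵐ w ∂dynLaw n, (∀ i, 0 < w.2 i) ∧ ∀ k, w.1 (k + 1) ≠ w.1 k := by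
  have h1 : ∀ᵐ w ∂dynLaw n, ∀ i, 0 < w.2 i :=
    (Measure.quasiMeasurePreserving_snd (μ := walkLaw n) (ν := expLaw)).ae ae_expLaw_pos
  have h2 : ∀ᵐ w ∂dynLaw n, ∀ k, w.1 (k + 1) ≠ w.1 k :=
    (Measure.quasiMeasurePreserving_fst (μ := walkLaw n) (ν := expLaw)).ae (ae_walkLaw_step hn)
  filter_upwards [h1, h2] with w a b using ⟨a, b⟩

/-- For positive holding times the clock is strictly increasing, so the gap events of different
steps are disjoint, and on each of them the process rests throughout the window. A jump exactly at
`c (t + s)` does no harm because the window is half-open. -/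
lemma sum_gap_le_corr (hn : 1 ≤ n) (β : ℝ) (H : Cube n → ℝ) {c t s : ℝ} (hc : 0 < c) (hs : 0 < s)
    (k : ℕ) :
    ∑ i ∈ Finset.range k, (dynLaw n).real (gap (tau β H) (c * t) (c * (t + s)) i) ≤
      corr β H c t s := by
  set τ := tau β H
  have hpq : c * t < c * (t + s) := by nlinarith
  set A : Set (Sample n) := {w | ∀ i, 0 < w.2 i} with hA
  have hAm : MeasurableSet A := by
    rw [hA, Set.ofPred_forall]
    exact MeasurableSet.iInter fun i => measurableSet_lt measurable_const
      ((measurable_pi_apply i).comp measurable_snd)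
  have hAae : ∀ᵐ w ∂dynLaw n, w ∈ A := (ae_dynLaw_good hn).mono fun w hw => hw.1
  have h1 : ∀ i, (dynLaw n).real (gap τ (c * t) (c * (t + s)) i) =
      (dynLaw n).real (gap τ (c * t) (c * (t + s)) i ∩ A) := by
    intro i
    refine measureReal_congr ?_
    filter_upwards [hAae] with w hw
    simp only [eq_iff_iff]
    exact ⟨fun h => ⟨h, hw⟩, fun h => h.1⟩
  simp_rw [h1]
  rw [← measureReal_biUnion_finset]
  · unfold corr
    rw [law_rate hn]
    refine measureReal_mono ?_
    intro w hw
    simp only [Set.mem_iUnion] at hw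
    obtain ⟨i, _, ⟨hw1, hw2⟩, hw3⟩ := hw
    intro u hu1 hu2
    have hu1' : c * t ≤ c * u := by gcongr
    have hu2' : c * u < c * (t + s) := by gcongr
    rw [X_eq_of_clock hn β H hw3 hw1 (by linarith), X_eq_of_clock hn β H hw3
      (hw1.trans hu1') (by linarith), innerProd_eq_iff hn]
  · intro i _ j _ hij
    wlog h : i < j generalizing i j
    · exact (this (by assumption) (by assumption) hij.symm (by omega)).symm
    refine Set.disjoint_left.2 fun w hw1 hw2 => ?_
    have := (clock_strictMono (τ := τ) (tau_pos β H) hw1.2).monotone (by omega : i + 1 ≤ j)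
    linarith [hw1.1.2, hw2.1.1]
  · exact fun i _ => (measurableSet_gap _ _ _ _).inter hAm

/-- Either the clock has not passed `c t` after `k` steps, or one of the first `k` steps is under
way at time `c t`, and staying at one vertex forces this step to outlast the window. -/
lemma corr_le_sum_gap (hn : 1 ≤ n) (β : ℝ) (H : Cube n → ℝ) {c t s : ℝ} (hc : 0 < c) (ht : 0 < t)
    (k : ℕ) :
    corr β H c t s ≤
      ∑ i ∈ Finset.range k, (dynLaw n).real (gap (tau β H) (c * t) (c * (t + s)) i) +
      (dynLaw n).real {w | clock (tau β H) w k ≤ c * t} := by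
  set τ := tau β H with hτ
  unfold corr
  rw [law_rate hn]
  refine le_trans ?_ (add_le_add (measureReal_biUnion_finset_le _ _) le_rfl)
  refine le_trans ?_ (measureReal_union_le _ _)
  refine ENNReal.toReal_mono (measure_ne_top _ _) (measure_mono_ae ?_)
  filter_upwards [ae_dynLaw_good hn] with w ⟨hw1, hw2⟩ hE
  have hmono := clock_strictMono (τ := τ) (tau_pos β H) hw1
  by_cases hk : clock τ w k ≤ c * t
  · exact Or.inr hk
  left
  have hex : ∃ j, c * t < clock τ w j := ⟨k, not_le.1 hk⟩
  classical
  obtain ⟨i, hi⟩ : ∃ i, Nat.find hex = i + 1 := by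
    refine Nat.exists_eq_succ_of_ne_zero fun h0 => ?_
    have := Nat.find_spec hex
    rw [h0] at this
    simp only [clock, Finset.range_zero, Finset.sum_empty] at this
    nlinarith
  have hi1 : clock τ w i ≤ c * t := not_lt.1 (Nat.find_min hex (by omega))
  have hi2 : c * t < clock τ w (i + 1) := hi ▸ Nat.find_spec hex
  have hik : i < k := by
    by_contra h
    exact hk ((hmono.monotone (not_lt.1 h)).trans hi1)
  have : w ∈ gap τ (c * t) (c * (t + s)) i := by
    refine ⟨hi1, ?_⟩
    by_contra h
    have h := not_le.1 h
    have hu : c * (clock τ w (i + 1) / c) = clock τ w (i + 1) := by field_simp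
    -- If the next jump fell inside the window, the event at the very time of this jump would equate
    -- two consecutive states of the walk.
    have h3 := hE (clock τ w (i + 1) / c) (by rw [le_div_iff₀ hc]; linarith)
      (by rw [div_lt_iff₀ hc]; linarith)
    rw [hu, X_eq_of_clock hn β H hw1 hi1 hi2, X_eq_of_clock hn β H hw1 le_rfl
      (hmono (Nat.lt_succ_self _)), innerProd_eq_iff hn] at h3
    exact hw2 i h3.symm
  exact Set.mem_biUnion (Finset.mem_coe.2 (Finset.mem_range.2 hik)) this

end Clock

end REM

namespace REM

open JumpProcess

/-! ### Estimates in a fixed environment -/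

section Quenched

variable {n : ℕ}

/-- The average of a function over the cube. -/
noncomputable def cubeAvg (f : Cube n → ℝ) : ℝ := (2 ^ n : ℝ)⁻¹ * ∑ x, f x

lemma cubeAvg_nonneg {f : Cube n → ℝ} (hf : ∀ x, 0 ≤ f x) : 0 ≤ cubeAvg f :=
  mul_nonneg (by positivity) (Finset.sum_nonneg fun x _ => hf x)

lemma ofReal_cubeAvg {f : Cube n → ℝ} (hf : ∀ x, 0 ≤ f x) :
    ENNReal.ofReal (cubeAvg f) = (2 ^ n : ℝ≥0∞)⁻¹ * ∑ x, ENNReal.ofReal (f x) := by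
  rw [cubeAvg, ENNReal.ofReal_mul (by positivity), ENNReal.ofReal_sum_of_nonneg fun x _ => hf x,
    ENNReal.ofReal_inv_of_pos (by positivity), ENNReal.ofReal_pow (by norm_num)]
  simp

/-- The probability that the holding time at a uniformly chosen vertex is at least `z`. -/
noncomputable def trapProb (τ : Cube n → ℝ) (z : ℝ) : ℝ :=
  cubeAvg fun x => Real.exp (-(z / τ x))

lemma trapProb_nonneg (τ : Cube n → ℝ) (z : ℝ) : 0 ≤ trapProb τ z :=
  cubeAvg_nonneg fun _ => (Real.exp_pos _).le

/-- The event that the `i`-th holding time is at least `z`. -/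
def holds (τ : Cube n → ℝ) (z : ℝ) (i : ℕ) : Set (Sample n) := {w | z ≤ τ (w.1 i) * w.2 i}

lemma measurable_eval (σ : Cube n → ℝ) (j : ℕ) : Measurable fun w : Sample n => σ (w.1 j) :=
  (measurable_of_finite σ).comp ((measurable_pi_apply j).comp measurable_fst)

lemma measurable_hold (σ : Cube n → ℝ) (j : ℕ) :
    Measurable fun w : Sample n => σ (w.1 j) * w.2 j :=
  (measurable_eval σ j).mul ((measurable_pi_apply j).comp measurable_snd)

lemma measurableSet_holds (τ : Cube n → ℝ) (z : ℝ) (i : ℕ) : MeasurableSet (holds τ z i) :=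
  measurableSet_le measurable_const (measurable_hold τ i)

lemma dynLaw_apply_right {A : Set (Sample n)} (hA : MeasurableSet A) :
    dynLaw n A = ∫⁻ e, ∫⁻ J, A.indicator 1 (J, e) ∂walkLaw n ∂expLaw := by
  rw [← lintegral_indicator_one hA, dynLaw, lintegral_prod_symm]
  exact (measurable_one.indicator hA).aemeasurable

lemma dynLaw_apply_left {A : Set (Sample n)} (hA : MeasurableSet A) :
    dynLaw n A = ∫⁻ J, expLaw {e | (J, e) ∈ A} ∂walkLaw n := by
  rw [dynLaw, Measure.prod_apply hA]; rfl

/-- Decoupling of the clock process from a much later holding time. -/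
lemma dynLaw_clock_inter_holds_le (hn : 1 ≤ n) {τ : Cube n → ℝ} (hτ : ∀ x, 0 < τ x) {z : ℝ}
    (hz : 0 ≤ z) (σ : Cube n → ℝ) {B : Set ℝ} (hB : MeasurableSet B) {a i : ℕ}
    (hai : a + n ^ 2 ≤ i) :
    dynLaw n ({w | clock σ w a ∈ B} ∩ holds τ z i) ≤
      3 * ENNReal.ofReal (trapProb τ z) * dynLaw n {w | clock σ w a ∈ B} := by
  have hA : MeasurableSet {w : Sample n | clock σ w a ∈ B} := measurable_clock σ a hB
  have hai' : a ≤ i := by have := Nat.pos_of_ne_zero (n := n) (by omega); nlinarith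
  -- The clock at `a` depends only on the walk up to `a` and on the `e j` with `j < a`. With the
  -- exponentials frozen, the walk is integrated first and `J i` is compared with a uniform vertex
  -- at the cost of a factor `3`; then `e i` splits off by independence.
  let F : (Finset.range a → ℝ) → ((j : Finset.Iic a) → Cube n) → ℝ≥0∞ := fun e h =>
    B.indicator 1 (∑ j : Finset.range a,
      σ (h ⟨j.1, Finset.mem_Iic.2 (Finset.mem_range.1 j.2).le⟩) * e j)
  have hFm : Measurable (Function.uncurry F) := by
    refine (measurable_one.indicator hB).comp ?_
    have hσ : Measurable σ := measurable_of_finite σ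
    fun_prop
  have hFc : ∀ J e, F (fun j => e j) (Preorder.frestrictLe a J) =
      {w : Sample n | clock σ w a ∈ B}.indicator 1 (J, e) := by
    intro J e
    have : ∑ j : Finset.range a, σ (J j.1) * e j = clock σ (J, e) a := by
      rw [clock, ← Finset.sum_coe_sort (Finset.range a)]
    simp only [F, Preorder.frestrictLe_apply, this]
    rfl
  let G : (Finset.range a → ℝ) → ℝ≥0∞ := fun e =>
    ∫⁻ J, F e (Preorder.frestrictLe a J) ∂walkLaw n
  have hG : Measurable G := by
    refine Measurable.lintegral_prod_right'
      (f := fun p : (Finset.range a → ℝ) × (ℕ → Cube n) => F p.1 (Preorder.frestrictLe a p.2)) ?_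
    have h2 : Measurable fun p : (Finset.range a → ℝ) × (ℕ → Cube n) =>
        (p.1, Preorder.frestrictLe (π := fun _ => Cube n) a p.2) := by fun_prop
    exact hFm.comp h2
  rw [dynLaw_apply_right (hA.inter (measurableSet_holds τ z i)), dynLaw_apply_right hA]
  have h1 : ∀ e J, ({w : Sample n | clock σ w a ∈ B} ∩ holds τ z i).indicator
      (1 : Sample n → ℝ≥0∞) (J, e) = F (fun j => e j) (Preorder.frestrictLe a J) *
        (Set.Ici (z / τ (J i))).indicator 1 (e i) := by
    intro e J
    rw [hFc, Set.inter_indicator_one, Pi.mul_apply]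
    congr 1
    simp only [Set.indicator, holds, Set.mem_ofPred_eq, Set.mem_Ici, div_le_iff₀' (hτ _)]
    rfl
  simp_rw [h1, ← hFc]
  calc ∫⁻ e, ∫⁻ J, F (fun j => e j) (Preorder.frestrictLe a J) *
          (Set.Ici (z / τ (J i))).indicator 1 (e i) ∂walkLaw n ∂expLaw
      ≤ ∫⁻ e, 3 * ((2 ^ n : ℝ≥0∞)⁻¹ * ∑ x, (Set.Ici (z / τ x)).indicator 1 (e i)) *
          G (fun j => e j) ∂expLaw := by
        refine lintegral_mono fun e => ?_
        exact lintegral_walkLaw_decouple hn hai (F fun j => e j)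
          (hFm.comp (measurable_const.prodMk measurable_id))
          fun x => (Set.Ici (z / τ x)).indicator 1 (e i)
    _ = 3 * (2 ^ n : ℝ≥0∞)⁻¹ * ∑ x, ∫⁻ e, G (fun j => e j) *
          (Set.Ici (z / τ x)).indicator 1 (e i) ∂expLaw := by
        rw [← lintegral_finsetSum, ← lintegral_const_mul]
        · refine lintegral_congr fun e => ?_
          rw [← Finset.mul_sum]; ring
        · refine Finset.measurable_sum _ fun x _ => ?_
          exact (hG.comp (by fun_prop)).mul
            ((measurable_one.indicator measurableSet_Ici).comp (measurable_pi_apply i))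
        · intro x _
          exact (hG.comp (by fun_prop)).mul
            ((measurable_one.indicator measurableSet_Ici).comp (measurable_pi_apply i))
    _ = 3 * (2 ^ n : ℝ≥0∞)⁻¹ * ∑ x, (∫⁻ e, G (fun j => e j) ∂expLaw) *
          ENNReal.ofReal (Real.exp (-(z / τ x))) := by
        congr 1
        refine Finset.sum_congr rfl fun x _ => ?_
        rw [lintegral_expLaw_mul i a hai' G hG _ (measurable_one.indicator measurableSet_Ici)]
        congr 1
        rw [lintegral_expLaw_apply i (measurable_one.indicator measurableSet_Ici),
          lintegral_indicator_one measurableSet_Ici,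
          expMeasure_Ici (div_nonneg hz (hτ x).le)]
    _ = _ := by
        rw [trapProb, ofReal_cubeAvg fun x => (Real.exp_pos _).le, ← Finset.mul_sum]
        ring

lemma dynLaw_holds (hn : 1 ≤ n) {τ : Cube n → ℝ} (hτ : ∀ x, 0 < τ x) {z : ℝ}
    (hz : 0 ≤ z) (i : ℕ) : dynLaw n (holds τ z i) = ENNReal.ofReal (trapProb τ z) := by
  rw [dynLaw_apply_left (measurableSet_holds τ z i)]
  have h1 : ∀ J : ℕ → Cube n, expLaw {e | (J, e) ∈ holds τ z i} =
      ENNReal.ofReal (Real.exp (-(z / τ (J i)))) := by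
    intro J
    rw [← expLaw_le_apply i (div_nonneg hz (hτ _).le)]
    congr 1
    ext e
    exact (div_le_iff₀' (hτ (J i))).symm
  simp_rw [h1]
  rw [lintegral_walkLaw_apply hn i fun x => ENNReal.ofReal (Real.exp (-(z / τ x))), trapProb,
    ofReal_cubeAvg fun x => (Real.exp_pos _).le]

/-- By stationarity the vertex is uniform, and the bound on the return probability does not depend
on the vertex, so the two effects multiply. -/
lemma dynLaw_return_inter_holds (hn : 1 ≤ n) {τ : Cube n → ℝ} (hτ : ∀ x, 0 < τ x) {z : ℝ}
    (hz : 0 ≤ z) (j d : ℕ) :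
    dynLaw n ({w | w.1 j = w.1 (j + d)} ∩ holds τ z (j + d)) ≤
      ENNReal.ofReal (eigMoment n d * trapProb τ z) := by
  classical
  have hm : MeasurableSet {w : Sample n | w.1 j = w.1 (j + d)} :=
    measurableSet_eq_fun (by fun_prop) (by fun_prop)
  rw [dynLaw_apply_left (hm.inter (measurableSet_holds τ z _))]
  have h1 : ∀ J : ℕ → Cube n, expLaw {e | (J, e) ∈
      ({w | w.1 j = w.1 (j + d)} ∩ holds τ z (j + d) : Set (Sample n))} ≤
      if J j = J (j + d) then ENNReal.ofReal (Real.exp (-(z / τ (J (j + d))))) else 0 := by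
    intro J
    split_ifs with h
    · rw [← expLaw_le_apply (j + d) (div_nonneg hz (hτ _).le)]
      exact measure_mono fun e he => (div_le_iff₀' (hτ _)).2 he.2
    · have : {e | (J, e) ∈ ({w | w.1 j = w.1 (j + d)} ∩ holds τ z (j + d) : Set (Sample n))} = ∅ :=
        Set.eq_empty_of_forall_notMem fun e he => h he.1
      rw [this]; simp
  refine (lintegral_mono h1).trans ?_
  rw [lintegral_walkLaw_apply_two hn j d
    fun x y => if x = y then ENNReal.ofReal (Real.exp (-(z / τ y))) else 0,
    ENNReal.ofReal_mul (eigMoment_nonneg _ _), trapProb,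
    ofReal_cubeAvg fun x => (Real.exp_pos _).le, mul_left_comm]
  gcongr
  rw [Finset.mul_sum]
  refine Finset.sum_le_sum fun x _ => ?_
  simp only [ite_mul, zero_mul, Finset.sum_ite_eq, Finset.mem_univ, if_true]
  rw [mul_comm]
  gcongr
  exact walkMatrix_pow_le_eigMoment hn d x x

/-- The probability that two distinct vertices visited at two times at distance `d` both have long
holding times. -/
noncomputable def closePair (τ : Cube n → ℝ) (y z : ℝ) (d : ℕ) : ℝ :=
  cubeAvg fun x => ∑ x', if x = x' then 0 else
    Real.exp (-(y / τ x)) * Real.exp (-(z / τ x')) * (walkMatrix n ^ d) x x'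

lemma closePair_nonneg (τ : Cube n → ℝ) (y z : ℝ) (d : ℕ) : 0 ≤ closePair τ y z d := by
  refine cubeAvg_nonneg fun x => Finset.sum_nonneg fun x' _ => ?_
  have := walkMatrix_pow_nonneg d x x'
  split_ifs <;> positivity

lemma dynLaw_closePair (hn : 1 ≤ n) {τ : Cube n → ℝ} (hτ : ∀ x, 0 < τ x) {y z : ℝ}
    (hy : 0 ≤ y) (hz : 0 ≤ z) (j d : ℕ) (hd : d ≠ 0) :
    dynLaw n ({w | w.1 j ≠ w.1 (j + d)} ∩ (holds τ y j ∩ holds τ z (j + d))) ≤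
      ENNReal.ofReal (closePair τ y z d) := by
  classical
  have hm : MeasurableSet {w : Sample n | w.1 j ≠ w.1 (j + d)} :=
    (measurableSet_eq_fun (by fun_prop) (by fun_prop)).compl
  rw [dynLaw_apply_left (hm.inter ((measurableSet_holds τ y _).inter (measurableSet_holds τ z _)))]
  have h1 : ∀ J : ℕ → Cube n, expLaw {e | (J, e) ∈
      ({w | w.1 j ≠ w.1 (j + d)} ∩ (holds τ y j ∩ holds τ z (j + d)) : Set (Sample n))} ≤
      if J j = J (j + d) then 0 else ENNReal.ofReal (Real.exp (-(y / τ (J j)))) *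
        ENNReal.ofReal (Real.exp (-(z / τ (J (j + d))))) := by
    intro J
    split_ifs with h
    · have : {e | (J, e) ∈ ({w | w.1 j ≠ w.1 (j + d)} ∩ (holds τ y j ∩ holds τ z (j + d)) :
          Set (Sample n))} = ∅ := Set.eq_empty_of_forall_notMem fun e he => he.1 h
      rw [this]; simp
    · rw [← expLaw_le_apply_two (show j ≠ j + d by omega) (div_nonneg hy (hτ _).le)
        (div_nonneg hz (hτ _).le)]
      exact measure_mono fun e he =>
        ⟨(div_le_iff₀' (hτ _)).2 he.2.1, (div_le_iff₀' (hτ _)).2 he.2.2⟩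
  refine (lintegral_mono h1).trans ?_
  rw [lintegral_walkLaw_apply_two hn j d
    fun x x' => if x = x' then 0 else ENNReal.ofReal (Real.exp (-(y / τ x))) *
        ENNReal.ofReal (Real.exp (-(z / τ x'))), closePair, ofReal_cubeAvg]
  · gcongr with x
    rw [ENNReal.ofReal_sum_of_nonneg]
    · refine Finset.sum_le_sum fun x' _ => ?_
      split_ifs
      · simp
      · rw [ENNReal.ofReal_mul (by positivity), ENNReal.ofReal_mul (by positivity)]
    · intro x' _
      have := walkMatrix_pow_nonneg d x x'
      split_ifs <;> positivity
  · intro x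
    refine Finset.sum_nonneg fun x' _ => ?_
    have := walkMatrix_pow_nonneg d x x'
    split_ifs <;> positivity

/-- The mean holding times truncated from above at level `L`. -/
noncomputable def lowPart (L : ℝ) (τ : Cube n → ℝ) (x : Cube n) : ℝ := if τ x ≤ L then τ x else 0

/-- The mean holding times above the level `L`. -/
noncomputable def highPart (L : ℝ) (τ : Cube n → ℝ) (x : Cube n) : ℝ := if τ x ≤ L then 0 else τ x

lemma clock_eq_low_add_high (L : ℝ) (τ : Cube n → ℝ) (w : Sample n) (k : ℕ) :
    clock τ w k = clock (lowPart L τ) w k + clock (highPart L τ) w k := by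
  unfold clock
  rw [← Finset.sum_add_distrib]
  refine Finset.sum_congr rfl fun j _ => ?_
  rw [← add_mul]
  congr 1
  unfold lowPart highPart
  split_ifs <;> simp

/-- The normalised contribution of the holding times above `L`, those above `c` being counted
as `1`. -/
noncomputable def highWeight (L c : ℝ) (r : ℝ) : ℝ :=
  if r ≤ L then 0 else if r ≤ c then r / c else 1

lemma highWeight_nonneg {L c r : ℝ} (hc : 0 < c) (hr : 0 ≤ r) : 0 ≤ highWeight L c r := by
  unfold highWeight; split_ifs <;> positivity

lemma highWeight_le_one {L c r : ℝ} (hc : 0 < c) : highWeight L c r ≤ 1 := by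
  unfold highWeight
  split_ifs with h1 h2
  · norm_num
  · rw [div_le_one hc]; exact h2
  · exact le_rfl

/-- Paths that visit a vertex above both `L` and `c` are given up: there the weight is `1` and `4 /
δ ≥ 1` covers the whole probability. For the other paths Markov's inequality applies to the
exponential variables, and stationarity turns the sum over the path into a cube average. -/
lemma dynLaw_high_clock_le (hn : 1 ≤ n) {τ : Cube n → ℝ} (hτ : ∀ x, 0 < τ x) {L c δ : ℝ}
    (hc : 0 < c) (hδ : 0 < δ) (hδ4 : δ ≤ 4) (a : ℕ) :
    dynLaw n {w | δ * c / 4 < clock (highPart L τ) w a} ≤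
      ENNReal.ofReal (4 / δ * a * cubeAvg fun x => highWeight L c (τ x)) := by
  classical
  set φ : Cube n → ℝ := fun x => highWeight L c (τ x) with hφ
  have hφ0 : ∀ x, 0 ≤ φ x := fun x => highWeight_nonneg hc (hτ x).le
  have hdc : 0 < δ * c / 4 := by positivity
  have hstep : ∀ J : ℕ → Cube n, expLaw {e | (J, e) ∈
      ({w | δ * c / 4 < clock (highPart L τ) w a} : Set (Sample n))} ≤
      ∑ j ∈ Finset.range a, ENNReal.ofReal (4 / δ * φ (J j)) := by
    intro J
    by_cases hbig : ∃ j ∈ Finset.range a, c < τ (J j) ∧ L < τ (J j)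
    · obtain ⟨j, hj, hcj, hLj⟩ := hbig
      refine prob_le_one.trans ?_
      refine le_trans ?_ (Finset.single_le_sum (f := fun j => ENNReal.ofReal (4 / δ * φ (J j)))
        (fun _ _ => zero_le) hj)
      have : φ (J j) = 1 := by
        simp only [hφ, highWeight]; rw [if_neg (not_le.2 hLj), if_neg (not_le.2 hcj)]
      rw [this, mul_one, ← ENNReal.ofReal_one]
      exact ENNReal.ofReal_le_ofReal (by rw [le_div_iff₀ hδ]; linarith)
    · push Not at hbig
      have hval : ∀ j ∈ Finset.range a, highPart L τ (J j) = c * φ (J j) := by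
        intro j hj
        simp only [hφ, highWeight, highPart]
        split_ifs with h1 h2
        · simp
        · field_simp
        · exact absurd (hbig j hj (not_le.1 h2)) h1
      have hsub : {e | (J, e) ∈ ({w | δ * c / 4 < clock (highPart L τ) w a} : Set (Sample n))} ⊆
          {e | ENNReal.ofReal (δ * c / 4) ≤
            ∑ j ∈ Finset.range a, ENNReal.ofReal (c * φ (J j)) * ENNReal.ofReal (e j)} := by
        intro e he
        have he' : δ * c / 4 < ∑ j ∈ Finset.range a, highPart L τ (J j) * e j := he
        rw [Set.mem_ofPred_eq]
        -- Positive parts are taken because the exponential variables are positive only almost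
        -- surely.
        have h2 : ∑ j ∈ Finset.range a, highPart L τ (J j) * e j ≤
            ∑ j ∈ Finset.range a, c * φ (J j) * max (e j) 0 := by
          refine Finset.sum_le_sum fun j hj => ?_
          rw [hval j hj]
          exact mul_le_mul_of_nonneg_left (le_max_left _ _) (mul_nonneg hc.le (hφ0 _))
        refine (ENNReal.ofReal_le_ofReal (he'.le.trans h2)).trans ?_
        rw [ENNReal.ofReal_sum_of_nonneg
          fun j _ => mul_nonneg (mul_nonneg hc.le (hφ0 _)) (le_max_right _ _)]
        refine Finset.sum_le_sum fun j _ => ?_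
        rw [ENNReal.ofReal_mul (mul_nonneg hc.le (hφ0 _))]
        refine mul_le_mul' le_rfl ?_
        rcases le_total (e j) 0 with h | h
        · rw [max_eq_right h, ENNReal.ofReal_zero]; exact zero_le
        · rw [max_eq_left h]
      refine (measure_mono hsub).trans ?_
      have hme : ∀ (v : ℝ≥0∞) (j : ℕ), Measurable fun e : ℕ → ℝ => v * ENNReal.ofReal (e j) :=
        fun v j => by fun_prop
      have hmk := mul_meas_ge_le_lintegral₀ (μ := expLaw) (f := fun e : ℕ → ℝ =>
        ∑ j ∈ Finset.range a, ENNReal.ofReal (c * φ (J j)) * ENNReal.ofReal (e j))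
        (Finset.aemeasurable_fun_sum _ fun j _ => (hme _ j).aemeasurable)
        (ENNReal.ofReal (δ * c / 4))
      rw [lintegral_finsetSum _ fun j _ => hme _ j] at hmk
      have hone : ∀ j, ∫⁻ e, ENNReal.ofReal (c * φ (J j)) * ENNReal.ofReal (e j) ∂expLaw =
          ENNReal.ofReal (c * φ (J j)) := by
        intro j
        rw [lintegral_const_mul _ (by fun_prop),
          lintegral_expLaw_apply j (f := fun x => ENNReal.ofReal x) (by fun_prop)]
        have := lintegral_pow_expMeasure 1
        simp only [pow_one] at this
        rw [this]; simp
      simp_rw [hone] at hmk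
      rw [← ENNReal.ofReal_sum_of_nonneg fun j _ => mul_nonneg hc.le (hφ0 _)] at hmk
      rw [← ENNReal.ofReal_sum_of_nonneg fun j _ => mul_nonneg (by positivity) (hφ0 _)]
      rw [mul_comm, ← ENNReal.le_div_iff_mul_le (Or.inl (by simpa using hdc))
        (Or.inl ENNReal.ofReal_ne_top), ← ENNReal.ofReal_div_of_pos hdc] at hmk
      refine hmk.trans (ENNReal.ofReal_le_ofReal (le_of_eq ?_))
      rw [← Finset.mul_sum, ← Finset.mul_sum]
      field_simp
  rw [dynLaw_apply_left (measurableSet_lt measurable_const (measurable_clock _ _))]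
  refine (lintegral_mono hstep).trans ?_
  rw [lintegral_finsetSum]
  · have h2 : ∀ j, ∫⁻ J, ENNReal.ofReal (4 / δ * φ (J j)) ∂walkLaw n =
        ENNReal.ofReal (4 / δ * cubeAvg φ) := by
      intro j
      rw [lintegral_walkLaw_apply hn j fun x => ENNReal.ofReal (4 / δ * φ x),
        ← ofReal_cubeAvg fun x => mul_nonneg (by positivity) (hφ0 x)]
      congr 1
      unfold cubeAvg
      rw [← Finset.mul_sum]; ring
    simp_rw [h2]
    rw [Finset.sum_const, Finset.card_range, nsmul_eq_mul, ← ENNReal.ofReal_natCast,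
      ← ENNReal.ofReal_mul (by positivity)]
    exact ENNReal.ofReal_le_ofReal (le_of_eq (by ring))
  · intro j _
    exact (measurable_of_finite fun x => ENNReal.ofReal (4 / δ * φ x)).comp (measurable_pi_apply j)

end Quenched

end REM

namespace REM

open JumpProcess

/-! ### Comparison of the correlation function with sums of trapping probabilities in a fixed
landscape -/

section QuenchedBounds

variable {n : ℕ}

/-- The event that the clock of the truncated holding times is far from its mean. -/
def lowDev (τ : Cube n → ℝ) (L m y : ℝ) (i : ℕ) : Set (Sample n) :=
  {w | y < |clock (lowPart L τ) w i - i * m|}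

/-- One of the last `n ^ 2` holding times must exceed `y`. Its vertex is either the present one,
which is a return, or a different one, which gives a close pair; the union is over the time
difference `d + 1`. -/
lemma dynLaw_near_inter_holds_le (hn : 1 ≤ n) {τ : Cube n → ℝ} (hτ : ∀ x, 0 < τ x) {y z : ℝ}
    (hy : 0 ≤ y) (hz : 0 ≤ z) (i : ℕ) :
    dynLaw n ({w | n ^ 2 * y < ∑ j ∈ Finset.Ico (i - n ^ 2) i, τ (w.1 j) * w.2 j} ∩ holds τ z i) ≤
      ENNReal.ofReal (trapProb τ z * returnBound n +
        ∑ d ∈ Finset.range (n ^ 2), closePair τ y z (d + 1)) := by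
  have hsub : ({w | n ^ 2 * y < ∑ j ∈ Finset.Ico (i - n ^ 2) i, τ (w.1 j) * w.2 j} ∩ holds τ z i :
      Set (Sample n)) ⊆ ⋃ d ∈ (Finset.range (n ^ 2)).filter (fun d => d + 1 ≤ i),
      (({w | w.1 (i - (d + 1)) = w.1 i} ∩ holds τ z i) ∪
      ({w | w.1 (i - (d + 1)) ≠ w.1 i} ∩ (holds τ y (i - (d + 1)) ∩ holds τ z i))) := by
    rintro w ⟨hw1, hw2⟩
    have hex : ∃ j ∈ Finset.Ico (i - n ^ 2) i, y < τ (w.1 j) * w.2 j := by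
      by_contra! hcon
      have h1 := Finset.sum_le_card_nsmul _ _ _ hcon
      rw [Nat.card_Ico, nsmul_eq_mul] at h1
      have h2 : ((i - (i - n ^ 2) : ℕ) : ℝ) ≤ (n : ℝ) ^ 2 := by
        exact_mod_cast (by omega : i - (i - n ^ 2) ≤ n ^ 2)
      have h3 : ((i - (i - n ^ 2) : ℕ) : ℝ) * y ≤ (n : ℝ) ^ 2 * y := by gcongr
      exact absurd hw1 (not_lt.2 (h1.trans h3))
    obtain ⟨j, hj, hjy⟩ := hex
    rw [Finset.mem_Ico] at hj
    refine Set.mem_biUnion (x := i - j - 1) ?_ ?_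
    · simp only [Finset.coe_filter, Finset.mem_range, Set.mem_ofPred_eq]
      omega
    · rw [show i - (i - j - 1 + 1) = j by omega]
      by_cases h : w.1 j = w.1 i
      · exact Or.inl ⟨h, hw2⟩
      · exact Or.inr ⟨h, hjy.le, hw2⟩
  refine (measure_mono hsub).trans ((measure_biUnion_finset_le _ _).trans ?_)
  have hterm : ∀ d ∈ (Finset.range (n ^ 2)).filter (fun d => d + 1 ≤ i),
      dynLaw n (({w | w.1 (i - (d + 1)) = w.1 i} ∩ holds τ z i) ∪
      ({w | w.1 (i - (d + 1)) ≠ w.1 i} ∩ (holds τ y (i - (d + 1)) ∩ holds τ z i))) ≤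
      ENNReal.ofReal (eigMoment n (d + 1) * trapProb τ z + closePair τ y z (d + 1)) := by
    intro d hd
    have hdi := (Finset.mem_filter.1 hd).2
    obtain ⟨j, rfl⟩ := Nat.exists_eq_add_of_le' hdi
    rw [Nat.add_sub_cancel, ENNReal.ofReal_add (mul_nonneg (eigMoment_nonneg _ _)
      (trapProb_nonneg _ _)) (closePair_nonneg _ _ _ _)]
    exact (measure_union_le _ _).trans (add_le_add (dynLaw_return_inter_holds hn hτ hz j (d + 1))
      (dynLaw_closePair hn hτ hy hz j (d + 1) (by omega)))
  have hnn : ∀ d, 0 ≤ eigMoment n (d + 1) * trapProb τ z + closePair τ y z (d + 1) := fun d =>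
    add_nonneg (mul_nonneg (eigMoment_nonneg _ _) (trapProb_nonneg _ _)) (closePair_nonneg _ _ _ _)
  refine (Finset.sum_le_sum hterm).trans ?_
  rw [← ENNReal.ofReal_sum_of_nonneg fun d _ => hnn d]
  refine ENNReal.ofReal_le_ofReal ?_
  refine (Finset.sum_le_sum_of_subset_of_nonneg (Finset.filter_subset _ _)
    fun d _ _ => hnn d).trans (le_of_eq ?_)
  rw [Finset.sum_add_distrib, ← Finset.sum_mul, returnBound, mul_comm]

/-- The event that the clock is far from its typical value has little influence on the occurrence
of a long holding time. -/
lemma dynLaw_bad_inter_holds_le (hn : 1 ≤ n) {τ : Cube n → ℝ} (hτ : ∀ x, 0 < τ x)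
    {L m c δ z : ℝ} (hm : 0 ≤ m) (hc : 0 < c) (hδ : 0 < δ) (hδ4 : δ ≤ 4) (hz : 0 ≤ z)
    (hmδ : n ^ 2 * m ≤ δ * c / 4) (i : ℕ) :
    (dynLaw n).real ({w | δ * c < |clock τ w i - i * m|} ∩ holds τ z i) ≤
      trapProb τ z * (3 * (dynLaw n).real (lowDev τ L m (δ * c / 4) (i - n ^ 2)) +
        12 / δ * i * cubeAvg (fun x => highWeight L c (τ x)) + returnBound n) +
        ∑ d ∈ Finset.range (n ^ 2), closePair τ (δ * c / (4 * n ^ 2)) z (d + 1) := by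
  have hn' : (0 : ℝ) < n := by exact_mod_cast hn
  have hdc : 0 < δ * c / 4 := by positivity
  -- The tolerance `δ c` is divided into four quarters: the truncated clock at `a`, the long holding
  -- times before `a`, the last `n ^ 2` holding times, and the drift `(i - a) m ≤ n ^ 2 m`.
  set a := i - n ^ 2 with ha
  set y := δ * c / (4 * n ^ 2) with hy
  have hny : n ^ 2 * y = δ * c / 4 := by rw [hy]; field_simp
  set N : Set (Sample n) :=
    {w | n ^ 2 * y < ∑ j ∈ Finset.Ico a i, τ (w.1 j) * w.2 j} ∩ holds τ z i with hN
  have hsub : ({w | δ * c < |clock τ w i - i * m|} ∩ holds τ z i : Set (Sample n)) ⊆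
      (lowDev τ L m (δ * c / 4) a ∩ holds τ z i) ∪
      (({w | δ * c / 4 < clock (highPart L τ) w a} ∩ holds τ z i) ∪ N) ∪
      {w | ¬ ∀ i, 0 < w.2 i} := by
    rintro w ⟨hw1, hw2⟩
    by_cases hpos : ∀ i, 0 < w.2 i
    swap
    · exact Or.inr hpos
    left
    by_contra hcon
    simp only [Set.mem_union, not_or] at hcon
    obtain ⟨h1, h2, h3⟩ := hcon
    have h1' : |clock (lowPart L τ) w a - a * m| ≤ δ * c / 4 :=
      not_lt.1 fun h => h1 ⟨h, hw2⟩
    have h2' : clock (highPart L τ) w a ≤ δ * c / 4 := not_lt.1 fun h => h2 ⟨h, hw2⟩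
    have h3' : ∑ j ∈ Finset.Ico a i, τ (w.1 j) * w.2 j ≤ δ * c / 4 := by
      rw [← hny]; exact not_lt.1 fun h => h3 ⟨h, hw2⟩
    have h2'' : 0 ≤ clock (highPart L τ) w a := Finset.sum_nonneg fun j _ =>
      mul_nonneg (by unfold highPart; split_ifs; exacts [le_rfl, (hτ _).le]) (hpos j).le
    have h3'' : 0 ≤ ∑ j ∈ Finset.Ico a i, τ (w.1 j) * w.2 j := Finset.sum_nonneg fun j _ =>
      mul_nonneg (hτ _).le (hpos j).le
    have hsplit : clock τ w i = clock (lowPart L τ) w a + clock (highPart L τ) w a +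
        ∑ j ∈ Finset.Ico a i, τ (w.1 j) * w.2 j := by
      rw [← clock_eq_low_add_high, clock, clock, Finset.sum_range_add_sum_Ico _ (by omega)]
    have hia : (i : ℝ) * m - a * m ≤ δ * c / 4 ∧ 0 ≤ (i : ℝ) * m - a * m := by
      have e1 : (a : ℝ) ≤ i := by exact_mod_cast (by omega : a ≤ i)
      have e2 : (i : ℝ) ≤ a + (n : ℝ) ^ 2 := by exact_mod_cast (by omega : i ≤ a + n ^ 2)
      constructor <;> nlinarith
    have hw1' : δ * c < |clock τ w i - i * m| := hw1
    rw [abs_le] at h1'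
    rw [hsplit, lt_abs] at hw1'
    rcases hw1' with h | h <;> linarith [h1'.1, h1'.2, hia.1, hia.2]
  have hnull : dynLaw n {w | ¬ ∀ i, 0 < w.2 i} = 0 := (ae_dynLaw_good hn).mono fun w h => h.1
  have hT : dynLaw n (lowDev τ L m (δ * c / 4) a ∩ holds τ z i) ≤
      3 * ENNReal.ofReal (trapProb τ z) * dynLaw n (lowDev τ L m (δ * c / 4) a) := by
    -- For `i < n ^ 2` the truncated subtraction gives `a = 0`, where the clock vanishes and the
    -- event is empty.
    by_cases hi : n ^ 2 ≤ i
    · exact dynLaw_clock_inter_holds_le hn hτ hz (lowPart L τ)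
        (B := {u | δ * c / 4 < |u - a * m|})
        (measurableSet_lt measurable_const (by fun_prop)) (by omega)
    · have : lowDev τ L m (δ * c / 4) a = ∅ := by
        refine Set.eq_empty_of_forall_notMem fun w hw => ?_
        have hw : δ * c / 4 < |clock (lowPart L τ) w a - a * m| := hw
        rw [show a = 0 by omega] at hw
        simp only [clock, Finset.range_zero, Finset.sum_empty, Nat.cast_zero, zero_mul, sub_zero,
          abs_zero] at hw
        linarith
      rw [this]; simp
  have hU : dynLaw n ({w | δ * c / 4 < clock (highPart L τ) w a} ∩ holds τ z i) ≤
      3 * ENNReal.ofReal (trapProb τ z) *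
        ENNReal.ofReal (4 / δ * a * cubeAvg fun x => highWeight L c (τ x)) := by
    by_cases hi : n ^ 2 ≤ i
    · refine (dynLaw_clock_inter_holds_le hn hτ hz (highPart L τ) (B := Set.Ioi (δ * c / 4))
        measurableSet_Ioi (by omega)).trans ?_
      exact mul_le_mul' le_rfl (dynLaw_high_clock_le hn hτ hc hδ hδ4 a)
    · have : ({w | δ * c / 4 < clock (highPart L τ) w a} : Set (Sample n)) = ∅ := by
        refine Set.eq_empty_of_forall_notMem fun w hw => ?_
        have hw : δ * c / 4 < clock (highPart L τ) w a := hw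
        rw [show a = 0 by omega] at hw
        simp only [clock, Finset.range_zero, Finset.sum_empty] at hw
        linarith
      rw [this]; simp
  have hV : dynLaw n N ≤ ENNReal.ofReal (trapProb τ z * returnBound n +
        ∑ d ∈ Finset.range (n ^ 2), closePair τ y z (d + 1)) :=
    dynLaw_near_inter_holds_le hn hτ (by positivity) hz i
  have havg : 0 ≤ cubeAvg fun x => highWeight L c (τ x) :=
    cubeAvg_nonneg fun x => highWeight_nonneg hc (hτ x).le
  have htp := trapProb_nonneg τ z
  have hT' : (dynLaw n).real (lowDev τ L m (δ * c / 4) a ∩ holds τ z i) ≤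
      3 * trapProb τ z * (dynLaw n).real (lowDev τ L m (δ * c / 4) a) := by
    have := ENNReal.toReal_mono (ENNReal.mul_ne_top (ENNReal.mul_ne_top (by simp)
      ENNReal.ofReal_ne_top) (measure_ne_top _ _)) hT
    rw [ENNReal.toReal_mul, ENNReal.toReal_mul, ENNReal.toReal_ofReal htp] at this
    simpa [measureReal_def] using this
  have hU' : (dynLaw n).real ({w | δ * c / 4 < clock (highPart L τ) w a} ∩ holds τ z i) ≤
      3 * trapProb τ z * (4 / δ * a * cubeAvg fun x => highWeight L c (τ x)) := by
    have := ENNReal.toReal_mono (ENNReal.mul_ne_top (ENNReal.mul_ne_top (by simp)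
      ENNReal.ofReal_ne_top) ENNReal.ofReal_ne_top) hU
    rw [ENNReal.toReal_mul, ENNReal.toReal_mul, ENNReal.toReal_ofReal htp,
      ENNReal.toReal_ofReal (by positivity)] at this
    simpa [measureReal_def] using this
  have hV' : (dynLaw n).real N ≤ trapProb τ z * returnBound n +
        ∑ d ∈ Finset.range (n ^ 2), closePair τ y z (d + 1) :=
    ENNReal.toReal_le_of_le_ofReal (add_nonneg (mul_nonneg htp (returnBound_nonneg n))
      (Finset.sum_nonneg fun d _ => closePair_nonneg _ _ _ _)) hV
  have hnull' : (dynLaw n).real {w | ¬ ∀ i, 0 < w.2 i} = 0 := by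
    rw [measureReal_def, hnull]; rfl
  have hai : (a : ℝ) ≤ i := by exact_mod_cast (by omega : a ≤ i)
  have hUU : 3 * trapProb τ z * (4 / δ * a * cubeAvg fun x => highWeight L c (τ x)) ≤
      trapProb τ z * (12 / δ * i * cubeAvg fun x => highWeight L c (τ x)) := by
    have h1 : 4 / δ * a * (cubeAvg fun x => highWeight L c (τ x)) ≤
        4 / δ * i * cubeAvg fun x => highWeight L c (τ x) := by gcongr
    calc _ ≤ 3 * trapProb τ z * (4 / δ * i * cubeAvg fun x => highWeight L c (τ x)) := by gcongr
      _ = _ := by ring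
  have hall := (measureReal_mono (μ := dynLaw n) hsub).trans (measureReal_union_le _ _)
  have h2 := measureReal_union_le (μ := dynLaw n) (lowDev τ L m (δ * c / 4) a ∩ holds τ z i)
    (({w | δ * c / 4 < clock (highPart L τ) w a} ∩ holds τ z i) ∪ N)
  have h3 := measureReal_union_le (μ := dynLaw n)
    ({w | δ * c / 4 < clock (highPart L τ) w a} ∩ holds τ z i) N
  rw [mul_add, mul_add]
  linarith

/-- The error made by replacing the clock by its mean in the correlation function. -/
noncomputable def corrErr (τ : Cube n → ℝ) (L m c δ s : ℝ) (k : ℕ) : ℝ :=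
  trapProb τ (c * s) *
    (3 * ∑ i ∈ Finset.range k, (dynLaw n).real (lowDev τ L m (δ * c / 4) (i - n ^ 2)) +
      12 / δ * k ^ 2 * cubeAvg (fun x => highWeight L c (τ x)) + k * returnBound n) +
    k * ∑ d ∈ Finset.range (n ^ 2), closePair τ (δ * c / (4 * n ^ 2)) (c * s) (d + 1) +
    (dynLaw n).real (lowDev τ L m (δ * c / 4) k)

lemma sum_bad_inter_holds_le (hn : 1 ≤ n) {τ : Cube n → ℝ} (hτ : ∀ x, 0 < τ x)
    {L m c δ s : ℝ} (hm : 0 ≤ m) (hc : 0 < c) (hδ : 0 < δ) (hδ4 : δ ≤ 4) (hs : 0 ≤ s)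
    (hmδ : n ^ 2 * m ≤ δ * c / 4) (k : ℕ) :
    ∑ i ∈ Finset.range k,
        (dynLaw n).real ({w | δ * c < |clock τ w i - i * m|} ∩ holds τ (c * s) i) +
      (dynLaw n).real (lowDev τ L m (δ * c / 4) k) ≤ corrErr τ L m c δ s k := by
  have havg : 0 ≤ cubeAvg fun x => highWeight L c (τ x) :=
    cubeAvg_nonneg fun x => highWeight_nonneg hc (hτ x).le
  have htp := trapProb_nonneg τ (c * s)
  unfold corrErr
  gcongr
  refine (Finset.sum_le_sum fun i _ => dynLaw_bad_inter_holds_le hn hτ (L := L) hm hc hδ hδ4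
    (mul_nonneg hc.le hs) hmδ i).trans ?_
  rw [Finset.sum_add_distrib, Finset.sum_const, Finset.card_range, nsmul_eq_mul, ← Finset.mul_sum,
    Finset.sum_add_distrib, Finset.sum_add_distrib, Finset.sum_const, Finset.card_range,
    nsmul_eq_mul, ← Finset.mul_sum]
  gcongr
  have : ∀ i ∈ Finset.range k, 12 / δ * i * (cubeAvg fun x => highWeight L c (τ x)) ≤
      12 / δ * k * cubeAvg fun x => highWeight L c (τ x) := by
    intro i hi
    have : (i : ℝ) ≤ k := by exact_mod_cast (Finset.mem_range.1 hi).le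
    gcongr
  refine (Finset.sum_le_sum this).trans (le_of_eq ?_)
  rw [Finset.sum_const, Finset.card_range, nsmul_eq_mul]
  ring

/-- On the gap event at `i` the holding time is at least `c (t + s)` minus the clock. If the clock
is within `δ c` of `i m`, this gives the main term; otherwise the clock is still at most `c t`, so
the holding time is at least `c s` and the deviation is charged to the error. By step `k` the mean
clock has reached `(t + δ) c`, so a clock still below `c t` makes the truncated clock deviate. -/
lemma corr_le_of_env (hn : 1 ≤ n) (β : ℝ) (H : Cube n → ℝ) {L m c δ t s : ℝ} (hm : 0 < m)
    (hc : 0 < c) (ht : 0 < t) (hδ : 0 < δ) (hδ4 : δ ≤ 4) (hs : 0 < s)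
    (hδs : 2 * δ ≤ s) (hmδ : n ^ 2 * m ≤ δ * c / 4) (k : ℕ) (hk : k = ⌈(t + δ) * c / m⌉₊) :
    corr β H c t s ≤ ∑ i ∈ Finset.range k,
      trapProb (tau β H) (c * (t + s - i * m / c - δ)) + corrErr (tau β H) L m c δ s k := by
  set τ := tau β H with hτ'
  have hτ : ∀ x, 0 < τ x := tau_pos β H
  refine (corr_le_sum_gap hn β H hc ht k).trans ?_
  refine le_trans ?_ (add_le_add le_rfl
    (sum_bad_inter_holds_le hn hτ (L := L) hm.le hc hδ hδ4 hs.le hmδ k))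
  rw [← add_assoc, ← Finset.sum_add_distrib]
  refine add_le_add (Finset.sum_le_sum fun i hi => ?_) ?_
  · have hik : (i : ℝ) < (t + δ) * c / m := by
      rw [Finset.mem_range, hk] at hi; exact Nat.lt_ceil.1 hi
    rw [lt_div_iff₀ hm] at hik
    -- Here `i m < (t + δ) c`, which leaves at least `c (s - 2 δ) ≥ 0`.
    have hz : 0 ≤ c * (t + s - i * m / c - δ) := by
      have : c * (t + s - i * m / c - δ) = c * (t + s - δ) - i * m := by field_simp; ring
      rw [this]; nlinarith
    rw [show trapProb τ (c * (t + s - i * m / c - δ)) =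
      (dynLaw n).real (holds τ (c * (t + s - i * m / c - δ)) i) by
        rw [measureReal_def, dynLaw_holds hn hτ hz, ENNReal.toReal_ofReal (trapProb_nonneg _ _)]]
    refine le_trans (measureReal_mono ?_) (measureReal_union_le _ _)
    rintro w ⟨hw1, hw2⟩
    rw [clock_succ] at hw2
    by_cases hb : δ * c < |clock τ w i - i * m|
    · right
      refine ⟨hb, ?_⟩
      change c * s ≤ τ (w.1 i) * w.2 i
      linarith
    · left
      have := (abs_le.1 (not_lt.1 hb)).2
      change c * (t + s - i * m / c - δ) ≤ τ (w.1 i) * w.2 i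
      have e : c * (t + s - i * m / c - δ) = c * (t + s - δ) - i * m := by field_simp; ring
      rw [e]; linarith
  · refine ENNReal.toReal_mono (measure_ne_top _ _) (measure_mono_ae ?_)
    filter_upwards [ae_dynLaw_good hn] with w ⟨hw1, _⟩ hw
    have hw : clock τ w k ≤ c * t := hw
    have hkm : (t + δ) * c ≤ k * m := by
      rw [← div_le_iff₀ hm, hk]; exact Nat.le_ceil _
    have hlow : clock (lowPart L τ) w k ≤ clock τ w k := by
      refine Finset.sum_le_sum fun j _ => mul_le_mul_of_nonneg_right ?_ (hw1 j).le
      unfold lowPart; split_ifs; exacts [le_rfl, (hτ _).le]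
    change δ * c / 4 < |clock (lowPart L τ) w k - k * m|
    rw [lt_abs]
    right
    nlinarith [mul_pos hδ hc]

/-- For `i < k` one has `i m < (t - δ) c`, so a clock within `δ c` of its mean has not passed `c t`,
and the holding time carries it beyond `c (t + s)`. The error is taken up to some `k' ≥ k`, so that
both bounds can share the same error term. -/
lemma le_corr_of_env (hn : 1 ≤ n) (β : ℝ) (H : Cube n → ℝ) {L m c δ t s : ℝ} (hm : 0 < m)
    (hc : 0 < c) (hδ : 0 < δ) (hδ4 : δ ≤ 4) (hs : 0 < s)
    (hmδ : n ^ 2 * m ≤ δ * c / 4) (k k' : ℕ) (hk : k = ⌈(t - δ) * c / m⌉₊) (hkk : k ≤ k') :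
    ∑ i ∈ Finset.range k, trapProb (tau β H) (c * (t + s - i * m / c + δ)) ≤
      corr β H c t s + corrErr (tau β H) L m c δ s k' := by
  set τ := tau β H with hτ'
  have hτ : ∀ x, 0 < τ x := tau_pos β H
  refine le_trans ?_ (add_le_add (sum_gap_le_corr hn β H (t := t) hc hs k)
    (sum_bad_inter_holds_le hn hτ (L := L) hm.le hc hδ hδ4 hs.le hmδ k'))
  have h1 : ∑ i ∈ Finset.range k,
      (dynLaw n).real ({w | δ * c < |clock τ w i - i * m|} ∩ holds τ (c * s) i) ≤
      ∑ i ∈ Finset.range k',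
      (dynLaw n).real ({w | δ * c < |clock τ w i - i * m|} ∩ holds τ (c * s) i) :=
    Finset.sum_le_sum_of_subset_of_nonneg (Finset.range_mono hkk)
      fun _ _ _ => measureReal_nonneg
  have h2 : (0 : ℝ) ≤ (dynLaw n).real (lowDev τ L m (δ * c / 4) k') := measureReal_nonneg
  have h3 : ∑ i ∈ Finset.range k, trapProb τ (c * (t + s - i * m / c + δ)) ≤
      ∑ i ∈ Finset.range k, (dynLaw n).real (gap τ (c * t) (c * (t + s)) i) +
      ∑ i ∈ Finset.range k,
      (dynLaw n).real ({w | δ * c < |clock τ w i - i * m|} ∩ holds τ (c * s) i) := by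
    rw [← Finset.sum_add_distrib]
    refine Finset.sum_le_sum fun i hi => ?_
    have hik : (i : ℝ) < (t - δ) * c / m := by
      rw [Finset.mem_range, hk] at hi; exact Nat.lt_ceil.1 hi
    rw [lt_div_iff₀ hm] at hik
    have e : c * (t + s - i * m / c + δ) = c * (t + s + δ) - i * m := by field_simp; ring
    have hdc := mul_pos hδ hc
    have hz : c * s ≤ c * (t + s - i * m / c + δ) := by rw [e]; linarith
    rw [show trapProb τ (c * (t + s - i * m / c + δ)) =
      (dynLaw n).real (holds τ (c * (t + s - i * m / c + δ)) i) by
        rw [measureReal_def, dynLaw_holds hn hτ ((mul_nonneg hc.le hs.le).trans hz),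
          ENNReal.toReal_ofReal (trapProb_nonneg _ _)]]
    refine le_trans (measureReal_mono ?_) (measureReal_union_le _ _)
    intro w hw
    have hw : c * (t + s - i * m / c + δ) ≤ τ (w.1 i) * w.2 i := hw
    by_cases hb : δ * c < |clock τ w i - i * m|
    · right
      exact ⟨hb, hz.trans hw⟩
    · left
      have := abs_le.1 (not_lt.1 hb)
      rw [e] at hw
      refine ⟨by linarith [this.2], ?_⟩
      rw [clock_succ]
      linarith [this.1]
  linarith

end QuenchedBounds

end REM

namespace REM

/-! ### Gaussian asymptotics -/

section Gaussian

/-- The law of the energy at a vertex. -/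
noncomputable abbrev siteLaw (n : ℕ) : Measure ℝ := gaussianReal 0 (n : ℝ≥0)

/-- The Boltzmann weight of an energy. -/
noncomputable def weight (β h : ℝ) : ℝ := Real.exp (-(β * h))

lemma weight_pos (β h : ℝ) : 0 < weight β h := Real.exp_pos _

@[fun_prop]
lemma measurable_weight (β : ℝ) : Measurable (weight β) := by unfold weight; fun_prop

/-- The mean of the weight truncated at the level `y`. -/
noncomputable def lowMean (β : ℝ) (n : ℕ) (y : ℝ) : ℝ :=
  ∫ h, (if weight β h ≤ y then weight β h else 0) ∂siteLaw n

/-- The mean over the environment of the probability that a holding time is at least `z`. -/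
noncomputable def siteTrap (β : ℝ) (n : ℕ) (z : ℝ) : ℝ :=
  ∫ h, Real.exp (-(z / weight β h)) ∂siteLaw n

lemma weight_le_iff {β : ℝ} (hβ : 0 < β) {y : ℝ} (hy : 0 < y) (h : ℝ) :
    weight β h ≤ y ↔ -(Real.log y / β) ≤ h := by
  rw [weight, ← Real.le_log_iff_exp_le hy, neg_le, ← neg_div, div_le_iff₀ hβ]
  constructor <;> intro h1 <;> linarith

/-- Exponential tilting: `exp (-β h)` times the density of `N(0, n)` is `exp (n β² / 2)` times that
of `N(-β n, n)`. The truncation becomes a half-line, so `Φ` appears after standardising. -/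
lemma lowMean_eq {β : ℝ} (hβ : 0 < β) {n : ℕ} (hn : 1 ≤ n) {y : ℝ} (hy : 0 < y) :
    lowMean β n y = Real.exp (n * β ^ 2 / 2) *
      cdf (gaussianReal 0 1) (Real.log y / (β * √n) - β * √n) := by
  have hn' : (0 : ℝ) < n := by exact_mod_cast hn
  have hnn : (n : ℝ≥0) ≠ 0 := by exact_mod_cast (by omega : n ≠ 0)
  set q : ℝ := √n with hq
  have hq0 : 0 < q := Real.sqrt_pos.2 hn'
  have hqq : q * q = n := Real.mul_self_sqrt hn'.le
  have h1 : lowMean β n y = Real.exp (n * β ^ 2 / 2) *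
      ∫ h, (Set.Ici (-(Real.log y / β))).indicator 1 h ∂gaussianReal (-(β * n)) (n : ℝ≥0) := by
    rw [lowMean, integral_gaussianReal_eq_integral_smul hnn,
      integral_gaussianReal_eq_integral_smul hnn, ← integral_const_mul]
    congr 1
    ext h
    simp only [smul_eq_mul, Set.indicator, Set.mem_Ici, Pi.one_apply, ← weight_le_iff hβ hy]
    split_ifs
    · rw [gaussianPDFReal_def, gaussianPDFReal_def, weight, mul_one]
      beta_reduce
      rw [mul_assoc, ← Real.exp_add, mul_left_comm, ← Real.exp_add]
      congr 2
      simp only [NNReal.coe_natCast]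
      field_simp
      ring
    · simp
  rw [h1, integral_indicator_one measurableSet_Ici]
  congr 1
  have h2 : gaussianReal (-(β * n)) (n : ℝ≥0) =
      (gaussianReal 0 1).map (fun z => -q * z + -(β * n)) := by
    have e1 : (gaussianReal 0 1).map (fun z => -q * z + -(β * n)) =
        ((gaussianReal 0 1).map (fun z => -q * z)).map (fun z => z + -(β * n)) := by
      rw [Measure.map_map (by fun_prop) (by fun_prop)]; rfl
    rw [e1, gaussianReal_map_const_mul, gaussianReal_map_add_const]
    congr 1
    · simp
    · ext; simp [hq]
  rw [h2, cdf_eq_real, map_measureReal_apply (by fun_prop) measurableSet_Ici]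
  congr 1
  ext z
  simp only [Set.mem_preimage, Set.mem_Ici, Set.mem_Iic]
  have e : Real.log y / (β * q) - β * q = (Real.log y / β - β * n) / q := by
    rw [← hqq]; field_simp
  rw [e, le_div_iff₀ hq0]
  constructor <;> intro h <;> linarith

lemma continuous_cdf_gaussian : Continuous (cdf (gaussianReal 0 1)) := by
  have : NullSingletonClass (gaussianReal 0 1) := nullSingletonClass_gaussianReal one_ne_zero
  rw [continuous_iff_continuousAt]
  intro x
  have hm : Monotone (cdf (gaussianReal 0 1)) := monotone_cdf _
  rw [hm.continuousAt_iff_leftLim_eq_rightLim, StieltjesFunction.rightLim_eq]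
  have h := StieltjesFunction.measure_singleton (cdf (gaussianReal 0 1)) x
  rw [measure_cdf, measure_singleton, eq_comm, ENNReal.ofReal_eq_zero, sub_nonpos] at h
  exact le_antisymm (hm.leftLim_le le_rfl) h

lemma cdf_gaussian_pos (x : ℝ) : 0 < cdf (gaussianReal 0 1) x := by
  rw [cdf_eq_real, measureReal_def, ENNReal.toReal_pos_iff]
  refine ⟨pos_iff_ne_zero.2 fun h => ?_, measure_lt_top _ _⟩
  have := gaussianReal_absolutelyContinuous' 0 one_ne_zero h
  simp at this

/-- Substitution `h = -(log c + w) / β`, that is `τ = c e^w`, with the square in the Gaussian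
density expanded around `log c = β √n (β √n + θ')`. -/
lemma siteTrap_eq {β : ℝ} (hβ : 0 < β) {n : ℕ} (hn : 1 ≤ n) {c v θ' : ℝ} (hc : 0 < c)
    (hθ' : θ' = Real.log c / (β * √n) - β * √n) :
    siteTrap β n (c * v) = (β * √(2 * Real.pi) * √n)⁻¹ * Real.exp (-(β * √n + θ') ^ 2 / 2) *
      ∫ w, Real.exp (-(v * Real.exp (-w)) - w * (1 + θ' / (β * √n)) - w ^ 2 / (2 * β ^ 2 * n)) := by
  have hn' : (0 : ℝ) < n := by exact_mod_cast hn
  have hnn : (n : ℝ≥0) ≠ 0 := by exact_mod_cast (by omega : n ≠ 0)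
  set q : ℝ := √n with hq
  have hq0 : 0 < q := Real.sqrt_pos.2 hn'
  have hqq : q ^ 2 = n := Real.sq_sqrt hn'.le
  have hlog : Real.log c = β * q * (β * q + θ') := by rw [hθ']; field_simp; ring
  rw [siteTrap, integral_gaussianReal_eq_integral_smul hnn]
  rw [← integral_sub_left_eq_self _ volume (-(Real.log c / β))]
  have h2 := Measure.integral_comp_mul_left (fun h => gaussianPDFReal 0 (n : ℝ≥0)
    (-(Real.log c / β) - h) • Real.exp (-(c * v / weight β (-(Real.log c / β) - h)))) β⁻¹
  rw [inv_inv, abs_of_pos hβ, smul_eq_mul] at h2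
  rw [← mul_right_inj' hβ.ne', ← h2, ← integral_const_mul, ← integral_const_mul]
  congr 1
  ext w
  have e1 : c * v / weight β (-(Real.log c / β) - β⁻¹ * w) = v * Real.exp (-w) := by
    rw [weight, div_eq_mul_inv, ← Real.exp_neg]
    have : -(-(β * (-(Real.log c / β) - β⁻¹ * w))) = -Real.log c + -w := by field_simp; ring
    rw [this, Real.exp_add, Real.exp_neg, Real.exp_log hc]
    field_simp
  have e2 : √(2 * Real.pi * n) = √(2 * Real.pi) * q := Real.sqrt_mul (by positivity) _
  rw [e1, smul_eq_mul, gaussianPDFReal_def]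
  simp only [NNReal.coe_natCast]
  rw [e2, mul_assoc, ← Real.exp_add, mul_assoc ((β * √(2 * Real.pi) * q)⁻¹), ← Real.exp_add,
    ← mul_assoc β]
  congr 1
  · field_simp
  · congr 1
    rw [hlog, ← hqq]
    field_simp
    ring

lemma integral_exp_gumbel {v : ℝ} (hv : 0 < v)
    (hi : Integrable fun w : ℝ => Real.exp (-(v * Real.exp (-w)) - w)) :
    ∫ w, Real.exp (-(v * Real.exp (-w)) - w) = 1 / v := by
  -- The integrand has an explicit primitive, a Gumbel distribution function up to shift and scale.
  have hd : ∀ w : ℝ, HasDerivAt (fun w => v⁻¹ * Real.exp (-(v * Real.exp (-w))))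
      (Real.exp (-(v * Real.exp (-w)) - w)) w := by
    intro w
    have h1 : HasDerivAt (fun w : ℝ => Real.exp (-w)) (Real.exp (-w) * (-1)) w :=
      (hasDerivAt_neg w).exp
    have h0 : HasDerivAt (fun w : ℝ => -(v * Real.exp (-w))) (-(v * (Real.exp (-w) * (-1)))) w :=
      (h1.const_mul v).neg
    have h2 := h0.exp.const_mul v⁻¹
    convert! h2 using 1
    rw [sub_eq_add_neg, Real.exp_add]
    field_simp
  have hbot : Tendsto (fun w => v⁻¹ * Real.exp (-(v * Real.exp (-w)))) atBot (𝓝 (v⁻¹ * 0)) := by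
    refine Tendsto.const_mul _ (Real.tendsto_exp_atBot.comp ?_)
    exact tendsto_neg_atTop_atBot.comp
      ((Real.tendsto_exp_atTop.comp tendsto_neg_atBot_atTop).const_mul_atTop hv)
  have htop : Tendsto (fun w => v⁻¹ * Real.exp (-(v * Real.exp (-w)))) atTop
      (𝓝 (v⁻¹ * Real.exp (-(v * 0)))) := by
    refine Tendsto.const_mul _ ((Real.continuous_exp.tendsto _).comp ?_)
    exact ((Real.tendsto_exp_atBot.comp tendsto_neg_atTop_atBot).const_mul v).neg
  rw [integral_of_hasDerivAt_of_tendsto hd hi hbot htop]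
  simp

/-- An integrable majorant free of `η` and `b`. For `w ≤ 0`, `v e^{-w} ≥ v w² / 2` absorbs the
linear terms, and completing a square with `3 |w|` leaves `9 / (2 v)`. -/
lemma exp_gumbel_bound {v η w b : ℝ} (hv : 0 < v) (hη : |η| ≤ 1 / 2) (hb : 0 ≤ b) :
    Real.exp (-(v * Real.exp (-w)) - w * (1 + η) - b) ≤
      8 * Real.exp (9 / (2 * v)) * (1 + w ^ 2)⁻¹ := by
  rw [abs_le] at hη
  have h1 : -(v * Real.exp (-w)) - w * (1 + η) - b ≤ 9 / (2 * v) - |w| / 2 := by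
    rcases le_total 0 w with hw | hw
    · rw [abs_of_nonneg hw]
      have : 0 < v * Real.exp (-w) := by positivity
      have : 0 < 9 / (2 * v) := by positivity
      nlinarith
    · rw [abs_of_nonpos hw]
      have h2 := Real.quadratic_le_exp_of_nonneg (neg_nonneg.2 hw)
      have h3 : v * ((-w) ^ 2 / 2) ≤ v * Real.exp (-w) := by
        gcongr; nlinarith
      have h4 : 9 / (2 * v) = v * ((3 / v) ^ 2 / 2) := by field_simp; norm_num
      have h5 : 0 ≤ v * ((-w - 3 / v) ^ 2 / 2) := by positivity
      have h6 : v * ((-w - 3 / v) ^ 2 / 2) = v * ((-w) ^ 2 / 2) + 3 * w + v * ((3 / v) ^ 2 / 2) := by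
        field_simp; ring
      nlinarith
  calc _ ≤ Real.exp (9 / (2 * v) - |w| / 2) := Real.exp_le_exp.2 h1
    _ = Real.exp (9 / (2 * v)) * (Real.exp (|w| / 2))⁻¹ := by
      rw [sub_eq_add_neg, Real.exp_add, Real.exp_neg]
    _ ≤ Real.exp (9 / (2 * v)) * ((1 + w ^ 2) / 8)⁻¹ := by
      gcongr
      have h2 := Real.quadratic_le_exp_of_nonneg (show 0 ≤ |w| / 2 by positivity)
      have := sq_abs w
      have := abs_nonneg w
      nlinarith
    _ = _ := by rw [inv_div]; field_simp

/-- `η` and `b` stand for the corrections `θ' / (β √n)` and `1 / (2 β² n)` in `siteTrap_eq`. -/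
lemma tendsto_integral_gumbel {v : ℝ} (hv : 0 < v) {η b : ℕ → ℝ} (hη : Tendsto η atTop (𝓝 0))
    (hb : Tendsto b atTop (𝓝 0)) (hb0 : ∀ n, 0 ≤ b n) :
    Tendsto (fun n => ∫ w, Real.exp (-(v * Real.exp (-w)) - w * (1 + η n) - b n * w ^ 2)) atTop
      (𝓝 (1 / v)) := by
  have hbd : Integrable fun w : ℝ => 8 * Real.exp (9 / (2 * v)) * (1 + w ^ 2)⁻¹ :=
    integrable_inv_one_add_sq.const_mul _
  have hi : Integrable fun w : ℝ => Real.exp (-(v * Real.exp (-w)) - w) := by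
    refine hbd.mono' (by fun_prop) (ae_of_all _ fun w => ?_)
    rw [Real.norm_of_nonneg (Real.exp_pos _).le]
    have := exp_gumbel_bound (η := 0) (w := w) hv (by simp) le_rfl
    simpa using this
  rw [← integral_exp_gumbel hv hi]
  refine tendsto_integral_filter_of_dominated_convergence _
    (Eventually.of_forall fun n => by fun_prop) ?_ hbd (ae_of_all _ fun w => ?_)
  · have h1 : ∀ᶠ n in atTop, |η n| ≤ 1 / 2 := by
      have := (hη.abs).eventually_le_const (show |(0 : ℝ)| < 1 / 2 by simp)
      exact this
    filter_upwards [h1] with n hn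
    refine ae_of_all _ fun w => ?_
    rw [Real.norm_of_nonneg (Real.exp_pos _).le]
    exact exp_gumbel_bound hv hn (mul_nonneg (hb0 n) (sq_nonneg _))
  · refine (Real.continuous_exp.tendsto _).comp ?_
    have h2 := (hη.const_add 1).const_mul w
    have h3 := hb.mul_const (w ^ 2)
    have := (h2.const_sub (-(v * Real.exp (-w)))).sub h3
    simpa using this

end Gaussian

end REM

namespace REM

/-! ### Asymptotics of the truncated mean and of the trapping probabilities along the time-scale -/

section Sequences

/-- The constant in front of `1 / v` in the tail of the rescaled holding times. -/
noncomputable def tailConst (β θ : ℝ) : ℝ :=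
  Real.exp (-θ ^ 2 / 2) / cdf (gaussianReal 0 1) θ * (1 / (β * √(2 * Real.pi)))

/-- The mean holding time, with holding times truncated at level `c n / n ^ 6`. -/
noncomputable def mseq (β : ℝ) (c : ℕ → ℝ) (n : ℕ) : ℝ := lowMean β n (c n / n ^ 6)

/-- The typical number of jumps up to time `c n`. -/
noncomputable def kseq (β : ℝ) (c : ℕ → ℝ) (n : ℕ) : ℝ := c n / mseq β c n

/-- The mean of the normalised contribution of the long holding times. -/
noncomputable def siteHigh (β : ℝ) (n : ℕ) (L c : ℝ) : ℝ :=
  ∫ h, highWeight L c (weight β h) ∂siteLaw n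

lemma integrable_low (β : ℝ) (n : ℕ) {y : ℝ} :
    Integrable (fun h => if weight β h ≤ y then weight β h else 0) (siteLaw n) := by
  refine Integrable.of_bound (C := max y 0) (Measurable.aestronglyMeasurable ?_)
    (ae_of_all _ fun h => ?_)
  · exact Measurable.ite (measurableSet_le (by fun_prop) measurable_const) (by fun_prop)
      measurable_const
  · split_ifs with h1
    · rw [Real.norm_of_nonneg (weight_pos _ _).le]; exact h1.trans (le_max_left _ _)
    · simp

lemma integrable_trap (β : ℝ) (n : ℕ) {z : ℝ} (hz : 0 ≤ z) :
    Integrable (fun h => Real.exp (-(z / weight β h))) (siteLaw n) := by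
  have hm : Measurable fun h => Real.exp (-(z / weight β h)) :=
    ((measurable_const.div (measurable_weight β)).neg).exp
  refine Integrable.of_bound (C := 1) hm.aestronglyMeasurable (ae_of_all _ fun h => ?_)
  rw [Real.norm_of_nonneg (Real.exp_pos _).le, Real.exp_le_one_iff, neg_nonpos]
  exact div_nonneg hz (weight_pos _ _).le

lemma siteTrap_nonneg (β : ℝ) (n : ℕ) (z : ℝ) : 0 ≤ siteTrap β n z :=
  integral_nonneg fun _ => (Real.exp_pos _).le

lemma siteTrap_antitone (β : ℝ) (n : ℕ) {y z : ℝ} (hy : 0 ≤ y) (hyz : y ≤ z) :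
    siteTrap β n z ≤ siteTrap β n y := by
  refine integral_mono (integrable_trap β n (hy.trans hyz)) (integrable_trap β n hy) fun h => ?_
  have := weight_pos β h
  refine Real.exp_le_exp.2 (neg_le_neg ?_)
  gcongr

lemma measurable_highWeight (L c : ℝ) : Measurable (highWeight L c) := by
  unfold highWeight
  exact Measurable.ite measurableSet_Iic measurable_const
    (Measurable.ite measurableSet_Iic (by fun_prop) measurable_const)

lemma integrable_high (β : ℝ) (n : ℕ) {L c : ℝ} (hc : 0 < c) :
    Integrable (fun h => highWeight L c (weight β h)) (siteLaw n) := by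
  refine Integrable.of_bound (C := 1)
    ((measurable_highWeight L c).comp (measurable_weight β)).aestronglyMeasurable
    (ae_of_all _ fun h => ?_)
  rw [Real.norm_of_nonneg (highWeight_nonneg hc (weight_pos _ _).le)]
  exact highWeight_le_one hc

/-- Weights between `L` and `c` give the difference of truncated means; above `c`, the indicator is
at most `e * exp (-c / τ)`. -/
lemma siteHigh_le (β : ℝ) (n : ℕ) {L c : ℝ} (hc : 0 < c) (hL : L ≤ c) :
    siteHigh β n L c ≤ (lowMean β n c - lowMean β n L) / c + Real.exp 1 * siteTrap β n c := by
  unfold siteHigh lowMean siteTrap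
  have hd : Integrable (fun h => ((if weight β h ≤ c then weight β h else 0) -
      (if weight β h ≤ L then weight β h else 0)) / c) (siteLaw n) :=
    ((integrable_low β n).sub (integrable_low β n)).div_const _
  rw [← integral_sub (integrable_low β n) (integrable_low β n), ← integral_div,
    ← integral_const_mul, ← integral_add hd ((integrable_trap β n hc.le).const_mul _)]
  refine integral_mono (integrable_high β n hc)
    (hd.add ((integrable_trap β n hc.le).const_mul _)) fun h => ?_
  have hw := weight_pos β h
  simp only [highWeight]
  have hpos : 0 < Real.exp 1 * Real.exp (-(c / weight β h)) := by positivity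
  split_ifs with h1 h2 h3
  · rw [sub_self, zero_div, zero_add]; exact hpos.le
  · exact absurd (h1.trans hL) h2
  · rw [sub_zero]; linarith
  · rw [sub_self, zero_div, zero_add, ← Real.exp_add]
    refine Real.one_le_exp ?_
    have : c / weight β h ≤ 1 := (div_le_one hw).2 (not_le.1 h3).le
    linarith

/-- Below `c` one uses `exp (-y / τ) ≤ τ / y`, above it `exp (-y / τ) ≤ 1 ≤ e * exp (-c / τ)`. -/
lemma siteTrap_le (β : ℝ) (n : ℕ) {y c : ℝ} (hc : 0 ≤ c) (hy : 0 < y) :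
    siteTrap β n y ≤ lowMean β n c / y + Real.exp 1 * siteTrap β n c := by
  unfold lowMean siteTrap
  rw [← integral_div, ← integral_const_mul, ← integral_add ((integrable_low β n).div_const _)
    ((integrable_trap β n hc).const_mul _)]
  refine integral_mono (integrable_trap β n hy.le) (((integrable_low β n).div_const _).add
    ((integrable_trap β n hc).const_mul _)) fun h => ?_
  have hw := weight_pos β h
  have hpos : 0 < Real.exp 1 * Real.exp (-(c / weight β h)) := by positivity
  beta_reduce
  split_ifs with h1
  · have h2 : Real.exp (-(y / weight β h)) ≤ weight β h / y := by
      rw [Real.exp_neg, ← inv_div y]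
      gcongr
      linarith [Real.add_one_le_exp (y / weight β h)]
    linarith
  · rw [zero_div, zero_add, ← Real.exp_add]
    refine Real.exp_le_exp.2 ?_
    have h2 : c / weight β h ≤ 1 := (div_le_one hw).2 (not_le.1 h1).le
    have h3 : 0 < y / weight β h := by positivity
    linarith

variable {β θ : ℝ} {c : ℕ → ℝ}

lemma tendsto_sqrt_natCast : Tendsto (fun n : ℕ => √(n : ℝ)) atTop atTop :=
  Real.tendsto_sqrt_atTop.comp tendsto_natCast_atTop_atTop

lemma tendsto_log_div_sqrt : Tendsto (fun n : ℕ => Real.log n / √(n : ℝ)) atTop (𝓝 0) := by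
  have h := (isLittleO_log_rpow_atTop (show (0 : ℝ) < 1 / 2 by norm_num)).tendsto_div_nhds_zero
  refine (h.comp tendsto_natCast_atTop_atTop).congr fun n => ?_
  simp [Real.sqrt_eq_rpow]

/-- A polynomial factor in the truncation level shifts the argument of `Φ` by `p log n / (β √n) →
0`. So truncation at `c` and at `c / n ^ 6` keep asymptotically the same share of the mean. -/
lemma tendsto_cdf_level (hβ : 0 < β) (hc : Tendsto c atTop atTop)
    (hθ : Tendsto (fun n : ℕ => Real.log (c n) / (β * √(n : ℝ)) - β * √(n : ℝ)) atTop (𝓝 θ))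
    (p : ℕ) :
    Tendsto (fun n : ℕ => cdf (gaussianReal 0 1)
      (Real.log (c n / n ^ p) / (β * √n) - β * √n)) atTop (𝓝 (cdf (gaussianReal 0 1) θ)) := by
  refine (continuous_cdf_gaussian.tendsto θ).comp ?_
  have h1 := hθ.sub ((tendsto_log_div_sqrt.const_mul (p / β : ℝ)))
  rw [mul_zero, sub_zero] at h1
  refine h1.congr' ?_
  filter_upwards [hc.eventually_gt_atTop 0, eventually_ge_atTop 1] with n hcn hn
  have hn' : (0 : ℝ) < n := by exact_mod_cast hn
  rw [Real.log_div hcn.ne' (by positivity), Real.log_pow]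
  have hq0 : 0 < √(n : ℝ) := Real.sqrt_pos.2 hn'
  field_simp
  ring

lemma mseq_eq (hβ : 0 < β) {n : ℕ} (hn : 1 ≤ n) (hcn : 0 < c n) :
    mseq β c n = Real.exp (n * β ^ 2 / 2) *
      cdf (gaussianReal 0 1) (Real.log (c n / n ^ 6) / (β * √n) - β * √n) := by
  have hn' : (0 : ℝ) < n := by exact_mod_cast hn
  exact lowMean_eq hβ hn (by positivity)

lemma mseq_pos (hβ : 0 < β) {n : ℕ} (hn : 1 ≤ n) (hcn : 0 < c n) : 0 < mseq β c n := by
  rw [mseq_eq hβ hn hcn]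
  exact mul_pos (Real.exp_pos _) (cdf_gaussian_pos _)

lemma kseq_pos (hβ : 0 < β) {n : ℕ} (hn : 1 ≤ n) (hcn : 0 < c n) : 0 < kseq β c n :=
  div_pos hcn (mseq_pos hβ hn hcn)

/-- The exponential orders of `c`, of `exp (n β² / 2)` and of the Gaussian density cancel up to `exp
(-θ² / 2)`; `Φ(θ)` comes from `mseq`, the factor `1 / √n` from the density, and `1 / v` from the
Gumbel integral. -/
lemma tendsto_kseq_mul_siteTrap (hβ : 0 < β) (hc : Tendsto c atTop atTop)
    (hθ : Tendsto (fun n : ℕ => Real.log (c n) / (β * √(n : ℝ)) - β * √(n : ℝ)) atTop (𝓝 θ))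
    {v : ℝ} (hv : 0 < v) :
    Tendsto (fun n : ℕ => √(n : ℝ) * kseq β c n * siteTrap β n (c n * v)) atTop
      (𝓝 (tailConst β θ / v)) := by
  set θ' : ℕ → ℝ := fun n => Real.log (c n) / (β * √(n : ℝ)) - β * √(n : ℝ) with hθ'
  set Φ' : ℕ → ℝ := fun n => cdf (gaussianReal 0 1)
      (Real.log (c n / n ^ 6) / (β * √n) - β * √n) with hΦ'
  have hinv : Tendsto (fun n : ℕ => (√(n : ℝ))⁻¹) atTop (𝓝 0) :=
    tendsto_inv_atTop_zero.comp tendsto_sqrt_natCast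
  have hη : Tendsto (fun n : ℕ => θ' n / (β * √(n : ℝ))) atTop (𝓝 0) := by
    have := (hθ.mul hinv).mul_const β⁻¹
    rw [mul_zero, zero_mul] at this
    refine this.congr fun n => ?_
    rw [div_eq_mul_inv, mul_inv]; ring
  have hb : Tendsto (fun n : ℕ => (2 * β ^ 2 * (n : ℝ))⁻¹) atTop (𝓝 0) :=
    tendsto_inv_atTop_zero.comp (tendsto_natCast_atTop_atTop.const_mul_atTop (by positivity))
  have hI := tendsto_integral_gumbel hv hη hb fun n => by positivity
  have hΦ := tendsto_cdf_level hβ hc hθ 6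
  have hE : Tendsto (fun n => Real.exp (-(θ' n) ^ 2 / 2)) atTop (𝓝 (Real.exp (-θ ^ 2 / 2))) :=
    (Real.continuous_exp.tendsto _).comp (((hθ.pow 2).neg).div_const 2)
  have hall := ((hE.div hΦ (cdf_gaussian_pos θ).ne').mul_const (1 / (β * √(2 * Real.pi)))).mul hI
  rw [mul_one_div] at hall
  refine hall.congr' ?_
  filter_upwards [hc.eventually_gt_atTop 0, eventually_ge_atTop 1] with n hcn hn
  have hn' : (0 : ℝ) < n := by exact_mod_cast hn
  have hq0 : 0 < √(n : ℝ) := Real.sqrt_pos.2 hn'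
  have hqq : √(n : ℝ) ^ 2 = n := Real.sq_sqrt hn'.le
  have hΦ0 : 0 < Φ' n := cdf_gaussian_pos _
  rw [kseq, mseq_eq hβ hn hcn, siteTrap_eq (θ' := θ' n) hβ hn hcn rfl]
  have hcexp : c n = Real.exp (β * √n * (β * √n + θ' n)) := by
    rw [← Real.exp_log hcn]
    congr 1
    rw [hθ']
    field_simp
    ring
  have hexp : Real.exp (-(θ' n) ^ 2 / 2) =
      c n * (Real.exp (n * β ^ 2 / 2))⁻¹ * Real.exp (-(β * √n + θ' n) ^ 2 / 2) := by
    rw [hcexp, ← Real.exp_neg, ← Real.exp_add, ← Real.exp_add]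
    congr 1
    nlinarith
  have hint : ∀ w : ℝ, w ^ 2 / (2 * β ^ 2 * n) = (2 * β ^ 2 * (n : ℝ))⁻¹ * w ^ 2 := fun w => by
    rw [div_eq_inv_mul]
  simp_rw [hint]
  rw [Pi.div_apply, hexp]
  change _ / Φ' n * _ * _ = _ * (c n / (_ * Φ' n)) * _
  field_simp

lemma kseq_lower (hβ : 0 < β) {n : ℕ} (hn : 1 ≤ n) (hcn : 0 < c n) :
    c n * Real.exp (-(n * β ^ 2 / 2)) ≤ kseq β c n := by
  rw [kseq, Real.exp_neg, ← div_eq_mul_inv]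
  have h0 := mseq_pos hβ hn hcn
  have h1 : mseq β c n ≤ Real.exp (n * β ^ 2 / 2) := by
    rw [mseq_eq hβ hn hcn]
    exact mul_le_of_le_one_right (Real.exp_pos _).le (cdf_le_one _ _)
  gcongr

/-- As `log c ~ β² n` and `mseq ≤ exp (n β² / 2)`, `kseq` grows exponentially; the exponent `β² n /
4` is enough. -/
lemma tendsto_pow_div_kseq (hβ : 0 < β) (hc : Tendsto c atTop atTop)
    (hθ : Tendsto (fun n : ℕ => Real.log (c n) / (β * √(n : ℝ)) - β * √(n : ℝ)) atTop (𝓝 θ))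
    (p : ℕ) : Tendsto (fun n : ℕ => (n : ℝ) ^ p / kseq β c n) atTop (𝓝 0) := by
  have hb : 0 < β ^ 2 / 4 := by positivity
  have h1 : Tendsto (fun n : ℕ => (n : ℝ) ^ p * Real.exp (-(β ^ 2 / 4) * n)) atTop (𝓝 0) := by
    have := (Real.tendsto_pow_mul_exp_neg_atTop_nhds_zero p).comp
      (tendsto_natCast_atTop_atTop.const_mul_atTop hb)
    have h2 := this.const_mul ((β ^ 2 / 4) ^ p)⁻¹
    rw [mul_zero] at h2
    refine h2.congr fun n => ?_
    simp only [Function.comp_apply, mul_pow]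
    field_simp
  refine tendsto_of_tendsto_of_tendsto_of_le_of_le' tendsto_const_nhds h1 ?_ ?_
  · filter_upwards [hc.eventually_gt_atTop 0, eventually_ge_atTop 1] with n hcn hn
    have := kseq_pos hβ hn hcn
    positivity
  · filter_upwards [hc.eventually_gt_atTop 0, eventually_ge_atTop 1,
      hθ.eventually_const_lt (show θ - 1 < θ by linarith),
      tendsto_sqrt_natCast.eventually_ge_atTop ((1 - θ) * 4 / β)] with n hcn hn h4 h5
    have hn' : (0 : ℝ) < n := by exact_mod_cast hn
    have hq0 : 0 < √(n : ℝ) := Real.sqrt_pos.2 hn'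
    have hqq : √(n : ℝ) ^ 2 = n := Real.sq_sqrt hn'.le
    -- The bound on `√n` was chosen so that `1 - θ` costs at most a quarter of `β √n`.
    have h6 : 3 / 4 * β ^ 2 * n ≤ Real.log (c n) := by
      rw [div_le_iff₀ hβ] at h5
      have h7 : 3 / 4 * (β * √n) ≤ Real.log (c n) / (β * √n) := by linarith
      rw [le_div_iff₀ (by positivity)] at h7
      rw [← hqq]; linarith
    have h8 := kseq_lower hβ hn hcn
    have h9 : Real.exp (β ^ 2 / 4 * n) ≤ kseq β c n := by
      refine le_trans ?_ h8
      rw [← Real.exp_log hcn, ← Real.exp_add]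
      refine Real.exp_le_exp.2 ?_
      linarith
    rw [neg_mul, Real.exp_neg, ← div_eq_mul_inv]
    gcongr

lemma tendsto_lowMean_div_mseq (hβ : 0 < β) (hc : Tendsto c atTop atTop)
    (hθ : Tendsto (fun n : ℕ => Real.log (c n) / (β * √(n : ℝ)) - β * √(n : ℝ)) atTop (𝓝 θ)) :
    Tendsto (fun n : ℕ => lowMean β n (c n) / mseq β c n) atTop (𝓝 1) := by
  have h1 := (tendsto_cdf_level hβ hc hθ 0).div (tendsto_cdf_level hβ hc hθ 6)
    (cdf_gaussian_pos θ).ne'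
  rw [div_self (cdf_gaussian_pos θ).ne'] at h1
  refine h1.congr' ?_
  filter_upwards [hc.eventually_gt_atTop 0, eventually_ge_atTop 1] with n hcn hn
  rw [mseq_eq hβ hn hcn, lowMean_eq hβ hn hcn, Pi.div_apply, pow_zero, div_one,
    mul_div_mul_left _ _ (Real.exp_pos _).ne']

lemma tendsto_kseq_mul_siteTrap_zero (hβ : 0 < β) (hc : Tendsto c atTop atTop)
    (hθ : Tendsto (fun n : ℕ => Real.log (c n) / (β * √(n : ℝ)) - β * √(n : ℝ)) atTop (𝓝 θ)) :
    Tendsto (fun n : ℕ => kseq β c n * siteTrap β n (c n)) atTop (𝓝 0) := by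
  have h := (tendsto_kseq_mul_siteTrap hβ hc hθ one_pos).mul
    (tendsto_inv_atTop_zero.comp tendsto_sqrt_natCast)
  rw [mul_zero] at h
  refine h.congr' ?_
  filter_upwards [eventually_ge_atTop 1] with n hn
  have hq0 : 0 < √(n : ℝ) := Real.sqrt_pos.2 (by exact_mod_cast hn)
  simp only [Function.comp_apply, mul_one]
  field_simp

lemma siteHigh_nonneg (β : ℝ) (n : ℕ) (L : ℝ) {c : ℝ} (hc : 0 < c) : 0 ≤ siteHigh β n L c :=
  integral_nonneg fun _ => highWeight_nonneg hc (weight_pos _ _).le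

/-- The middle range contributes `lowMean (c) / mseq - 1 → 0`, and the range above `c` is of order
`1 / √n`. -/
lemma tendsto_kseq_mul_siteHigh (hβ : 0 < β) (hc : Tendsto c atTop atTop)
    (hθ : Tendsto (fun n : ℕ => Real.log (c n) / (β * √(n : ℝ)) - β * √(n : ℝ)) atTop (𝓝 θ)) :
    Tendsto (fun n : ℕ => kseq β c n * siteHigh β n (c n / n ^ 6) (c n)) atTop (𝓝 0) := by
  have h1 := ((tendsto_lowMean_div_mseq hβ hc hθ).sub_const 1).add
    ((tendsto_kseq_mul_siteTrap_zero hβ hc hθ).const_mul (Real.exp 1))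
  rw [sub_self, mul_zero, add_zero] at h1
  refine tendsto_of_tendsto_of_tendsto_of_le_of_le' tendsto_const_nhds h1 ?_ ?_
  · filter_upwards [hc.eventually_gt_atTop 0, eventually_ge_atTop 1] with n hcn hn
    exact mul_nonneg (kseq_pos hβ hn hcn).le (siteHigh_nonneg _ _ _ hcn)
  · filter_upwards [hc.eventually_gt_atTop 0, eventually_ge_atTop 1] with n hcn hn
    have hn' : (1 : ℝ) ≤ n := by exact_mod_cast hn
    have h2 := siteHigh_le β n hcn (div_le_self hcn.le (one_le_pow₀ hn' (n := 6)))
    have hk := kseq_pos hβ hn hcn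
    have hm := mseq_pos hβ hn hcn
    refine (mul_le_mul_of_nonneg_left h2 hk.le).trans (le_of_eq ?_)
    rw [mul_add, kseq]
    change c n / mseq β c n * ((_ - mseq β c n) / c n) + _ = _
    field_simp

end Sequences

end REM

namespace REM

open JumpProcess

/-! ### Averages over the environment -/

section Annealed

variable {n : ℕ}

/-- The law of the environment. -/
noncomputable def envLaw (n : ℕ) : Measure (Cube n → ℝ) := Measure.pi fun _ => siteLaw n

instance : IsProbabilityMeasure (envLaw n) := by unfold envLaw; infer_instance

lemma measurePreserving_env (x : Cube n) :
    MeasurePreserving (fun H : Cube n → ℝ => H x) (envLaw n) (siteLaw n) :=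
  measurePreserving_eval (fun _ : Cube n => siteLaw n) x

lemma integral_env (x : Cube n) {f : ℝ → ℝ} (hf : Measurable f) :
    ∫ H, f (H x) ∂envLaw n = ∫ h, f h ∂siteLaw n := by
  rw [← (measurePreserving_env x).map_eq, integral_map (measurable_pi_apply x).aemeasurable
    hf.aestronglyMeasurable]

/-- Chebyshev's inequality for weighted sums over the environment. -/
lemma envLaw_sum_deviation_le {f : ℝ → ℝ} (hf : MemLp f 2 (siteLaw n)) (a : Cube n → ℝ)
    {y : ℝ} (hy : 0 < y) :
    envLaw n {H | y ≤ |∑ x, a x * f (H x) - (∑ x, a x) * ∫ h, f h ∂siteLaw n|} ≤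
      ENNReal.ofReal ((∑ x, a x ^ 2) * (∫ h, f h ^ 2 ∂siteLaw n) / y ^ 2) := by
  have hmem : ∀ x : Cube n, MemLp (fun H : Cube n → ℝ => f (H x)) 2 (envLaw n) := fun x =>
    hf.comp_measurePreserving (measurePreserving_env x)
  have hmem2 : MemLp (fun H : Cube n → ℝ => ∑ x, a x * f (H x)) 2 (envLaw n) :=
    memLp_finsetSum _ fun x _ => (hmem x).const_mul (a x)
  have hint : ∫ H, (∑ x, a x * f (H x)) ∂envLaw n = (∑ x, a x) * ∫ h, f h ∂siteLaw n := by
    rw [integral_finsetSum _ fun x _ => ((hmem x).const_mul (a x)).integrable one_le_two,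
      Finset.sum_mul]
    refine Finset.sum_congr rfl fun x _ => ?_
    rw [integral_const_mul, ← (measurePreserving_env x).map_eq,
      integral_map (measurable_pi_apply x).aemeasurable]
    rw [(measurePreserving_env x).map_eq]; exact hf.1
  have hvar : Var[fun H : Cube n → ℝ => ∑ x, a x * f (H x); envLaw n] =
      (∑ x, a x ^ 2) * Var[f; siteLaw n] := by
    have h := variance_sum_pi (μ := fun _ : Cube n => siteLaw n)
      (X := fun x h => a x * f h) fun x => hf.const_mul (a x)
    have e : (∑ x : Cube n, fun H : Cube n → ℝ => a x * f (H x)) =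
        fun H => ∑ x, a x * f (H x) := by ext H; simp
    rw [e] at h
    rw [envLaw, h, Finset.sum_mul]
    exact Finset.sum_congr rfl fun x _ => variance_const_mul _ _ _
  have h1 := meas_ge_le_variance_div_sq hmem2 hy
  rw [hint, hvar] at h1
  refine h1.trans (ENNReal.ofReal_le_ofReal ?_)
  have h2 := variance_le_expectation_sq (μ := siteLaw n) hf.1
  simp only [Pi.pow_apply] at h2
  gcongr

/-- Chebyshev's inequality for averages over the cube. -/
lemma envLaw_cubeAvg_deviation_le {f : ℝ → ℝ} (hf : MemLp f 2 (siteLaw n)) {y : ℝ} (hy : 0 < y) :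
    envLaw n {H | y ≤ |cubeAvg (fun x => f (H x)) - ∫ h, f h ∂siteLaw n|} ≤
      ENNReal.ofReal ((∫ h, f h ^ 2 ∂siteLaw n) / (2 ^ n * y ^ 2)) := by
  have hcard : (Fintype.card (Cube n) : ℝ) = 2 ^ n := by
    simp [Fintype.card_pi, Fintype.card_units_int]
  have h := envLaw_sum_deviation_le hf (fun _ => (2 ^ n : ℝ)⁻¹) hy
  simp only [Finset.sum_const, Finset.card_univ, nsmul_eq_mul, hcard, ← Finset.mul_sum] at h
  rw [mul_inv_cancel₀ (by positivity), one_mul] at h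
  refine h.trans (ENNReal.ofReal_le_ofReal (le_of_eq ?_))
  field_simp

lemma memLp_low (β : ℝ) {y : ℝ} :
    MemLp (fun h => if weight β h ≤ y then weight β h else 0) 2 (siteLaw n) := by
  refine MemLp.of_bound (integrable_low β n).1 (max y 0) (ae_of_all _ fun h => ?_)
  split_ifs with h1
  · rw [Real.norm_of_nonneg (weight_pos _ _).le]; exact h1.trans (le_max_left _ _)
  · simp

lemma integral_low_sq_le (β : ℝ) {L : ℝ} :
    ∫ h, (if weight β h ≤ L then weight β h else 0) ^ 2 ∂siteLaw n ≤ L * lowMean β n L := by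
  unfold lowMean
  rw [← integral_const_mul]
  refine integral_mono (memLp_low β).integrable_sq ((integrable_low β n).const_mul _) fun h => ?_
  have := weight_pos β h
  beta_reduce
  split_ifs with h1
  · rw [pow_two]; gcongr
  · simp

/-- The mean number of coincidences of the walk up to time `i`. -/
lemma sum_walkLaw_eq_le (hn : 1 ≤ n) (i : ℕ) :
    ∑ j ∈ Finset.range i, ∑ l ∈ Finset.range i, walkLaw n {J | J j = J l} ≤
      ENNReal.ofReal (i * (2 * n ^ 2 + 3 * i / 2 ^ n)) := by
  classical
  have hadd : ∀ j d, walkLaw n {J | J j = J (j + d)} ≤ ENNReal.ofReal (eigMoment n d) := by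
    intro j d
    have hm : MeasurableSet {J : ℕ → Cube n | J j = J (j + d)} :=
      measurableSet_eq_fun (by fun_prop) (by fun_prop)
    have h := lintegral_walkLaw_apply_two hn j d fun x y => if x = y then 1 else 0
    have e : ∀ J : ℕ → Cube n, (if J j = J (j + d) then (1 : ℝ≥0∞) else 0) =
        {J : ℕ → Cube n | J j = J (j + d)}.indicator 1 J := by
      intro J; simp [Set.indicator]
    simp_rw [e] at h
    rw [lintegral_indicator_one hm] at h
    rw [h]
    simp only [ite_mul, one_mul, zero_mul, Finset.sum_ite_eq, Finset.mem_univ, if_true]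
    calc _ ≤ (2 ^ n : ℝ≥0∞)⁻¹ * ∑ _x : Cube n, ENNReal.ofReal (eigMoment n d) := by
          gcongr with x
          exact walkMatrix_pow_le_eigMoment hn d x x
      _ = _ := by
          rw [Finset.sum_const, Finset.card_univ, nsmul_eq_mul, ← mul_assoc]
          have : (Fintype.card (Cube n) : ℝ≥0∞) = 2 ^ n := by
            simp [Fintype.card_pi, Fintype.card_units_int]
          rw [this, ENNReal.inv_mul_cancel (by simp) (by simp), one_mul]
  -- Pairs of times closer than `n ^ 2` are bounded by `1`, at most `2 n ^ 2` in each row; for the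
  -- others the walk has mixed.
  have hbd : ∀ j l, walkLaw n {J | J j = J l} ≤
      ENNReal.ofReal ((if j < l + n ^ 2 ∧ l < j + n ^ 2 then 1 else 0) + 3 / 2 ^ n) := by
    intro j l
    wlog hjl : j ≤ l generalizing j l
    · have h := this l j (not_le.1 hjl).le
      have e : {J : ℕ → Cube n | J l = J j} = {J | J j = J l} := by
        ext J; exact eq_comm
      rw [e] at h
      simpa only [and_comm] using h
    obtain ⟨d, rfl⟩ := Nat.exists_eq_add_of_le hjl
    refine (hadd j d).trans (ENNReal.ofReal_le_ofReal ?_)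
    have h3 : (0 : ℝ) ≤ 3 / 2 ^ n := by positivity
    split_ifs with h
    · linarith [eigMoment_le_one hn d]
    · rw [zero_add]
      exact eigMoment_le_of_sq_le hn (by have := Nat.pos_of_ne_zero (n := n ^ 2) (by positivity); omega)
  refine (Finset.sum_le_sum fun j _ => Finset.sum_le_sum fun l _ => hbd j l).trans ?_
  have hnn : ∀ j l : ℕ, (0 : ℝ) ≤ (if j < l + n ^ 2 ∧ l < j + n ^ 2 then 1 else 0) + 3 / 2 ^ n := by
    intro j l; split_ifs <;> positivity
  simp_rw [← ENNReal.ofReal_sum_of_nonneg fun l (_ : l ∈ Finset.range i) => hnn _ l]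
  rw [← ENNReal.ofReal_sum_of_nonneg fun j _ => Finset.sum_nonneg fun l _ => hnn j l]
  refine ENNReal.ofReal_le_ofReal ?_
  have hrow : ∀ j ∈ Finset.range i, ∑ l ∈ Finset.range i,
      ((if j < l + n ^ 2 ∧ l < j + n ^ 2 then (1 : ℝ) else 0) + 3 / 2 ^ n) ≤
      2 * n ^ 2 + 3 * i / 2 ^ n := by
    intro j _
    rw [Finset.sum_add_distrib, Finset.sum_const, Finset.card_range, nsmul_eq_mul,
      ← Finset.sum_filter, Finset.sum_const, nsmul_eq_mul, mul_one]
    have hc : ((Finset.range i).filter fun l => j < l + n ^ 2 ∧ l < j + n ^ 2).card ≤ 2 * n ^ 2 := by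
      calc _ ≤ (Finset.Ico (j + 1 - n ^ 2) (j + n ^ 2)).card := by
            refine Finset.card_le_card fun l hl => ?_
            rw [Finset.mem_filter] at hl
            rw [Finset.mem_Ico]; omega
        _ ≤ _ := by rw [Nat.card_Ico]; omega
    have hc' : (((Finset.range i).filter fun l => j < l + n ^ 2 ∧ l < j + n ^ 2).card : ℝ) ≤
        2 * n ^ 2 := by exact_mod_cast hc
    have e : (i : ℝ) * (3 / 2 ^ n) = 3 * i / 2 ^ n := by ring
    linarith
  refine (Finset.sum_le_sum hrow).trans (le_of_eq ?_)
  rw [Finset.sum_const, Finset.card_range, nsmul_eq_mul]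

/-- Deviation of the mean of the clock in the environment, for a fixed path of the walk. -/
lemma envLaw_path_deviation_le (β : ℝ) {L m y : ℝ} (hm : m = lowMean β n L) (hy : 0 < y) (i : ℕ)
    (J : ℕ → Cube n) :
    envLaw n {H | y ≤ |∑ j ∈ Finset.range i, lowPart L (tau β H) (J j) - i * m|} ≤
      ENNReal.ofReal (L * m / y ^ 2) *
        ∑ j ∈ Finset.range i, ∑ l ∈ Finset.range i, {J : ℕ → Cube n | J j = J l}.indicator 1 J := by
  classical
  set f : ℝ → ℝ := fun h => if weight β h ≤ L then weight β h else 0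
  -- `a` is the local time of the path. The sum along the path is a weighted sum of independent
  -- variables, and `∑ a x ^ 2` counts the pairs of coinciding times.
  set a : Cube n → ℝ := fun x => ∑ j ∈ Finset.range i, if J j = x then 1 else 0 with ha
  have h1 : ∀ H : Cube n → ℝ, ∑ j ∈ Finset.range i, lowPart L (tau β H) (J j) =
      ∑ x, a x * f (H x) := by
    intro H
    simp_rw [ha, Finset.sum_mul]
    rw [Finset.sum_comm]
    refine Finset.sum_congr rfl fun j _ => ?_
    simp only [ite_mul, one_mul, zero_mul, Finset.sum_ite_eq, Finset.mem_univ, if_true]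
    rfl
  have h2 : ∑ x, a x = i := by
    simp_rw [ha]
    rw [Finset.sum_comm]
    simp
  have h3 : ∑ x, a x ^ 2 =
      ∑ j ∈ Finset.range i, ∑ l ∈ Finset.range i, if J j = J l then (1 : ℝ) else 0 := by
    simp_rw [ha, pow_two, Finset.sum_mul_sum]
    rw [Finset.sum_comm]
    refine Finset.sum_congr rfl fun j _ => ?_
    rw [Finset.sum_comm]
    refine Finset.sum_congr rfl fun l _ => ?_
    simp [eq_comm]
  have h := envLaw_sum_deviation_le (memLp_low (n := n) β (y := L)) a hy
  simp_rw [h1]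
  rw [h2, show (∫ h, (if weight β h ≤ L then weight β h else 0) ∂siteLaw n) = m from hm.symm] at h
  refine h.trans ?_
  have h0 : 0 ≤ ∑ x, a x ^ 2 := Finset.sum_nonneg fun x _ => sq_nonneg _
  have hLm := integral_low_sq_le (n := n) β (L := L)
  rw [← hm] at hLm
  have h5 : ENNReal.ofReal (∑ x, a x ^ 2) =
      ∑ j ∈ Finset.range i, ∑ l ∈ Finset.range i, {J : ℕ → Cube n | J j = J l}.indicator 1 J := by
    rw [h3, ENNReal.ofReal_sum_of_nonneg fun j _ => Finset.sum_nonneg fun l _ => by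
      split_ifs <;> norm_num]
    refine Finset.sum_congr rfl fun j _ => ?_
    rw [ENNReal.ofReal_sum_of_nonneg fun l _ => by split_ifs <;> norm_num]
    refine Finset.sum_congr rfl fun l _ => ?_
    simp only [Set.indicator, Set.mem_ofPred_eq]
    split_ifs <;> simp
  rw [← h5, ← ENNReal.ofReal_mul' h0]
  refine ENNReal.ofReal_le_ofReal ?_
  rw [div_mul_eq_mul_div, mul_comm (∑ x, a x ^ 2)]
  gcongr

/-- Deviation of the clock from its mean in the environment, for a fixed environment and path. -/
lemma expLaw_clock_deviation_le (σ : Cube n → ℝ) {y : ℝ} (hy : 0 < y) (i : ℕ)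
    (J : ℕ → Cube n) :
    expLaw {e | y ≤ |clock σ (J, e) i - ∑ j ∈ Finset.range i, σ (J j)|} ≤
      ∑ j ∈ Finset.range i, ENNReal.ofReal (σ (J j) ^ 2 / y ^ 2) := by
  have hmp : ∀ j : ℕ, MeasurePreserving (fun e : ℕ → ℝ => e j) expLaw (expMeasure 1) := fun j =>
    ⟨measurable_pi_apply j, map_expLaw j⟩
  have hmem : ∀ j, MemLp (fun e : ℕ → ℝ => σ (J j) * e j) 2 expLaw := fun j =>
    (memLp_expMeasure.comp_measurePreserving (hmp j)).const_mul _
  have hvar : Var[fun e : ℕ → ℝ => clock σ (J, e) i; expLaw] =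
      ∑ j ∈ Finset.range i, σ (J j) ^ 2 := by
    have h := IndepFun.variance_sum (μ := expLaw) (s := Finset.range i)
      (X := fun j e => σ (J j) * e j) (fun j _ => hmem j) fun j _ l _ hjl =>
        (iIndepFun_expLaw.indepFun hjl).comp (φ := fun x => σ (J j) * x)
          (ψ := fun x => σ (J l) * x) (by fun_prop) (by fun_prop)
    have e : (∑ j ∈ Finset.range i, fun e : ℕ → ℝ => σ (J j) * e j) =
        fun e => clock σ (J, e) i := by ext e; simp [clock]
    rw [e] at h
    rw [h]
    refine Finset.sum_congr rfl fun j _ => ?_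
    rw [variance_const_mul, (hmp j).variance_fun_comp (f := fun x => x) (by fun_prop),
      variance_expMeasure, mul_one]
  have hmem2 : MemLp (fun e : ℕ → ℝ => clock σ (J, e) i) 2 expLaw :=
    memLp_finsetSum _ fun j _ => hmem j
  have hint : ∫ e, clock σ (J, e) i ∂expLaw = ∑ j ∈ Finset.range i, σ (J j) := by
    unfold clock
    rw [integral_finsetSum _ fun j _ => (hmem j).integrable one_le_two]
    refine Finset.sum_congr rfl fun j _ => ?_
    have : ∫ e : ℕ → ℝ, e j ∂expLaw = 1 := by
      rw [← integral_expMeasure, ← map_expLaw j,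
        integral_map (measurable_pi_apply j).aemeasurable (by fun_prop)]
    rw [integral_const_mul, this, mul_one]
  have h := meas_ge_le_variance_div_sq hmem2 hy
  rw [hint, hvar] at h
  refine h.trans (le_of_eq ?_)
  rw [Finset.sum_div, ENNReal.ofReal_sum_of_nonneg fun j _ => by positivity]

lemma measurable_env_eval {α : Type*} [MeasurableSpace α] {f : ℝ → α} (hf : Measurable f) (j : ℕ) :
    Measurable fun p : (Cube n → ℝ) × (ℕ → Cube n) => f (p.1 (p.2 j)) := by
  have h : Measurable fun q : (Cube n → ℝ) × Cube n => q.1 q.2 :=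
    measurable_from_prod_countable_left fun x => measurable_pi_apply x
  exact hf.comp (h.comp (measurable_fst.prodMk ((measurable_pi_apply j).comp measurable_snd)))

lemma measurable_lowWeight (β : ℝ) {L : ℝ} :
    Measurable fun h => if weight β h ≤ L then weight β h else 0 :=
  Measurable.ite (measurableSet_le (by fun_prop) measurable_const) (by fun_prop) measurable_const

lemma lintegral_env_walk_le {f : ℝ → ℝ} (hfm : Measurable f) (hf : MemLp f 2 (siteLaw n)) {y : ℝ}
    (j : ℕ) :
    ∫⁻ H, ∫⁻ J, ENNReal.ofReal (f (H (J j)) ^ 2 / y ^ 2) ∂walkLaw n ∂envLaw n ≤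
      ENNReal.ofReal ((∫ h, f h ^ 2 ∂siteLaw n) / y ^ 2) := by
  have hg : Measurable fun h => ENNReal.ofReal (f h ^ 2 / y ^ 2) := by fun_prop
  rw [lintegral_lintegral_swap (measurable_env_eval hg j).aemeasurable]
  have h1 : ∀ x : Cube n, ∫⁻ H, ENNReal.ofReal (f (H x) ^ 2 / y ^ 2) ∂envLaw n =
      ENNReal.ofReal ((∫ h, f h ^ 2 ∂siteLaw n) / y ^ 2) := by
    intro x
    rw [(measurePreserving_env x).lintegral_comp hg,
      ← ofReal_integral_eq_lintegral_ofReal (hf.integrable_sq.div_const _)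
      (ae_of_all _ fun h => by positivity), integral_div]
  refine (lintegral_mono fun J : ℕ → Cube n => (h1 (J j)).le).trans ?_
  simp

lemma measurableSet_path_deviation {f : ℝ → ℝ} (hf : Measurable f) (y z : ℝ) (i : ℕ) :
    MeasurableSet {p : (Cube n → ℝ) × (ℕ → Cube n) |
      y ≤ |∑ j ∈ Finset.range i, f (p.1 (p.2 j)) - z|} := by
  refine measurableSet_le measurable_const ?_
  have : Measurable fun p : (Cube n → ℝ) × (ℕ → Cube n) =>
      ∑ j ∈ Finset.range i, f (p.1 (p.2 j)) :=
    Finset.measurable_sum _ fun j _ => measurable_env_eval hf j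
  fun_prop

lemma measurableSet_lowDev (τ : Cube n → ℝ) (L m y : ℝ) (i : ℕ) :
    MeasurableSet (lowDev τ L m y i) := by
  refine measurableSet_lt measurable_const ?_
  have := measurable_clock (lowPart L τ) i
  fun_prop

/-- Two sources of fluctuation, with `y` allotted to each: the exponential variables given the path,
by Chebyshev's inequality, and the path sum of the mean holding times. -/
lemma dynLaw_lowDev_le (τ : Cube n → ℝ) {L m y : ℝ} (hy : 0 < y) (i : ℕ) :
    dynLaw n (lowDev τ L m (2 * y) i) ≤
      (∑ j ∈ Finset.range i, ∫⁻ J, ENNReal.ofReal (lowPart L τ (J j) ^ 2 / y ^ 2) ∂walkLaw n) +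
      walkLaw n {J | y ≤ |∑ j ∈ Finset.range i, lowPart L τ (J j) - i * m|} := by
  have hfm2 : ∀ j, Measurable fun J : ℕ → Cube n =>
      ENNReal.ofReal (lowPart L τ (J j) ^ 2 / y ^ 2) := fun j =>
    (measurable_of_finite fun x => ENNReal.ofReal (lowPart L τ x ^ 2 / y ^ 2)).comp
      (measurable_pi_apply j)
  have hD : MeasurableSet {J : ℕ → Cube n |
      y ≤ |∑ j ∈ Finset.range i, lowPart L τ (J j) - i * m|} := by
    refine measurableSet_le measurable_const ?_
    have : Measurable fun J : ℕ → Cube n => ∑ j ∈ Finset.range i, lowPart L τ (J j) :=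
      Finset.measurable_sum _ fun j _ =>
        (measurable_of_finite (lowPart L τ)).comp (measurable_pi_apply j)
    fun_prop
  rw [dynLaw_apply_left (measurableSet_lowDev τ L m (2 * y) i),
    ← lintegral_finsetSum _ fun j _ => hfm2 j, ← lintegral_indicator_one hD, ← lintegral_add_left
    (Finset.measurable_sum _ fun j _ => hfm2 j)]
  refine lintegral_mono fun J => ?_
  beta_reduce
  by_cases hJ : J ∈ {J : ℕ → Cube n | y ≤ |∑ j ∈ Finset.range i, lowPart L τ (J j) - i * m|}
  · rw [Set.indicator_of_mem hJ]
    exact prob_le_one.trans le_add_self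
  · have hJ' : |∑ j ∈ Finset.range i, lowPart L τ (J j) - i * m| < y := not_le.1 hJ
    refine le_trans (le_trans (measure_mono ?_)
      (expLaw_clock_deviation_le (lowPart L τ) hy i J)) le_self_add
    intro e he
    have he' : 2 * y < |clock (lowPart L τ) (J, e) i - i * m| := he
    change y ≤ |clock (lowPart L τ) (J, e) i - ∑ j ∈ Finset.range i, lowPart L τ (J j)|
    have := abs_sub_le (clock (lowPart L τ) (J, e) i)
      (∑ j ∈ Finset.range i, lowPart L τ (J j)) (i * m)
    linarith

/-- By Tonelli the environment is integrated first with the path fixed; the walk then enters only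
through its coincidences. -/
lemma lintegral_path_deviation_le (hn : 1 ≤ n) (β : ℝ) {L m y : ℝ} (hm : m = lowMean β n L)
    (hy : 0 < y) (i : ℕ) :
    ∫⁻ H, walkLaw n {J | y ≤ |∑ j ∈ Finset.range i, lowPart L (tau β H) (J j) - i * m|}
      ∂envLaw n ≤
    ENNReal.ofReal (L * m / y ^ 2) * ENNReal.ofReal (i * (2 * n ^ 2 + 3 * i / 2 ^ n)) := by
  have hDm : MeasurableSet {p : (Cube n → ℝ) × (ℕ → Cube n) |
      y ≤ |∑ j ∈ Finset.range i, lowPart L (tau β p.1) (p.2 j) - i * m|} :=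
    measurableSet_path_deviation (measurable_lowWeight β (L := L)) y (i * m) i
  have h1 := Measure.prod_apply (μ := envLaw n) (ν := walkLaw n) hDm
  have h2 := Measure.prod_apply_symm (μ := envLaw n) (ν := walkLaw n) hDm
  have h3 := h1.symm.trans h2
  refine (le_of_eq h3).trans ?_
  have hmE : ∀ j l, MeasurableSet {J : ℕ → Cube n | J j = J l} := fun j l =>
    measurableSet_eq_fun (by fun_prop) (by fun_prop)
  refine (lintegral_mono fun J => envLaw_path_deviation_le β hm hy i J).trans ?_
  rw [lintegral_const_mul, lintegral_finsetSum]
  · refine mul_le_mul' le_rfl (le_trans (le_of_eq ?_) (sum_walkLaw_eq_le hn i))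
    refine Finset.sum_congr rfl fun j _ => ?_
    rw [lintegral_finsetSum _ fun l _ => measurable_one.indicator (hmE j l)]
    exact Finset.sum_congr rfl fun l _ => lintegral_indicator_one (hmE j l)
  · exact fun j _ => Finset.measurable_sum _ fun l _ => measurable_one.indicator (hmE j l)
  · exact Finset.measurable_sum _ fun j _ =>
      Finset.measurable_sum _ fun l _ => measurable_one.indicator (hmE j l)

lemma measurable_dynLaw_lowDev (β : ℝ) (L m y : ℝ) (i : ℕ) :
    Measurable fun H : Cube n → ℝ => dynLaw n (lowDev (tau β H) L m y i) := by
  have hT : Measurable fun p : (Cube n → ℝ) × Sample n =>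
      ∑ j ∈ Finset.range i, lowPart L (tau β p.1) (p.2.1 j) * p.2.2 j := by
    refine Finset.measurable_sum _ fun j _ => Measurable.mul ?_ (by fun_prop)
    exact (measurable_env_eval (measurable_lowWeight β (L := L)) j).comp
      (measurable_fst.prodMk (measurable_fst.comp measurable_snd))
  have hD : MeasurableSet {p : (Cube n → ℝ) × Sample n |
      y < |∑ j ∈ Finset.range i, lowPart L (tau β p.1) (p.2.1 j) * p.2.2 j - i * m|} :=
    measurableSet_lt measurable_const (by fun_prop)
  exact measurable_measure_prodMk_left hD

/-- The mean over the environment of the probability that the truncated clock deviates. -/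
lemma lintegral_lowDev_le (hn : 1 ≤ n) (β : ℝ) {L m y : ℝ} (hm : m = lowMean β n L)
    (hL : 0 ≤ L) (hy : 0 < y) (i : ℕ) :
    ∫⁻ H, dynLaw n (lowDev (tau β H) L m y i) ∂envLaw n ≤
      ENNReal.ofReal (4 * (L * m) / y ^ 2 * i * (1 + 2 * n ^ 2 + 3 * i / 2 ^ n)) := by
  have hy2 : 0 < y / 2 := by positivity
  have hm0 : 0 ≤ m := by
    rw [hm]; exact integral_nonneg fun h => by
      beta_reduce; split_ifs; exacts [(weight_pos _ _).le, le_rfl]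
  have hmj : ∀ j, Measurable fun H : Cube n → ℝ =>
      ∫⁻ J, ENNReal.ofReal (lowPart L (tau β H) (J j) ^ 2 / (y / 2) ^ 2) ∂walkLaw n := fun j =>
    Measurable.lintegral_prod_right'
      (measurable_env_eval (f := fun h => ENNReal.ofReal
        ((if weight β h ≤ L then weight β h else 0) ^ 2 / (y / 2) ^ 2))
        ((((measurable_lowWeight β).pow_const 2).div_const _).ennreal_ofReal) j)
  have hfirst : ∀ j, ∫⁻ H, ∫⁻ J, ENNReal.ofReal (lowPart L (tau β H) (J j) ^ 2 / (y / 2) ^ 2)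
      ∂walkLaw n ∂envLaw n ≤ ENNReal.ofReal (L * m / (y / 2) ^ 2) := by
    intro j
    refine (lintegral_env_walk_le (measurable_lowWeight β (L := L)) (memLp_low β) j).trans ?_
    refine ENNReal.ofReal_le_ofReal (div_le_div_of_nonneg_right ?_ (by positivity))
    rw [hm]
    exact integral_low_sq_le β
  have hpt : ∀ H : Cube n → ℝ, dynLaw n (lowDev (tau β H) L m y i) ≤
      (∑ j ∈ Finset.range i,
        ∫⁻ J, ENNReal.ofReal (lowPart L (tau β H) (J j) ^ 2 / (y / 2) ^ 2) ∂walkLaw n) +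
      walkLaw n {J | y / 2 ≤ |∑ j ∈ Finset.range i, lowPart L (tau β H) (J j) - i * m|} := by
    intro H
    have h := dynLaw_lowDev_le (tau β H) (L := L) (m := m) hy2 i
    rwa [mul_div_cancel₀ _ (two_ne_zero' ℝ)] at h
  refine (lintegral_mono hpt).trans ?_
  rw [lintegral_add_left (Finset.measurable_sum _ fun j _ => hmj j),
    lintegral_finsetSum _ fun j _ => hmj j]
  refine (add_le_add (Finset.sum_le_sum fun j _ => hfirst j)
    (lintegral_path_deviation_le hn β hm hy2 i)).trans (le_of_eq ?_)
  have hnn : 0 ≤ L * m / (y / 2) ^ 2 := by positivity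
  rw [Finset.sum_const, Finset.card_range, nsmul_eq_mul, ← ENNReal.ofReal_natCast,
    ← ENNReal.ofReal_mul (by positivity), ← ENNReal.ofReal_mul hnn,
    ← ENNReal.ofReal_add (by positivity) (by positivity)]
  congr 1
  field_simp
  ring

/-- The mean over the environment of `closePair`. -/
lemma integral_closePair_le (hn : 1 ≤ n) (β : ℝ) {y z : ℝ} (hy : 0 ≤ y) (hz : 0 ≤ z) (d : ℕ) :
    Integrable (fun H => closePair (tau β H) y z d) (envLaw n) ∧
    ∫ H, closePair (tau β H) y z d ∂envLaw n ≤ siteTrap β n y * siteTrap β n z := by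
  classical
  have hexp : ∀ {u : ℝ}, Measurable fun h => Real.exp (-(u / weight β h)) := fun {u} =>
    ((measurable_const.div (measurable_weight β)).neg).exp
  have hterm : ∀ x x' : Cube n, Integrable (fun H : Cube n → ℝ => if x = x' then 0 else
      Real.exp (-(y / tau β H x)) * Real.exp (-(z / tau β H x')) * (walkMatrix n ^ d) x x')
      (envLaw n) := by
    intro x x'
    split_ifs
    · exact integrable_zero _ _ _
    · refine Integrable.mul_const ?_ _
      refine Integrable.of_bound (C := 1) (Measurable.aestronglyMeasurable ?_)
        (ae_of_all _ fun H => ?_)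
      · exact (hexp.comp (measurable_pi_apply x)).mul (hexp.comp (measurable_pi_apply x'))
      · rw [Real.norm_of_nonneg (by positivity), ← Real.exp_add, Real.exp_le_one_iff]
        have h1 := div_nonneg hy (tau_pos β H x).le
        have h2 := div_nonneg hz (tau_pos β H x').le
        linarith
  have hval : ∀ x x' : Cube n, ∫ H, (if x = x' then 0 else
      Real.exp (-(y / tau β H x)) * Real.exp (-(z / tau β H x')) * (walkMatrix n ^ d) x x')
      ∂envLaw n ≤ siteTrap β n y * siteTrap β n z * (walkMatrix n ^ d) x x' := by
    intro x x'
    have h0 := walkMatrix_pow_nonneg d x x'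
    have h1 := siteTrap_nonneg β n y
    have h2 := siteTrap_nonneg β n z
    split_ifs with hx
    · rw [integral_zero]; positivity
    · rw [integral_mul_const]
      refine mul_le_mul_of_nonneg_right (le_of_eq ?_) h0
      -- Independence is available because equal vertices were left out of `closePair`.
      have hind : IndepFun (fun H : Cube n → ℝ => Real.exp (-(y / tau β H x)))
          (fun H => Real.exp (-(z / tau β H x'))) (envLaw n) := by
        have := (iIndepFun_pi (μ := fun _ : Cube n => siteLaw n) (X := fun _ h => h)
          fun _ => aemeasurable_id).indepFun hx
        exact this.comp (φ := fun h => Real.exp (-(y / weight β h)))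
          (ψ := fun h => Real.exp (-(z / weight β h))) hexp hexp
      rw [hind.integral_fun_mul_eq_mul_integral
        (hexp.comp (measurable_pi_apply x)).aestronglyMeasurable
        (hexp.comp (measurable_pi_apply x')).aestronglyMeasurable]
      exact congrArg₂ _ (integral_env x hexp) (integral_env x' hexp)
  unfold closePair cubeAvg
  refine ⟨(integrable_finsetSum _ fun x _ =>
    integrable_finsetSum _ fun x' _ => hterm x x').const_mul _, ?_⟩
  rw [integral_const_mul, integral_finsetSum _ fun x _ =>
    integrable_finsetSum _ fun x' _ => hterm x x']
  simp_rw [integral_finsetSum _ fun x' _ => hterm _ x']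
  calc _ ≤ (2 ^ n : ℝ)⁻¹ * ∑ x : Cube n, ∑ x' : Cube n,
        siteTrap β n y * siteTrap β n z * (walkMatrix n ^ d) x x' := by
        gcongr with x _ x' _
        exact hval x x'
    _ = _ := by
        rw [Finset.sum_comm]
        simp_rw [← Finset.mul_sum, sum_walkMatrix_pow hn]
        simp only [mul_one, Finset.sum_const, Finset.card_univ, nsmul_eq_mul]
        have : (Fintype.card (Cube n) : ℝ) = 2 ^ n := by
          simp [Fintype.card_pi, Fintype.card_units_int]
        rw [this]
        field_simp

end Annealed

end REM

namespace REM

/-! ### The mean of the main term -/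

section MainTerm

/-- With `⌈U⌉₊ = k + 1`, the usual comparison on `[0, k]` leaves one summand and the integral over
`[k, U]`, of length at most `1`; each lies between `0` and `F U`. -/
lemma abs_sum_sub_integral_le_of_monotoneOn {F : ℝ → ℝ} {U : ℝ} (hU : 0 < U)
    (hF : MonotoneOn F (Set.Icc 0 U)) (h0 : ∀ x ∈ Set.Icc 0 U, 0 ≤ F x) :
    |∑ i ∈ Finset.range ⌈U⌉₊, F i - ∫ x in (0)..U, F x| ≤ F U := by
  obtain ⟨k, hk⟩ : ∃ k, ⌈U⌉₊ = k + 1 := ⟨⌈U⌉₊ - 1, by have := Nat.ceil_pos.2 hU; omega⟩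
  have hkU : (k : ℝ) < U := Nat.lt_ceil.1 (by omega)
  have hUk : U ≤ k + 1 := by have := Nat.le_ceil U; rw [hk] at this; exact_mod_cast this
  have hk0 : (0 : ℝ) ≤ k := k.cast_nonneg
  have hmk : MonotoneOn F (Set.Icc (0 : ℝ) (0 + (k : ℕ))) := hF.mono (by
    rw [zero_add]; exact Set.Icc_subset_Icc le_rfl hkU.le)
  have hup := hmk.sum_le_integral
  have hlo := hmk.integral_le_sum
  simp only [zero_add] at hup hlo
  have hi1 : IntervalIntegrable F volume 0 k := by
    refine MonotoneOn.intervalIntegrable ?_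
    rw [Set.uIcc_of_le hk0]; exact hF.mono (Set.Icc_subset_Icc le_rfl hkU.le)
  have hm2 : MonotoneOn F (Set.Icc (k : ℝ) U) := hF.mono (Set.Icc_subset_Icc hk0 le_rfl)
  have hi2 : IntervalIntegrable F volume k U := by
    refine MonotoneOn.intervalIntegrable ?_
    rw [Set.uIcc_of_le hkU.le]; exact hm2
  rw [← intervalIntegral.integral_add_adjacent_intervals hi1 hi2]
  have h1 : 0 ≤ ∫ x in (k : ℝ)..U, F x :=
    intervalIntegral.integral_nonneg hkU.le fun x hx => h0 x ⟨hk0.trans hx.1, hx.2⟩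
  have h2 : ∫ x in (k : ℝ)..U, F x ≤ F U := by
    have h3 := intervalIntegral.integral_mono_on hkU.le hi2
      (intervalIntegrable_const (c := F U)) fun x hx =>
      hF ⟨hk0.trans hx.1, hx.2⟩ ⟨hU.le, le_rfl⟩ hx.2
    rw [intervalIntegral.integral_const, smul_eq_mul] at h3
    have h4 := h0 U ⟨hU.le, le_rfl⟩
    nlinarith
  rw [hk, abs_le]
  constructor
  · rw [Finset.sum_range_succ']
    have := h0 0 ⟨le_rfl, hU.le⟩
    push_cast at hlo ⊢
    linarith
  · rw [Finset.sum_range_succ]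
    have := hF ⟨hk0, hkU.le⟩ ⟨hU.le, le_rfl⟩ hkU.le
    linarith

lemma integral_inv_sub {V u : ℝ} (hu : 0 < u) (huV : u < V) (κ : ℝ) :
    ∫ x in (0)..u, κ / (V - x) = κ * Real.log (V / (V - u)) := by
  simp_rw [div_eq_mul_inv κ]
  rw [intervalIntegral.integral_const_mul,
    intervalIntegral.integral_comp_sub_left (fun x => x⁻¹) V, sub_zero,
    integral_inv_of_pos (by linarith) (by linarith)]

variable {β θ : ℝ} {c : ℕ → ℝ}

lemma tendsto_inv_kseq (hβ : 0 < β) (hc : Tendsto c atTop atTop)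
    (hθ : Tendsto (fun n : ℕ => Real.log (c n) / (β * √(n : ℝ)) - β * √(n : ℝ)) atTop (𝓝 θ)) :
    Tendsto (fun n : ℕ => (kseq β c n)⁻¹) atTop (𝓝 0) :=
  (tendsto_pow_div_kseq hβ hc hθ 0).congr fun n => by rw [pow_zero, one_div]

/-- The mean of the main term. -/
lemma tendsto_sum_siteTrap (hβ : 0 < β) (hc : Tendsto c atTop atTop)
    (hθ : Tendsto (fun n : ℕ => Real.log (c n) / (β * √(n : ℝ)) - β * √(n : ℝ)) atTop (𝓝 θ))
    {V u : ℝ} (hu : 0 < u) (huV : u < V) :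
    Tendsto (fun n : ℕ => √(n : ℝ) * ∑ i ∈ Finset.range ⌈u * kseq β c n⌉₊,
      siteTrap β n (c n * (V - i / kseq β c n))) atTop
      (𝓝 (tailConst β θ * Real.log (V / (V - u)))) := by
  set g : ℕ → ℝ → ℝ := fun n v => √(n : ℝ) * kseq β c n * siteTrap β n (c n * v) with hg
  have hVu : 0 < V - u := by linarith
  have hganti : ∀ n, 1 ≤ n → 0 < c n → ∀ v w, 0 < v → v ≤ w → g n w ≤ g n v := by
    intro n hn hcn v w hv hvw
    have := kseq_pos hβ hn hcn
    exact mul_le_mul_of_nonneg_left (siteTrap_antitone β n (by positivity) (by gcongr))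
      (by positivity)
  have hg0 : ∀ n, 1 ≤ n → 0 < c n → ∀ v, 0 ≤ g n v := by
    intro n hn hcn v
    have := kseq_pos hβ hn hcn
    have := siteTrap_nonneg β n (c n * v)
    positivity
  have hmono : ∀ n, 1 ≤ n → 0 < c n → MonotoneOn (fun x => g n (V - x)) (Set.Icc 0 u) :=
    fun n hn hcn x hx y hy hxy => hganti n hn hcn _ _ (by linarith [hy.2]) (by linarith)
  -- Dominated convergence: by monotonicity the integrand is largest at `x = u`, where it converges.
  have hint : Tendsto (fun n => ∫ x in (0)..u, g n (V - x)) atTop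
      (𝓝 (tailConst β θ * Real.log (V / (V - u)))) := by
    rw [← integral_inv_sub hu huV]
    refine intervalIntegral.tendsto_integral_filter_of_dominated_convergence
      (fun _ => tailConst β θ / (V - u) + 1) ?_ ?_ intervalIntegrable_const ?_
    · filter_upwards [hc.eventually_gt_atTop 0, eventually_ge_atTop 1] with n hcn hn
      have : IntervalIntegrable (fun x => g n (V - x)) volume 0 u := by
        refine MonotoneOn.intervalIntegrable ?_
        rw [Set.uIcc_of_le hu.le]
        exact hmono n hn hcn
      rw [Set.uIoc_of_le hu.le]
      exact this.1.aestronglyMeasurable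
    · filter_upwards [hc.eventually_gt_atTop 0, eventually_ge_atTop 1,
        (tendsto_kseq_mul_siteTrap hβ hc hθ hVu).eventually_lt_const (lt_add_one _)]
        with n hcn hn h1
      refine ae_of_all _ fun x hx => ?_
      rw [Set.uIoc_of_le hu.le] at hx
      rw [Real.norm_of_nonneg (hg0 n hn hcn _)]
      exact (hganti n hn hcn _ _ hVu (by linarith [hx.2])).trans h1.le
    · refine ae_of_all _ fun x hx => ?_
      rw [Set.uIoc_of_le hu.le] at hx
      exact tendsto_kseq_mul_siteTrap hβ hc hθ (by linarith [hx.2])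
  have herr : Tendsto (fun n => g n (V - u) * (kseq β c n)⁻¹) atTop (𝓝 0) := by
    have := (tendsto_kseq_mul_siteTrap hβ hc hθ hVu).mul (tendsto_inv_kseq hβ hc hθ)
    rwa [mul_zero] at this
  -- The sum is a Riemann sum of mesh `1 / kseq`, so it differs from the integral by at most its
  -- largest value times the mesh.
  have hdiff : Tendsto (fun n : ℕ => √(n : ℝ) * ∑ i ∈ Finset.range ⌈u * kseq β c n⌉₊,
      siteTrap β n (c n * (V - i / kseq β c n)) - ∫ x in (0)..u, g n (V - x)) atTop (𝓝 0) := by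
    refine squeeze_zero_norm' ?_ herr
    filter_upwards [hc.eventually_gt_atTop 0, eventually_ge_atTop 1] with n hcn hn
    have hK := kseq_pos hβ hn hcn
    have h1 := abs_sum_sub_integral_le_of_monotoneOn
      (F := fun x => g n (V - x / kseq β c n) * (kseq β c n)⁻¹) (U := u * kseq β c n)
      (by positivity) ?_ ?_
    · rw [Real.norm_eq_abs]
      refine le_trans (le_of_eq ?_) (h1.trans (le_of_eq ?_))
      · congr 1
        congr 1
        · rw [Finset.mul_sum]
          refine Finset.sum_congr rfl fun i _ => ?_
          simp only [hg]
          field_simp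
        · rw [intervalIntegral.integral_mul_const,
            intervalIntegral.integral_comp_div (fun x => g n (V - x)) hK.ne', zero_div,
            mul_div_cancel_right₀ _ hK.ne', smul_eq_mul]
          field_simp
      · rw [mul_div_cancel_right₀ _ hK.ne']
    · intro x hx y hy hxy
      refine mul_le_mul_of_nonneg_right (hmono n hn hcn ?_ ?_ ?_) (by positivity)
      · exact ⟨div_nonneg hx.1 hK.le, (div_le_iff₀ hK).2 hx.2⟩
      · exact ⟨div_nonneg hy.1 hK.le, (div_le_iff₀ hK).2 hy.2⟩
      · gcongr
    · intro x hx
      exact mul_nonneg (hg0 n hn hcn _) (by positivity)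
  have := hdiff.add hint
  rw [zero_add] at this
  exact this.congr fun n => sub_add_cancel _ _

end MainTerm

end REM

namespace REM

/-! ### Rare events of the environment -/

section Rare

/-- Events whose probabilities are at most `r`, up to a constant factor and a summable sequence. -/
def Rare (r : ℕ → ℝ) (A : (n : ℕ) → Set (Cube n → ℝ)) : Prop :=
  ∃ C : ℝ≥0, ∃ b : ℕ → ℝ≥0∞, ∑' n, b n ≠ ⊤ ∧
    ∀ᶠ n in atTop, envLaw n (A n) ≤ C * ENNReal.ofReal (r n) + b n

variable {r : ℕ → ℝ} {A B : (n : ℕ) → Set (Cube n → ℝ)}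

lemma Rare.mono (hA : Rare r A) (h : ∀ᶠ n in atTop, B n ⊆ A n) : Rare r B := by
  obtain ⟨C, b, hb, hC⟩ := hA
  refine ⟨C, b, hb, ?_⟩
  filter_upwards [h, hC] with n h1 h2
  exact (measure_mono h1).trans h2

lemma Rare.union (hA : Rare r A) (hB : Rare r B) : Rare r fun n => A n ∪ B n := by
  obtain ⟨C, b, hb, hC⟩ := hA
  obtain ⟨C', b', hb', hC'⟩ := hB
  refine ⟨C + C', fun n => b n + b' n, ?_, ?_⟩
  · rw [ENNReal.tsum_add]; exact ENNReal.add_ne_top.2 ⟨hb, hb'⟩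
  · filter_upwards [hC, hC'] with n h1 h2
    refine (measure_union_le _ _).trans ((add_le_add h1 h2).trans (le_of_eq ?_))
    push_cast
    ring

lemma rare_of_le_mul (C : ℝ) (h : ∀ᶠ n in atTop, envLaw n (A n) ≤ ENNReal.ofReal (C * r n))
    (hr : ∀ᶠ n in atTop, 0 ≤ r n) : Rare r A := by
  refine ⟨C.toNNReal, 0, by simp, ?_⟩
  filter_upwards [h, hr] with n h1 h2
  rw [ENNReal.ofReal_mul' h2] at h1
  exact h1.trans (add_zero _).ge

lemma rare_of_le_sq (C : ℝ) (h : ∀ᶠ n in atTop, envLaw n (A n) ≤ ENNReal.ofReal (C / n ^ 2)) :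
    Rare r A := by
  refine ⟨0, fun n : ℕ => ENNReal.ofReal (C / n ^ 2), ?_, ?_⟩
  · have hs : Summable fun n : ℕ => max C 0 / (n : ℝ) ^ 2 :=
      (Real.summable_one_div_nat_pow.2 one_lt_two).mul_left (max C 0) |>.congr
        fun n => by rw [mul_one_div]
    refine ne_top_of_le_ne_top hs.tsum_ofReal_ne_top (ENNReal.tsum_le_tsum fun n => ?_)
    exact ENNReal.ofReal_le_ofReal (by gcongr; exact le_max_left _ _)
  · filter_upwards [h] with n h1
    simpa using h1

lemma rare_of_lintegral_le {f : (n : ℕ) → (Cube n → ℝ) → ℝ≥0∞} (hf : ∀ n, Measurable (f n))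
    {η : ℝ} (hη : 0 < η) (C : ℝ)
    (h : ∀ᶠ n : ℕ in atTop, ∫⁻ H, f n H ∂envLaw n ≤ ENNReal.ofReal (C / n ^ 2)) :
    Rare r fun n => {H | ENNReal.ofReal η ≤ f n H} := by
  refine rare_of_le_sq (C / η) ?_
  filter_upwards [h] with n h1
  refine (meas_ge_le_lintegral_div (hf n).aemeasurable (by simpa using hη)
    ENNReal.ofReal_ne_top).trans ?_
  refine (ENNReal.div_le_div_right h1 _).trans (le_of_eq ?_)
  rw [← ENNReal.ofReal_div_of_pos hη]
  congr 1
  ring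

variable {β θ : ℝ} {c : ℕ → ℝ}

/-- Chebyshev's inequality over `2 ^ n` independent sites: a second moment of order `√n k` gives
exactly the rate `√n k / 2 ^ n`. -/
lemma rare_cubeAvg_deviation (hβ : 0 < β) (hc : Tendsto c atTop atTop) {f : ℕ → ℝ → ℝ}
    (hf : ∀ᶠ n in atTop, MemLp (f n) 2 (siteLaw n)) {C : ℝ}
    (h : ∀ᶠ n : ℕ in atTop, ∫ h, f n h ^ 2 ∂siteLaw n ≤ C * (√n * kseq β c n)) {η : ℝ}
    (hη : 0 < η) :
    Rare (fun n => √n * kseq β c n / 2 ^ n)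
      fun n => {H | η ≤ |cubeAvg (fun x => f n (H x)) - ∫ h, f n h ∂siteLaw n|} := by
  refine rare_of_le_mul (C / η ^ 2) ?_ ?_
  · filter_upwards [hf, h] with n h1 h2
    refine (envLaw_cubeAvg_deviation_le h1 hη).trans (ENNReal.ofReal_le_ofReal ?_)
    rw [div_le_iff₀ (by positivity)]
    refine h2.trans (le_of_eq ?_)
    field_simp
  · filter_upwards [hc.eventually_gt_atTop 0, eventually_ge_atTop 1] with n hcn hn
    have := kseq_pos hβ hn hcn
    positivity

/-- Since `exp (-x) ^ 2 ≤ exp (-x)` for `x ≥ 0`, the second moment is at most `C² √n k` times `√n k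
siteTrap`, and the last product is bounded. -/
lemma rare_trap_deviation (hβ : 0 < β) (hc : Tendsto c atTop atTop)
    (hθ : Tendsto (fun n : ℕ => Real.log (c n) / (β * √(n : ℝ)) - β * √(n : ℝ)) atTop (𝓝 θ))
    {f : ℕ → ℝ → ℝ} (hf : ∀ n, Measurable (f n)) {C v : ℝ} (hv : 0 < v)
    (h : ∀ᶠ n : ℕ in atTop, ∀ h, |f n h| ≤
      C * (√n * kseq β c n) * Real.exp (-(c n * v / weight β h))) {η : ℝ} (hη : 0 < η) :
    Rare (fun n => √n * kseq β c n / 2 ^ n)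
      fun n => {H | η ≤ |cubeAvg (fun x => f n (H x)) - ∫ h, f n h ∂siteLaw n|} := by
  have hbd : ∀ᶠ n : ℕ in atTop, ∀ h, ‖f n h‖ ≤ |C| * (√n * kseq β c n) := by
    filter_upwards [h, hc.eventually_gt_atTop 0, eventually_ge_atTop 1] with n h1 hcn hn x
    have hk := kseq_pos hβ hn hcn
    have hw := weight_pos β x
    refine (h1 x).trans ?_
    have h2 : Real.exp (-(c n * v / weight β x)) ≤ 1 := by
      rw [Real.exp_le_one_iff, neg_nonpos]; positivity
    have h3 : C * (√n * kseq β c n) ≤ |C| * (√n * kseq β c n) := by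
      gcongr; exact le_abs_self C
    have h4 : 0 ≤ |C| * (√n * kseq β c n) := by positivity
    nlinarith [Real.exp_pos (-(c n * v / weight β x))]
  have hmem : ∀ᶠ n in atTop, MemLp (f n) 2 (siteLaw n) := by
    filter_upwards [hbd] with n h1
    exact MemLp.of_bound (hf n).aestronglyMeasurable _ (ae_of_all _ h1)
  refine rare_cubeAvg_deviation hβ hc hmem (C := C ^ 2 * (tailConst β θ / v + 1)) ?_ hη
  filter_upwards [h, hmem, hc.eventually_gt_atTop 0, eventually_ge_atTop 1,
    (tendsto_kseq_mul_siteTrap hβ hc hθ hv).eventually_lt_const (lt_add_one _)]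
    with n h1 hm hcn hn h5
  have hk := kseq_pos hβ hn hcn
  have h6 : ∫ h, f n h ^ 2 ∂siteLaw n ≤
      (C * (√n * kseq β c n)) ^ 2 * siteTrap β n (c n * v) := by
    rw [siteTrap, ← integral_const_mul]
    refine integral_mono hm.integrable_sq
      ((integrable_trap β n (by positivity)).const_mul _) fun x => ?_
    have hw := weight_pos β x
    have h2 : Real.exp (-(c n * v / weight β x)) ≤ 1 := by
      rw [Real.exp_le_one_iff, neg_nonpos]; positivity
    have h3 := h1 x
    beta_reduce
    calc f n x ^ 2 = |f n x| ^ 2 := (sq_abs _).symm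
      _ ≤ (C * (√n * kseq β c n) * Real.exp (-(c n * v / weight β x))) ^ 2 := by gcongr
      _ = (C * (√n * kseq β c n)) ^ 2 * (Real.exp (-(c n * v / weight β x)) *
          Real.exp (-(c n * v / weight β x))) := by ring
      _ ≤ _ := by
        gcongr
        exact mul_le_of_le_one_left (Real.exp_pos _).le h2
  refine h6.trans ?_
  have h7 : (C * (√n * kseq β c n)) ^ 2 * siteTrap β n (c n * v) =
      C ^ 2 * (√n * kseq β c n) * (√n * kseq β c n * siteTrap β n (c n * v)) := by ring
  rw [h7, show C ^ 2 * (tailConst β θ / v + 1) * (√n * kseq β c n) =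
    C ^ 2 * (√n * kseq β c n) * (tailConst β θ / v + 1) by ring]
  gcongr

lemma measurable_trap (β z : ℝ) : Measurable fun h => Real.exp (-(z / weight β h)) :=
  ((measurable_const.div (measurable_weight β)).neg).exp

/-- The environment average of a single trapping probability is not large. -/
lemma rare_trapProb (hβ : 0 < β) (hc : Tendsto c atTop atTop)
    (hθ : Tendsto (fun n : ℕ => Real.log (c n) / (β * √(n : ℝ)) - β * √(n : ℝ)) atTop (𝓝 θ))
    {s : ℝ} (hs : 0 < s) :
    Rare (fun n => √n * kseq β c n / 2 ^ n)
      fun n => {H | tailConst β θ / s + 2 ≤ √n * kseq β c n * trapProb (tau β H) (c n * s)} := by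
  refine (rare_trap_deviation hβ hc hθ (v := s) (C := 1)
    (f := fun n h => √n * kseq β c n * Real.exp (-(c n * s / weight β h)))
    (fun n => (measurable_trap β _).const_mul _) hs ?_ one_pos).mono ?_
  · filter_upwards [hc.eventually_gt_atTop 0, eventually_ge_atTop 1] with n hcn hn x
    have hk := kseq_pos hβ hn hcn
    rw [abs_of_nonneg (by positivity), one_mul]
  -- Of the `2` in the threshold, one unit bounds the mean and one is the deviation.
  · filter_upwards [(tendsto_kseq_mul_siteTrap hβ hc hθ hs).eventually_lt_const (lt_add_one _)]
      with n h1 H hH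
    have hH : tailConst β θ / s + 2 ≤ √n * kseq β c n * trapProb (tau β H) (c n * s) := hH
    change 1 ≤ |cubeAvg _ - _|
    rw [integral_const_mul]
    have e : cubeAvg (fun x => √n * kseq β c n * Real.exp (-(c n * s / weight β (H x)))) =
        √n * kseq β c n * trapProb (tau β H) (c n * s) := by
      unfold trapProb cubeAvg
      rw [← Finset.mul_sum]
      rw [mul_left_comm]
      rfl
    rw [e]
    refine le_trans ?_ (le_abs_self _)
    rw [siteTrap] at h1
    linarith

/-- Law of large numbers for the main term. -/
lemma rare_main (hβ : 0 < β) (hc : Tendsto c atTop atTop)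
    (hθ : Tendsto (fun n : ℕ => Real.log (c n) / (β * √(n : ℝ)) - β * √(n : ℝ)) atTop (𝓝 θ))
    {V u : ℝ} (hu : 0 < u) (huV : u < V) {η : ℝ} (hη : 0 < η) :
    Rare (fun n => √n * kseq β c n / 2 ^ n)
      fun n => {H | η ≤ |√n * ∑ i ∈ Finset.range ⌈u * kseq β c n⌉₊,
        trapProb (tau β H) (c n * (V - i / kseq β c n)) -
        tailConst β θ * Real.log (V / (V - u))|} := by
  have hvi : ∀ n, 0 < kseq β c n → ∀ i ∈ Finset.range ⌈u * kseq β c n⌉₊,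
      V - u ≤ V - i / kseq β c n := by
    intro n hk i hi
    have := Nat.lt_ceil.1 (Finset.mem_range.1 hi)
    have := (div_le_iff₀ hk).2 this.le
    linarith
  have hVu : 0 < V - u := by linarith
  -- The whole Riemann sum is treated as one function of the energy. It has at most `(u + 1) k`
  -- terms, each bounded by the exponential with `V - u`.
  refine (rare_trap_deviation hβ hc hθ (v := V - u) (C := u + 1)
    (f := fun n h => √n * ∑ i ∈ Finset.range ⌈u * kseq β c n⌉₊,
      Real.exp (-(c n * (V - i / kseq β c n) / weight β h)))
    (fun n => (Finset.measurable_sum _ fun i _ => measurable_trap β _).const_mul _) hVu ?_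
    (half_pos hη)).mono ?_
  · filter_upwards [hc.eventually_gt_atTop 0, eventually_ge_atTop 1,
      (tendsto_inv_kseq hβ hc hθ).eventually_le_const one_pos] with n hcn hn hk1 x
    have hk := kseq_pos hβ hn hcn
    have hw := weight_pos β x
    rw [abs_of_nonneg (mul_nonneg (by positivity)
      (Finset.sum_nonneg fun i _ => (Real.exp_pos _).le))]
    have h1 : ∑ i ∈ Finset.range ⌈u * kseq β c n⌉₊,
        Real.exp (-(c n * (V - i / kseq β c n) / weight β x)) ≤
        ⌈u * kseq β c n⌉₊ * Real.exp (-(c n * (V - u) / weight β x)) := by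
      have h2 : ∀ i ∈ Finset.range ⌈u * kseq β c n⌉₊,
          Real.exp (-(c n * (V - i / kseq β c n) / weight β x)) ≤
          Real.exp (-(c n * (V - u) / weight β x)) := by
        intro i hi
        have := hvi n hk i hi
        refine Real.exp_le_exp.2 (neg_le_neg ?_)
        gcongr
      refine (Finset.sum_le_card_nsmul _ _ _ h2).trans (le_of_eq ?_)
      rw [Finset.card_range, nsmul_eq_mul]
    have h3 : (⌈u * kseq β c n⌉₊ : ℝ) ≤ (u + 1) * kseq β c n := by
      have := (Nat.ceil_lt_add_one (show 0 ≤ u * kseq β c n by positivity)).le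
      rw [inv_le_one₀ hk] at hk1
      linarith
    calc _ ≤ √(n : ℝ) * ((u + 1) * kseq β c n * Real.exp (-(c n * (V - u) / weight β x))) := by
          refine mul_le_mul_of_nonneg_left (h1.trans ?_) (by positivity)
          gcongr
      _ = _ := by ring
  · filter_upwards [hc.eventually_gt_atTop 0, eventually_ge_atTop 1,
      ((tendsto_sum_siteTrap hβ hc hθ hu huV).sub_const
        (tailConst β θ * Real.log (V / (V - u)))).abs.eventually_lt_const
        (show |_ - _| < η / 2 by rw [sub_self, abs_zero]; positivity)] with n hcn hn h1 H hH
    have hk := kseq_pos hβ hn hcn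
    have hH : η ≤ |√n * ∑ i ∈ Finset.range ⌈u * kseq β c n⌉₊,
        trapProb (tau β H) (c n * (V - i / kseq β c n)) -
        tailConst β θ * Real.log (V / (V - u))| := hH
    change η / 2 ≤ |cubeAvg _ - _|
    have e1 : cubeAvg (fun x => √n * ∑ i ∈ Finset.range ⌈u * kseq β c n⌉₊,
        Real.exp (-(c n * (V - i / kseq β c n) / weight β (H x)))) =
        √n * ∑ i ∈ Finset.range ⌈u * kseq β c n⌉₊,
          trapProb (tau β H) (c n * (V - i / kseq β c n)) := by
      unfold trapProb cubeAvg
      rw [← Finset.mul_sum, mul_left_comm, Finset.sum_comm, ← Finset.mul_sum]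
      rfl
    have e2 : ∫ h, √n * ∑ i ∈ Finset.range ⌈u * kseq β c n⌉₊,
        Real.exp (-(c n * (V - i / kseq β c n) / weight β h)) ∂siteLaw n =
        √n * ∑ i ∈ Finset.range ⌈u * kseq β c n⌉₊,
          siteTrap β n (c n * (V - i / kseq β c n)) := by
      rw [integral_const_mul, integral_finsetSum]
      · rfl
      · intro i hi
        refine integrable_trap β n ?_
        have := hvi n hk i hi
        have : 0 ≤ V - i / kseq β c n := by linarith
        positivity
    rw [e1, e2]
    have := abs_sub_le (√n * ∑ i ∈ Finset.range ⌈u * kseq β c n⌉₊,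
        trapProb (tau β H) (c n * (V - i / kseq β c n)))
      (√n * ∑ i ∈ Finset.range ⌈u * kseq β c n⌉₊, siteTrap β n (c n * (V - i / kseq β c n)))
      (tailConst β θ * Real.log (V / (V - u)))
    linarith

end Rare

end REM

namespace REM

/-! ### The error terms are negligible -/

section ErrorTerms

variable {β θ : ℝ} {c : ℕ → ℝ}

lemma rare_of_integral_le {r : ℕ → ℝ} {f : (n : ℕ) → (Cube n → ℝ) → ℝ}
    (hf : ∀ᶠ n in atTop, Integrable (f n) (envLaw n)) (hf0 : ∀ᶠ n in atTop, ∀ H, 0 ≤ f n H)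
    {η : ℝ} (hη : 0 < η) (C : ℝ) (h : ∀ᶠ n : ℕ in atTop, ∫ H, f n H ∂envLaw n ≤ C / n ^ 2) :
    Rare r fun n => {H | η ≤ f n H} := by
  refine rare_of_le_sq (C / η) ?_
  filter_upwards [hf, hf0, h] with n h1 h2 h3
  have h4 := mul_meas_ge_le_integral_of_nonneg (ae_of_all _ h2) h1 η
  rw [← ENNReal.ofReal_toReal (measure_ne_top (envLaw n) _)]
  refine ENNReal.ofReal_le_ofReal ?_
  rw [div_right_comm, le_div_iff₀ hη, mul_comm]
  exact h4.trans h3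

/-- As the weight lies in `[0, 1]`, its square is dominated by itself, and the second moment is at
most `k * (k siteHigh)`, with `k siteHigh → 0`. -/
lemma rare_high (hβ : 0 < β) (hc : Tendsto c atTop atTop)
    (hθ : Tendsto (fun n : ℕ => Real.log (c n) / (β * √(n : ℝ)) - β * √(n : ℝ)) atTop (𝓝 θ))
    {η : ℝ} (hη : 0 < η) :
    Rare (fun n => √n * kseq β c n / 2 ^ n)
      fun n => {H | η ≤ kseq β c n *
        cubeAvg (fun x => highWeight (c n / n ^ 6) (c n) (tau β H x))} := by
  have hmem : ∀ᶠ n in atTop, MemLp (fun h => kseq β c n *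
      highWeight (c n / n ^ 6) (c n) (weight β h)) 2 (siteLaw n) := by
    filter_upwards [hc.eventually_gt_atTop 0] with n hcn
    refine MemLp.const_mul (MemLp.of_bound (integrable_high β n hcn).1 1
      (ae_of_all _ fun h => ?_)) _
    rw [Real.norm_of_nonneg (highWeight_nonneg hcn (weight_pos _ _).le)]
    exact highWeight_le_one hcn
  refine (rare_cubeAvg_deviation hβ hc hmem (C := 1) ?_ (half_pos hη)).mono ?_
  · filter_upwards [hmem, hc.eventually_gt_atTop 0, eventually_ge_atTop 1,
      (tendsto_kseq_mul_siteHigh hβ hc hθ).eventually_le_const one_pos] with n hm hcn hn h1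
    have hk := kseq_pos hβ hn hcn
    have hn' : 1 ≤ √(n : ℝ) := Real.one_le_sqrt.2 (by exact_mod_cast hn)
    have h2 : ∫ h, (kseq β c n * highWeight (c n / n ^ 6) (c n) (weight β h)) ^ 2 ∂siteLaw n ≤
        kseq β c n ^ 2 * siteHigh β n (c n / n ^ 6) (c n) := by
      rw [siteHigh, ← integral_const_mul]
      refine integral_mono hm.integrable_sq ((integrable_high β n hcn).const_mul _) fun x => ?_
      have h3 := highWeight_nonneg (L := c n / n ^ 6) hcn (weight_pos β x).le
      have h4 := highWeight_le_one (L := c n / n ^ 6) (r := weight β x) hcn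
      beta_reduce
      rw [mul_pow]
      gcongr
      nlinarith
    refine h2.trans ?_
    calc _ = kseq β c n * (kseq β c n * siteHigh β n (c n / n ^ 6) (c n)) := by ring
      _ ≤ kseq β c n * 1 := by gcongr
      _ ≤ _ := by nlinarith
  · filter_upwards [(tendsto_kseq_mul_siteHigh hβ hc hθ).eventually_lt_const (half_pos hη)]
      with n h1 H hH
    have hH : η ≤ kseq β c n * cubeAvg (fun x => highWeight (c n / n ^ 6) (c n) (tau β H x)) := hH
    change η / 2 ≤ |cubeAvg _ - _|
    rw [integral_const_mul]
    have e : cubeAvg (fun x => kseq β c n * highWeight (c n / n ^ 6) (c n) (weight β (H x))) =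
        kseq β c n * cubeAvg (fun x => highWeight (c n / n ^ 6) (c n) (tau β H x)) := by
      unfold cubeAvg
      rw [← Finset.mul_sum, mul_left_comm]
      rfl
    rw [e]
    refine le_trans ?_ (le_abs_self _)
    rw [siteHigh] at h1
    linarith

lemma eventually_kseq_le (hr : Tendsto (fun n : ℕ => √n * kseq β c n / 2 ^ n) atTop (𝓝 0))
    (hβ : 0 < β) (hc : Tendsto c atTop atTop) : ∀ᶠ n : ℕ in atTop, kseq β c n ≤ 2 ^ n := by
  filter_upwards [hr.eventually_le_const one_pos, hc.eventually_gt_atTop 0,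
    eventually_ge_atTop 1] with n h1 hcn hn
  have hk := kseq_pos hβ hn hcn
  have hn' : 1 ≤ √(n : ℝ) := Real.one_le_sqrt.2 (by exact_mod_cast hn)
  rw [div_le_one (by positivity)] at h1
  nlinarith

/-- The annealed bound on the deviations of the truncated clock. -/
lemma exists_lintegral_lowDev_le
    (hr : Tendsto (fun n : ℕ => √n * kseq β c n / 2 ^ n) atTop (𝓝 0))
    (hβ : 0 < β) (hc : Tendsto c atTop atTop) {δ : ℝ} (hδ : 0 < δ) {T : ℝ} (hT : 0 ≤ T) :
    ∃ C : ℝ, 0 ≤ C ∧ ∀ᶠ n : ℕ in atTop, ∀ i : ℕ, (i : ℝ) ≤ T * kseq β c n →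
      ∫⁻ H, dynLaw n (lowDev (tau β H) (c n / n ^ 6) (mseq β c n) (δ * c n / 4) i) ∂envLaw n ≤
        ENNReal.ofReal (C / n ^ 4) := by
  refine ⟨64 * T * (3 + 3 * T) / δ ^ 2, by positivity, ?_⟩
  filter_upwards [eventually_kseq_le hr hβ hc, hc.eventually_gt_atTop 0,
    eventually_ge_atTop 1] with n h1 hcn hn i hi
  have hk := kseq_pos hβ hn hcn
  have hm := mseq_pos hβ hn hcn
  have hn' : (1 : ℝ) ≤ n := by exact_mod_cast hn
  refine (lintegral_lowDev_le hn β (m := mseq β c n) rfl (by positivity) (by positivity) i).trans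
    (ENNReal.ofReal_le_ofReal ?_)
  -- The truncation at `c / n ^ 6` pays off here: the variance per step is of order `n ^ (-6) / k`,
  -- and about `k` steps with `n ^ 2` coincidences each leave `n ^ (-4)`, summable even after
  -- multiplication by `√n`.
  have e : 4 * (c n / n ^ 6 * mseq β c n) / (δ * c n / 4) ^ 2 =
      64 / (δ ^ 2 * n ^ 6 * kseq β c n) := by
    rw [kseq]; field_simp; ring
  have h2 : (i : ℝ) / 2 ^ n ≤ T := by
    rw [div_le_iff₀ (by positivity)]
    exact hi.trans (by gcongr)
  have h3 : 1 + 2 * (n : ℝ) ^ 2 + 3 * i / 2 ^ n ≤ (3 + 3 * T) * n ^ 2 := by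
    have h4 : 3 * (i : ℝ) / 2 ^ n = 3 * (i / 2 ^ n) := by ring
    have h5 : (1 : ℝ) ≤ (n : ℝ) ^ 2 := one_le_pow₀ hn'
    rw [h4]
    nlinarith
  rw [e]
  calc 64 / (δ ^ 2 * n ^ 6 * kseq β c n) * i * (1 + 2 * (n : ℝ) ^ 2 + 3 * i / 2 ^ n) ≤
      64 / (δ ^ 2 * n ^ 6 * kseq β c n) * (T * kseq β c n) * ((3 + 3 * T) * n ^ 2) := by gcongr
    _ = _ := by field_simp

lemma rare_sum_lowDev
    (hr : Tendsto (fun n : ℕ => √n * kseq β c n / 2 ^ n) atTop (𝓝 0))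
    (hβ : 0 < β) (hc : Tendsto c atTop atTop) {δ : ℝ} (hδ : 0 < δ) {T : ℝ} (hT : 0 ≤ T)
    {k : ℕ → ℕ} (hk : ∀ᶠ n in atTop, (k n : ℝ) ≤ T * kseq β c n) {η : ℝ} (hη : 0 < η) :
    Rare (fun n => √n * kseq β c n / 2 ^ n)
      fun n => {H | η * kseq β c n ≤ ∑ i ∈ Finset.range (k n), (dynLaw n).real
        (lowDev (tau β H) (c n / n ^ 6) (mseq β c n) (δ * c n / 4) (i - n ^ 2))} := by
  obtain ⟨C, hC0, hC⟩ := exists_lintegral_lowDev_le hr hβ hc hδ hT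
  refine (rare_of_lintegral_le (f := fun n H => ENNReal.ofReal (kseq β c n)⁻¹ *
    ∑ i ∈ Finset.range (k n), dynLaw n
        (lowDev (tau β H) (c n / n ^ 6) (mseq β c n) (δ * c n / 4) (i - n ^ 2)))
    (fun n => (Finset.measurable_sum _ fun i _ => measurable_dynLaw_lowDev _ _ _ _ _).const_mul _)
    hη (T * C) ?_).mono ?_
  · filter_upwards [hC, hk, hc.eventually_gt_atTop 0, eventually_ge_atTop 1] with n h1 h2 hcn hn
    have hk := kseq_pos hβ hn hcn
    have hn' : (1 : ℝ) ≤ n := by exact_mod_cast hn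
    rw [lintegral_const_mul _ (Finset.measurable_sum _ fun i _ =>
      measurable_dynLaw_lowDev _ _ _ _ _),
      lintegral_finsetSum _ fun i _ => measurable_dynLaw_lowDev _ _ _ _ _]
    have h3 : ∀ i ∈ Finset.range (k n), ∫⁻ H, dynLaw n (lowDev (tau β H) (c n / n ^ 6)
        (mseq β c n) (δ * c n / 4) (i - n ^ 2)) ∂envLaw n ≤ ENNReal.ofReal (C / n ^ 4) := by
      intro i hi
      refine h1 _ (le_trans ?_ h2)
      exact_mod_cast (Nat.sub_le _ _).trans (Finset.mem_range.1 hi).le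
    refine (mul_le_mul' le_rfl (Finset.sum_le_sum h3)).trans ?_
    rw [Finset.sum_const, Finset.card_range, nsmul_eq_mul, ← ENNReal.ofReal_natCast,
      ← ENNReal.ofReal_mul (by positivity), ← ENNReal.ofReal_mul (by positivity)]
    refine ENNReal.ofReal_le_ofReal ?_
    calc (kseq β c n)⁻¹ * (k n * (C / n ^ 4)) ≤
        (kseq β c n)⁻¹ * (T * kseq β c n * (C / n ^ 2)) := by
          gcongr
          norm_num
      _ = _ := by field_simp
  · filter_upwards [hc.eventually_gt_atTop 0, eventually_ge_atTop 1] with n hcn hn H hH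
    have hk := kseq_pos hβ hn hcn
    have hH : η * kseq β c n ≤ ∑ i ∈ Finset.range (k n), (dynLaw n).real
        (lowDev (tau β H) (c n / n ^ 6) (mseq β c n) (δ * c n / 4) (i - n ^ 2)) := hH
    change ENNReal.ofReal η ≤ ENNReal.ofReal (kseq β c n)⁻¹ * _
    rw [← div_inv_eq_mul, div_le_iff₀ (by positivity)] at hH
    refine (ENNReal.ofReal_le_ofReal hH).trans (le_of_eq ?_)
    rw [mul_comm, ENNReal.ofReal_mul (by positivity),
      ENNReal.ofReal_sum_of_nonneg fun i _ => measureReal_nonneg]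
    congr 1
    exact Finset.sum_congr rfl fun i _ => ofReal_measureReal (measure_ne_top _ _)

lemma rare_lowDev
    (hr : Tendsto (fun n : ℕ => √n * kseq β c n / 2 ^ n) atTop (𝓝 0))
    (hβ : 0 < β) (hc : Tendsto c atTop atTop) {δ : ℝ} (hδ : 0 < δ) {T : ℝ} (hT : 0 ≤ T)
    {k : ℕ → ℕ} (hk : ∀ᶠ n in atTop, (k n : ℝ) ≤ T * kseq β c n) {η : ℝ} (hη : 0 < η) :
    Rare (fun n => √n * kseq β c n / 2 ^ n)
      fun n => {H | η ≤ √n * (dynLaw n).real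
        (lowDev (tau β H) (c n / n ^ 6) (mseq β c n) (δ * c n / 4) (k n))} := by
  obtain ⟨C, hC0, hC⟩ := exists_lintegral_lowDev_le hr hβ hc hδ hT
  refine (rare_of_lintegral_le (f := fun n H => ENNReal.ofReal √n *
    dynLaw n (lowDev (tau β H) (c n / n ^ 6) (mseq β c n) (δ * c n / 4) (k n)))
    (fun n => (measurable_dynLaw_lowDev _ _ _ _ _).const_mul _) hη C ?_).mono ?_
  · filter_upwards [hC, hk, eventually_ge_atTop 1] with n h1 h2 hn
    have hn' : (1 : ℝ) ≤ n := by exact_mod_cast hn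
    rw [lintegral_const_mul _ (measurable_dynLaw_lowDev _ _ _ _ _)]
    refine (mul_le_mul' le_rfl (h1 _ h2)).trans ?_
    rw [← ENNReal.ofReal_mul (by positivity)]
    refine ENNReal.ofReal_le_ofReal ?_
    have h3 : √(n : ℝ) ≤ (n : ℝ) ^ 2 := by
      rw [Real.sqrt_le_left (by positivity)]
      calc (n : ℝ) = n ^ 1 := (pow_one _).symm
        _ ≤ n ^ 4 := pow_le_pow_right₀ hn' (by norm_num)
        _ = _ := by ring
    calc √(n : ℝ) * (C / n ^ 4) ≤ (n : ℝ) ^ 2 * (C / n ^ 4) := by gcongr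
      _ = _ := by field_simp
  · refine Eventually.of_forall fun n H hH => ?_
    have hH : η ≤ √n * (dynLaw n).real
        (lowDev (tau β H) (c n / n ^ 6) (mseq β c n) (δ * c n / 4) (k n)) := hH
    change ENNReal.ofReal η ≤ ENNReal.ofReal √n * _
    refine (ENNReal.ofReal_le_ofReal hH).trans (le_of_eq ?_)
    rw [ENNReal.ofReal_mul (by positivity), ofReal_measureReal]

/-- At the lower level `c / n ^ 2`, a first-moment bound loses only the factor `n ^ 2`. -/
lemma eventually_siteTrap_near_le (hβ : 0 < β) (hc : Tendsto c atTop atTop)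
    (hθ : Tendsto (fun n : ℕ => Real.log (c n) / (β * √(n : ℝ)) - β * √(n : ℝ)) atTop (𝓝 θ))
    {δ : ℝ} (hδ : 0 < δ) :
    ∀ᶠ n : ℕ in atTop, siteTrap β n (δ * c n / (4 * n ^ 2)) ≤
      (8 / δ + Real.exp 1) * n ^ 2 / kseq β c n := by
  filter_upwards [hc.eventually_gt_atTop 0, eventually_ge_atTop 1,
    (tendsto_lowMean_div_mseq hβ hc hθ).eventually_le_const one_lt_two,
    (tendsto_kseq_mul_siteTrap_zero hβ hc hθ).eventually_le_const one_pos] with n hcn hn h1 h2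
  have hk := kseq_pos hβ hn hcn
  have hm := mseq_pos hβ hn hcn
  have hn' : (1 : ℝ) ≤ n := by exact_mod_cast hn
  refine (siteTrap_le β n hcn.le (by positivity)).trans ?_
  rw [le_div_iff₀ hk, add_mul]
  have e : lowMean β n (c n) / (δ * c n / (4 * n ^ 2)) * kseq β c n =
      4 / δ * n ^ 2 * (lowMean β n (c n) / mseq β c n) := by
    rw [kseq]; field_simp
  have h3 : (1 : ℝ) ≤ (n : ℝ) ^ 2 := one_le_pow₀ hn'
  have h4 : 4 / δ * (n : ℝ) ^ 2 * (lowMean β n (c n) / mseq β c n) ≤ 4 / δ * n ^ 2 * 2 := by gcongr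
  have h5 : Real.exp 1 * siteTrap β n (c n) * kseq β c n ≤ Real.exp 1 * n ^ 2 := by
    rw [mul_assoc, mul_comm (siteTrap _ _ _)]
    gcongr
    exact h2.trans h3
  rw [e]
  calc _ ≤ 4 / δ * (n : ℝ) ^ 2 * 2 + Real.exp 1 * n ^ 2 := add_le_add h4 h5
    _ = _ := by ring

/-- The mean is of order `√n k * n ^ 2 * (n ^ 2 / k) * siteTrap (c s)`. As `√n k siteTrap (c s)` is
bounded, this is `O(n ^ 4 / k)`, and `k ≥ n ^ 6` makes it summable. -/
lemma rare_closePair (hβ : 0 < β) (hc : Tendsto c atTop atTop)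
    (hθ : Tendsto (fun n : ℕ => Real.log (c n) / (β * √(n : ℝ)) - β * √(n : ℝ)) atTop (𝓝 θ))
    {δ s : ℝ} (hδ : 0 < δ) (hs : 0 < s) {η : ℝ} (hη : 0 < η) :
    Rare (fun n => √n * kseq β c n / 2 ^ n)
      fun n => {H | η ≤ √n * kseq β c n * ∑ d ∈ Finset.range (n ^ 2),
        closePair (tau β H) (δ * c n / (4 * n ^ 2)) (c n * s) (d + 1)} := by
  refine rare_of_integral_le ?_ ?_ hη ((8 / δ + Real.exp 1) * (tailConst β θ / s + 1)) ?_
  · filter_upwards [hc.eventually_gt_atTop 0, eventually_ge_atTop 1] with n hcn hn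
    exact (integrable_finsetSum _ fun d _ =>
      (integral_closePair_le hn β (by positivity) (by positivity) _).1).const_mul _
  · filter_upwards [hc.eventually_gt_atTop 0, eventually_ge_atTop 1] with n hcn hn H
    have hk := kseq_pos hβ hn hcn
    exact mul_nonneg (by positivity) (Finset.sum_nonneg fun d _ => closePair_nonneg _ _ _ _)
  · filter_upwards [hc.eventually_gt_atTop 0, eventually_ge_atTop 1,
      eventually_siteTrap_near_le hβ hc hθ hδ,
      (tendsto_pow_div_kseq hβ hc hθ 6).eventually_le_const one_pos,
      (tendsto_kseq_mul_siteTrap hβ hc hθ hs).eventually_le_const (lt_add_one _)]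
      with n hcn hn h1 h2 h3
    have hk := kseq_pos hβ hn hcn
    have hn' : (1 : ℝ) ≤ n := by exact_mod_cast hn
    have hT := siteTrap_nonneg β n (c n * s)
    rw [integral_const_mul, integral_finsetSum _ fun d _ =>
      (integral_closePair_le hn β (by positivity) (by positivity) _).1]
    have h4 : ∑ d ∈ Finset.range (n ^ 2), ∫ H, closePair (tau β H) (δ * c n / (4 * n ^ 2))
        (c n * s) (d + 1) ∂envLaw n ≤
        n ^ 2 * (siteTrap β n (δ * c n / (4 * n ^ 2)) * siteTrap β n (c n * s)) := by
      refine (Finset.sum_le_card_nsmul _ _ _ fun d _ =>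
        (integral_closePair_le hn β (by positivity) (by positivity) (d + 1)).2).trans (le_of_eq ?_)
      rw [Finset.card_range, nsmul_eq_mul]
      push_cast
      rfl
    have h5 : (n : ℝ) ^ 4 / kseq β c n ≤ 1 / n ^ 2 := by
      rw [div_le_one hk] at h2
      rw [div_le_div_iff₀ hk (by positivity)]
      calc (n : ℝ) ^ 4 * n ^ 2 = n ^ 6 := by ring
        _ ≤ _ := by linarith
    calc _ ≤ √n * kseq β c n *
          (n ^ 2 * ((8 / δ + Real.exp 1) * n ^ 2 / kseq β c n * siteTrap β n (c n * s))) := by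
          refine mul_le_mul_of_nonneg_left (h4.trans ?_) (by positivity)
          gcongr
      _ = (8 / δ + Real.exp 1) * (√n * kseq β c n * siteTrap β n (c n * s)) *
          ((n : ℝ) ^ 4 / kseq β c n) := by ring
      _ ≤ (8 / δ + Real.exp 1) * (tailConst β θ / s + 1) * (1 / n ^ 2) := by
          have : 0 ≤ √n * kseq β c n * siteTrap β n (c n * s) := by positivity
          have h6 : 0 ≤ tailConst β θ / s + 1 := this.trans h3
          gcongr
      _ = _ := by ring

/-- The error terms of the bounds on the correlation function are small. -/
lemma rare_corrErr (hr : Tendsto (fun n : ℕ => √n * kseq β c n / 2 ^ n) atTop (𝓝 0))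
    (hβ : 0 < β) (hc : Tendsto c atTop atTop)
    (hθ : Tendsto (fun n : ℕ => Real.log (c n) / (β * √(n : ℝ)) - β * √(n : ℝ)) atTop (𝓝 θ))
    {δ s : ℝ} (hδ : 0 < δ) (hs : 0 < s) {T : ℝ} (hT : 0 < T)
    {k : ℕ → ℕ} (hk : ∀ᶠ n in atTop, (k n : ℝ) ≤ T * kseq β c n) {η : ℝ} (hη : 0 < η) :
    Rare (fun n => √n * kseq β c n / 2 ^ n)
      fun n => {H | η ≤ √n * corrErr (tau β H) (c n / n ^ 6) (mseq β c n) (c n) δ s (k n)} := by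
  set M := |tailConst β θ / s| + 2 with hM
  have hM0 : 0 < M := by positivity
  -- The left side is linear in `ρ` and bounds the total error when each ingredient is below `ρ`;
  -- the witness makes it `η / 2`. `M` bounds `√n k trapProb` outside a rare event.
  obtain ⟨ρ, hρ0, hρ⟩ : ∃ ρ : ℝ, 0 < ρ ∧ M * (3 * ρ + 12 / δ * T ^ 2 * ρ + T * ρ) + T * ρ + ρ < η := by
    refine ⟨η / (M * (3 + 12 / δ * T ^ 2 + T) + T + 1) / 2, by positivity, ?_⟩
    have h0 : 0 < M * (3 + 12 / δ * T ^ 2 + T) + T + 1 := by positivity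
    have e : ∀ ρ : ℝ, M * (3 * ρ + 12 / δ * T ^ 2 * ρ + T * ρ) + T * ρ + ρ =
        (M * (3 + 12 / δ * T ^ 2 + T) + T + 1) * ρ := fun ρ => by ring
    rw [e, div_div, mul_div_assoc', mul_comm, mul_comm _ (2 : ℝ), mul_div_mul_right _ _ h0.ne']
    linarith
  have hret : Tendsto (fun n : ℕ => returnBound n) atTop (𝓝 0) := by
    have h1 : Tendsto (fun n : ℕ => 2900 / √(n : ℝ)) atTop (𝓝 0) :=
      tendsto_const_nhds.div_atTop tendsto_sqrt_natCast
    refine tendsto_of_tendsto_of_tendsto_of_le_of_le' tendsto_const_nhds h1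
      (Eventually.of_forall fun n => returnBound_nonneg n) ?_
    filter_upwards [eventually_ge_atTop 1] with n hn
    exact returnBound_le hn
  refine (((((rare_trapProb hβ hc hθ hs).union (rare_sum_lowDev hr hβ hc hδ hT.le hk hρ0)).union
    (rare_high hβ hc hθ hρ0)).union (rare_closePair hβ hc hθ hδ hs hρ0)).union
    (rare_lowDev hr hβ hc hδ hT.le hk hρ0)).mono ?_
  filter_upwards [hc.eventually_gt_atTop 0, eventually_ge_atTop 1, hk,
    hret.eventually_le_const hρ0] with n hcn hn hkn hrn
  have hK := kseq_pos hβ hn hcn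
  intro H hH
  by_contra hcon
  simp only [Set.mem_union, not_or] at hcon
  obtain ⟨⟨⟨⟨h1, h2⟩, h3⟩, h4⟩, h5⟩ := hcon
  have h1 : √n * kseq β c n * trapProb (tau β H) (c n * s) < tailConst β θ / s + 2 := not_le.1 h1
  have h2 : ∑ i ∈ Finset.range (k n), (dynLaw n).real
        (lowDev (tau β H) (c n / n ^ 6) (mseq β c n) (δ * c n / 4) (i - n ^ 2)) <
        ρ * kseq β c n := not_le.1 h2
  have h3 : kseq β c n * cubeAvg (fun x => highWeight (c n / n ^ 6) (c n) (tau β H x)) < ρ :=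
    not_le.1 h3
  have h4 : √n * kseq β c n * ∑ d ∈ Finset.range (n ^ 2),
        closePair (tau β H) (δ * c n / (4 * n ^ 2)) (c n * s) (d + 1) < ρ := not_le.1 h4
  have h5 : √n * (dynLaw n).real
        (lowDev (tau β H) (c n / n ^ 6) (mseq β c n) (δ * c n / 4) (k n)) < ρ := not_le.1 h5
  have hH : η ≤ √n * corrErr (tau β H) (c n / n ^ 6) (mseq β c n) (c n) δ s (k n) := hH
  refine absurd hH (not_le.2 (lt_of_le_of_lt ?_ hρ))
  unfold corrErr
  set tp := trapProb (tau β H) (c n * s)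
  set S := ∑ i ∈ Finset.range (k n), (dynLaw n).real
        (lowDev (tau β H) (c n / n ^ 6) (mseq β c n) (δ * c n / 4) (i - n ^ 2))
  set A := cubeAvg (fun x => highWeight (c n / n ^ 6) (c n) (tau β H x))
  set P := ∑ d ∈ Finset.range (n ^ 2),
        closePair (tau β H) (δ * c n / (4 * n ^ 2)) (c n * s) (d + 1)
  have htp : 0 ≤ tp := trapProb_nonneg _ _
  have hS : 0 ≤ S := Finset.sum_nonneg fun _ _ => measureReal_nonneg
  have hA : 0 ≤ A := cubeAvg_nonneg fun x => highWeight_nonneg hcn (tau_pos β H x).le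
  have hP : 0 ≤ P := Finset.sum_nonneg fun d _ => closePair_nonneg _ _ _ _
  have hR := returnBound_nonneg n
  have h1' : √n * kseq β c n * tp ≤ M := h1.le.trans (by rw [hM]; gcongr; exact le_abs_self _)
  have hin : 3 * S + 12 / δ * (k n : ℝ) ^ 2 * A + k n * returnBound n ≤
      kseq β c n * (3 * ρ + 12 / δ * T ^ 2 * ρ + T * ρ) := by
    have a1 : (k n : ℝ) ^ 2 * A ≤ T ^ 2 * kseq β c n * ρ := by
      calc (k n : ℝ) ^ 2 * A ≤ (T * kseq β c n) ^ 2 * A := by gcongr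
        _ = T ^ 2 * kseq β c n * (kseq β c n * A) := by ring
        _ ≤ _ := by gcongr
    have a2 : (k n : ℝ) * returnBound n ≤ T * kseq β c n * ρ := by gcongr
    have a3 : 12 / δ * (k n : ℝ) ^ 2 * A ≤ 12 / δ * (T ^ 2 * kseq β c n * ρ) := by
      rw [mul_assoc]; gcongr
    calc _ ≤ 3 * (ρ * kseq β c n) + 12 / δ * (T ^ 2 * kseq β c n * ρ) + T * kseq β c n * ρ := by
          gcongr
      _ = _ := by ring
  calc _ = √n * tp * (3 * S + 12 / δ * (k n : ℝ) ^ 2 * A + k n * returnBound n) +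
        k n * (√n * P) + √n * (dynLaw n).real
        (lowDev (tau β H) (c n / n ^ 6) (mseq β c n) (δ * c n / 4) (k n)) := by ring
    _ ≤ √n * tp * (kseq β c n * (3 * ρ + 12 / δ * T ^ 2 * ρ + T * ρ)) +
        T * kseq β c n * (√n * P) + ρ := by gcongr
    _ = √n * kseq β c n * tp * (3 * ρ + 12 / δ * T ^ 2 * ρ + T * ρ) +
        T * (√n * kseq β c n * P) + ρ := by ring
    _ ≤ _ := by gcongr

end ErrorTerms

end REM

namespace REM

/-! ### Convergence of the correlation function -/

section Convergence

variable {β θ : ℝ} {c : ℕ → ℝ}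

/-- Continuity at `δ = 0`, where both quotients equal `(t + s) / s`. They are the limits of the
upper and lower main terms with tolerance `δ`. -/
lemma exists_window {t s : ℝ} (ht : 0 < t) (hs : 0 < s) (κ : ℝ) {η : ℝ} (hη : 0 < η) :
    ∃ δ : ℝ, 0 < δ ∧ δ ≤ 4 ∧ δ < t ∧ 2 * δ < s ∧
      |κ * Real.log ((t + s - δ) / ((t + s - δ) - (t + δ))) - κ * Real.log (1 + t / s)| < η ∧
      |κ * Real.log ((t + s + δ) / ((t + s + δ) - (t - δ))) - κ * Real.log (1 + t / s)| < η := by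
  have e : 1 + t / s = (t + s) / s := by field_simp; ring
  have e1 : t + s - 0 - (t + 0) = s := by ring
  have e0 : t + s + 0 - (t - 0) = s := by ring
  have h1 : ContinuousAt (fun δ : ℝ =>
      |κ * Real.log ((t + s - δ) / ((t + s - δ) - (t + δ))) - κ * Real.log (1 + t / s)|) 0 := by
    refine ContinuousAt.abs ((ContinuousAt.mul continuousAt_const (ContinuousAt.log
      (ContinuousAt.div (by fun_prop) (by fun_prop) ?_) ?_)).sub continuousAt_const)
    · rw [e1]; exact hs.ne'
    · change (t + s - 0) / (t + s - 0 - (t + 0)) ≠ 0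
      rw [e1, sub_zero]; positivity
  have h2 : ContinuousAt (fun δ : ℝ =>
      |κ * Real.log ((t + s + δ) / ((t + s + δ) - (t - δ))) - κ * Real.log (1 + t / s)|) 0 := by
    refine ContinuousAt.abs ((ContinuousAt.mul continuousAt_const (ContinuousAt.log
      (ContinuousAt.div (by fun_prop) (by fun_prop) ?_) ?_)).sub continuousAt_const)
    · rw [e0]; exact hs.ne'
    · change (t + s + 0) / (t + s + 0 - (t - 0)) ≠ 0
      rw [e0]; positivity
  have h3 := h1.eventually_lt_const (u := η) (by simpa [e] using hη)
  have h4 := h2.eventually_lt_const (u := η) (by simpa [e] using hη)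
  have h5 : ∀ᶠ δ : ℝ in 𝓝 0, δ < min 4 (min t (s / 2)) := eventually_lt_nhds (by positivity)
  have h6 := ((h3.and (h4.and h5)).filter_mono
    (nhdsWithin_le_nhds (s := Set.Ioi 0))).and self_mem_nhdsWithin
  obtain ⟨δ, ⟨h7, h8, h9⟩, h10⟩ := h6.exists
  rw [lt_min_iff, lt_min_iff] at h9
  exact ⟨δ, h10, h9.1.le, h9.2.1, by linarith [h9.2.2], h7, h8⟩

lemma limitValue_eq (β θ t s : ℝ) :
    limitValue β θ t s = tailConst β θ * Real.log (1 + t / s) := by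
  unfold limitValue tailConst
  ring

lemma rare_corr_deviation (hr : Tendsto (fun n : ℕ => √n * kseq β c n / 2 ^ n) atTop (𝓝 0))
    (hβ : 0 < β) (hc : Tendsto c atTop atTop)
    (hθ : Tendsto (fun n : ℕ => Real.log (c n) / (β * √(n : ℝ)) - β * √(n : ℝ)) atTop (𝓝 θ))
    {t s : ℝ} (ht : 0 < t) (hs : 0 < s) {η : ℝ} (hη : 0 < η) :
    Rare (fun n => √n * kseq β c n / 2 ^ n)
      fun n => {H | η ≤ |√n * corr β H (c n) t s - limitValue β θ t s|} := by
  have hη3 : 0 < η / 3 := by positivity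
  obtain ⟨δ, hδ, hδ4, hδt, hδs, hw1, hw2⟩ := exists_window ht hs (tailConst β θ) hη3
  have hceil : ∀ᶠ n in atTop, ((⌈(t + δ) * kseq β c n⌉₊ : ℕ) : ℝ) ≤ (t + δ + 1) * kseq β c n := by
    filter_upwards [hc.eventually_gt_atTop 0, eventually_ge_atTop 1,
      (tendsto_inv_kseq hβ hc hθ).eventually_le_const one_pos] with n hcn hn h1
    have hk := kseq_pos hβ hn hcn
    have := (Nat.ceil_lt_add_one (show 0 ≤ (t + δ) * kseq β c n by positivity)).le
    rw [inv_le_one₀ hk] at h1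
    linarith
  refine (((rare_main hβ hc hθ (u := t + δ) (V := t + s - δ) (by linarith) (by linarith) hη3).union
    (rare_main hβ hc hθ (u := t - δ) (V := t + s + δ) (by linarith) (by linarith) hη3)).union
    (rare_corrErr hr hβ hc hθ hδ hs (T := t + δ + 1) (by positivity) hceil hη3)).mono ?_
  filter_upwards [hc.eventually_gt_atTop 0, eventually_ge_atTop 1,
    (tendsto_pow_div_kseq hβ hc hθ 2).eventually_le_const (show (0 : ℝ) < δ / 4 by positivity)]
    with n hcn hn hn2 H hH
  have hm := mseq_pos hβ hn hcn
  have hk := kseq_pos hβ hn hcn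
  have hH : η ≤ |√n * corr β H (c n) t s - limitValue β θ t s| := hH
  by_contra hcon
  simp only [Set.mem_union, not_or] at hcon
  obtain ⟨⟨h1, h2⟩, h3⟩ := hcon
  have h1 : |√n * ∑ i ∈ Finset.range ⌈(t + δ) * kseq β c n⌉₊,
      trapProb (tau β H) (c n * (t + s - δ - i / kseq β c n)) - tailConst β θ *
      Real.log ((t + s - δ) / (t + s - δ - (t + δ)))| < η / 3 := not_le.1 h1
  have h2 : |√n * ∑ i ∈ Finset.range ⌈(t - δ) * kseq β c n⌉₊,
      trapProb (tau β H) (c n * (t + s + δ - i / kseq β c n)) - tailConst β θ *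
      Real.log ((t + s + δ) / (t + s + δ - (t - δ)))| < η / 3 := not_le.1 h2
  rw [abs_lt] at h1 h2
  have h3 : √n * corrErr (tau β H) (c n / n ^ 6) (mseq β c n) (c n) δ s
    ⌈(t + δ) * kseq β c n⌉₊ < η / 3 := not_le.1 h3
  have hmδ : (n : ℝ) ^ 2 * mseq β c n ≤ δ * c n / 4 := by
    rw [kseq, div_div_eq_mul_div, div_le_iff₀ hcn] at hn2
    linarith
  have ek : ∀ u : ℝ, u * c n / mseq β c n = u * kseq β c n := fun u => by rw [kseq, mul_div_assoc]
  have hup := corr_le_of_env hn β H (L := c n / n ^ 6) hm hcn ht hδ hδ4 hs hδs.le hmδ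
    ⌈(t + δ) * kseq β c n⌉₊ (by rw [ek])
  have hlo := le_corr_of_env hn β H (L := c n / n ^ 6) (t := t) hm hcn hδ hδ4 hs hmδ
    ⌈(t - δ) * kseq β c n⌉₊ ⌈(t + δ) * kseq β c n⌉₊ (by rw [ek])
    (Nat.ceil_le_ceil (by gcongr; linarith))
  have e1 : ∀ i : ℕ, t + s - i * mseq β c n / c n - δ = t + s - δ - i / kseq β c n := fun i => by
    rw [kseq, div_div_eq_mul_div]; ring
  have e2 : ∀ i : ℕ, t + s - i * mseq β c n / c n + δ = t + s + δ - i / kseq β c n := fun i => by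
    rw [kseq, div_div_eq_mul_div]; ring
  simp_rw [e1] at hup
  simp_rw [e2] at hlo
  have hq : 0 ≤ √(n : ℝ) := Real.sqrt_nonneg _
  have hup := mul_le_mul_of_nonneg_left hup hq
  have hlo := mul_le_mul_of_nonneg_left hlo hq
  rw [mul_add] at hup hlo
  rw [abs_lt] at hw1 hw2
  rw [limitValue_eq] at hH
  refine absurd hH (not_le.2 (abs_lt.2 ⟨?_, ?_⟩)) <;> linarith

/-- If the correlation stayed above `η`, then `√n η` would exceed any neighbourhood of the finite
limit. -/
lemma rare_corr (hr : Tendsto (fun n : ℕ => √n * kseq β c n / 2 ^ n) atTop (𝓝 0))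
    (hβ : 0 < β) (hc : Tendsto c atTop atTop)
    (hθ : Tendsto (fun n : ℕ => Real.log (c n) / (β * √(n : ℝ)) - β * √(n : ℝ)) atTop (𝓝 θ))
    {t s : ℝ} (ht : 0 < t) (hs : 0 < s) {η : ℝ} (hη : 0 < η) :
    Rare (fun n => √n * kseq β c n / 2 ^ n) fun n => {H | η ≤ |corr β H (c n) t s - 0|} := by
  refine (rare_corr_deviation hr hβ hc hθ ht hs one_pos).mono ?_
  filter_upwards [tendsto_sqrt_natCast.eventually_ge_atTop ((1 + |limitValue β θ t s|) / η)]
    with n hn H hH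
  have hH : η ≤ |corr β H (c n) t s - 0| := hH
  rw [sub_zero] at hH
  change 1 ≤ |√n * corr β H (c n) t s - limitValue β θ t s|
  rw [div_le_iff₀ hη] at hn
  have h1 : 1 + |limitValue β θ t s| ≤ |√n * corr β H (c n) t s| := by
    rw [abs_mul, abs_of_nonneg (Real.sqrt_nonneg _)]
    exact hn.trans (mul_le_mul_of_nonneg_left hH (Real.sqrt_nonneg _))
  have := abs_sub_abs_le_abs_sub (√n * corr β H (c n) t s) (limitValue β θ t s)
  linarith

end Convergence

/-! ### From rare events of the environment to the two modes of convergence -/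

section Transfer

variable {Ω : Type*} [MeasurableSpace Ω] {Pr : Measure Ω} {H : (n : ℕ) → Cube n → Ω → ℝ}
  {r : ℕ → ℝ} {F : (n : ℕ) → (Cube n → ℝ) → ℝ} {l : ℝ}

/-- An inequality for arbitrary `A` suffices, so measurability of the correlation function in the
environment never has to be shown. -/
lemma IsHamiltonian.measure_le [IsProbabilityMeasure Pr] (hH : IsHamiltonian Pr H) (n : ℕ)
    (A : Set (Cube n → ℝ)) :
    Pr {ω | (fun x => H n x ω) ∈ A} ≤ envLaw n A := by
  have hm : ∀ x, AEMeasurable (H n x) Pr := fun x => (hH.law n x).aemeasurable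
  have h := (iIndepFun_iff_map_fun_eq_pi_map hm).1 (hH.indep n)
  have e : Pr.map (fun ω x => H n x ω) = envLaw n := by
    rw [h, envLaw]
    exact congrArg Measure.pi (funext fun x => (hH.law n x).map_eq)
  rw [← e]
  exact Measure.le_map_apply (aemeasurable_pi_lambda _ hm) A

lemma Rare.mono_bound {r' : ℕ → ℝ} {A : (n : ℕ) → Set (Cube n → ℝ)} (hA : Rare r A) {C : ℝ}
    (hC : 0 ≤ C) (h : ∀ᶠ n in atTop, r n ≤ C * r' n) : Rare r' A := by
  obtain ⟨D, b, hb, hD⟩ := hA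
  refine ⟨D * C.toNNReal, b, hb, ?_⟩
  filter_upwards [hD, h] with n h1 h2
  refine h1.trans (add_le_add ?_ le_rfl)
  push_cast
  rw [mul_assoc]
  refine mul_le_mul' le_rfl ((ENNReal.ofReal_le_ofReal h2).trans ?_)
  rw [ENNReal.ofReal_mul hC]
  exact le_rfl

lemma ae_eventually_notMem_of_eventually_le {s : ℕ → Set Ω} {b : ℕ → ℝ≥0∞}
    (hb : ∑' n, b n ≠ ⊤) (h : ∀ᶠ n in atTop, Pr (s n) ≤ b n) :
    ∀ᵐ ω ∂Pr, ∀ᶠ n in atTop, ω ∉ s n := by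
  obtain ⟨N, hN⟩ := eventually_atTop.1 h
  have h1 : ∑' n, Pr (s (n + N)) ≠ ⊤ := by
    refine ne_top_of_le_ne_top hb ((ENNReal.tsum_le_tsum fun n => hN (n + N) (by omega)).trans ?_)
    exact ENNReal.tsum_comp_le_tsum_of_injective (add_left_injective N) b
  filter_upwards [ae_eventually_notMem h1] with ω hω
  obtain ⟨M, hM⟩ := eventually_atTop.1 hω
  refine eventually_atTop.2 ⟨M + N, fun n hn => ?_⟩
  have := hM (n - N) (by omega)
  rwa [Nat.sub_add_cancel (by omega)] at this

/-- First Borel–Cantelli lemma along the thresholds `1 / (j + 1)`; it needs no relation between the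
environments for different `n`. -/
lemma ae_tendsto_of_rare [IsProbabilityMeasure Pr] (hH : IsHamiltonian Pr H) (hr : Summable r)
    (h : ∀ η > 0, Rare r fun n => {E | η ≤ |F n E - l|}) :
    ∀ᵐ ω ∂Pr, Tendsto (fun n => F n fun x => H n x ω) atTop (𝓝 l) := by
  have h1 : ∀ j : ℕ, ∀ᵐ ω ∂Pr, ∀ᶠ n in atTop,
      ω ∉ {ω | (1 : ℝ) / (j + 1) ≤ |F n (fun x => H n x ω) - l|} := by
    intro j
    obtain ⟨C, b, hb, hC⟩ := h (1 / (j + 1)) Nat.one_div_pos_of_nat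
    refine ae_eventually_notMem_of_eventually_le
      (b := fun n => C * ENNReal.ofReal (r n) + b n) ?_ ?_
    · rw [ENNReal.tsum_add, ENNReal.tsum_mul_left]
      exact ENNReal.add_ne_top.2 ⟨ENNReal.mul_ne_top ENNReal.coe_ne_top hr.tsum_ofReal_ne_top, hb⟩
    · filter_upwards [hC] with n hn
      exact (hH.measure_le n {E | (1 : ℝ) / (j + 1) ≤ |F n E - l|}).trans hn
  filter_upwards [ae_all_iff.2 h1] with ω hω
  rw [Metric.tendsto_atTop']
  intro η hη
  obtain ⟨j, hj⟩ := exists_nat_one_div_lt hη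
  obtain ⟨N, hN⟩ := eventually_atTop.1 (hω j)
  refine ⟨N, fun n hn => ?_⟩
  rw [Real.dist_eq]
  exact (not_le.1 (hN n hn.le)).trans hj

lemma tendstoInMeasure_of_rare [IsProbabilityMeasure Pr] (hH : IsHamiltonian Pr H)
    (hr : Tendsto r atTop (𝓝 0)) (h : ∀ η > 0, Rare r fun n => {E | η ≤ |F n E - l|}) :
    TendstoInMeasure Pr (fun n ω => F n fun x => H n x ω) atTop fun _ => l := by
  rw [tendstoInMeasure_iff_norm]
  intro η hη
  obtain ⟨C, b, hb, hC⟩ := h η hη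
  have h1 : Tendsto (fun n => C * ENNReal.ofReal (r n) + b n) atTop (𝓝 0) := by
    have h2 := ENNReal.Tendsto.const_mul (a := (C : ℝ≥0∞)) (ENNReal.tendsto_ofReal hr)
      (Or.inr ENNReal.coe_ne_top)
    have h3 := h2.add (ENNReal.tendsto_atTop_zero_of_tsum_ne_top hb)
    simpa using h3
  refine tendsto_of_tendsto_of_tendsto_of_le_of_le' tendsto_const_nhds h1
    (Eventually.of_forall fun _ => zero_le) ?_
  filter_upwards [hC] with n hn
  exact (hH.measure_le n {E | η ≤ |F n E - l|}).trans hn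

variable {β θ : ℝ} {c a : ℕ → ℝ}

/-- From `1{τ ≥ c} ≤ e * exp (-c / τ)` one gets `1 / a ≤ e siteTrap (c)`, while `√n k siteTrap (c)`
is bounded; hence `√n k = O(a)`. -/
lemma IsScale.sqrt_mul_kseq_le [IsProbabilityMeasure Pr] (hH : IsHamiltonian Pr H)
    (ha : IsScale Pr H β c a) (hβ : 0 < β) (hc : Tendsto c atTop atTop)
    (hθ : Tendsto (fun n : ℕ => Real.log (c n) / (β * √(n : ℝ)) - β * √(n : ℝ)) atTop (𝓝 θ)) :
    ∃ C : ℝ, 0 ≤ C ∧ ∀ᶠ n : ℕ in atTop, √n * kseq β c n / 2 ^ n ≤ C * (a n / 2 ^ n) := by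
  refine ⟨Real.exp 1 * (|tailConst β θ| + 1), by positivity, ?_⟩
  filter_upwards [hc.eventually_gt_atTop 0, eventually_ge_atTop 1,
    (tendsto_kseq_mul_siteTrap hβ hc hθ one_pos).eventually_le_const (lt_add_one _)]
    with n hcn hn h1
  have hk := kseq_pos hβ hn hcn
  simp only [mul_one, div_one] at h1
  have h2 := ha n hn 1
  set p := Pr.real {ω | c n ≤ tau β (fun y => H n y ω) 1} with hp
  have hp0 : 0 ≤ p := measureReal_nonneg
  have hpe : p ≤ Real.exp 1 * siteTrap β n (c n) := by
    have hS : MeasurableSet {h | c n ≤ weight β h} :=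
      measurableSet_le measurable_const (measurable_weight β)
    have e : p = (siteLaw n).real {h | c n ≤ weight β h} := by
      rw [siteLaw, ← (hH.law n 1).map_eq,
        map_measureReal_apply_of_aemeasurable (hH.law n 1).aemeasurable hS]
      rfl
    rw [e, ← integral_indicator_one hS, siteTrap, ← integral_const_mul]
    refine integral_mono ((integrable_const (1 : ℝ)).indicator hS)
      ((integrable_trap β n hcn.le).const_mul _) fun h => ?_
    have hw := weight_pos β h
    by_cases hh : h ∈ {h | c n ≤ weight β h}
    · rw [Set.indicator_of_mem hh, Pi.one_apply, ← Real.exp_add]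
      refine Real.one_le_exp ?_
      have : c n / weight β h ≤ 1 := (div_le_one hw).2 hh
      linarith
    · rw [Set.indicator_of_notMem hh]
      positivity
  have ha0 : 0 < a n := by
    by_contra hcon
    have := mul_nonpos_of_nonpos_of_nonneg (not_lt.1 hcon) hp0
    linarith
  rw [← mul_div_assoc]
  refine div_le_div_of_nonneg_right ?_ (by positivity)
  have h3 : √n * kseq β c n * siteTrap β n (c n) ≤ |tailConst β θ| + 1 :=
    h1.trans (by gcongr; exact le_abs_self _)
  calc √n * kseq β c n = a n * (√n * kseq β c n * p) := by
        rw [mul_comm (√n * kseq β c n) p, ← mul_assoc, h2, one_mul]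
    _ ≤ a n * (√n * kseq β c n * (Real.exp 1 * siteTrap β n (c n))) := by gcongr
    _ = Real.exp 1 * (√n * kseq β c n * siteTrap β n (c n)) * a n := by ring
    _ ≤ _ := by gcongr

end Transfer

end REM

theorem theorem1p4 {Ω : Type*} [MeasurableSpace Ω] (Pr : Measure Ω) [IsProbabilityMeasure Pr]
    (H : (n : ℕ) → REM.Cube n → Ω → ℝ) (hH : REM.IsHamiltonian Pr H)
    (ε β θ : ℝ) (hβ : β = REM.betaC ε)
    (c a : ℕ → ℝ) (ha : REM.IsScale Pr H β c a) (hc : REM.IsIntermediate c a ε)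
    (hθ : Tendsto (fun n : ℕ => Real.log (c n) / (β * √(n : ℝ)) - β * √(n : ℝ)) atTop (𝓝 θ))
    (t s : ℝ) (ht : 0 < t) (hs : 0 < s) :
    (Summable (fun n : ℕ => a n / 2 ^ n) →
      (∀ᵐ ω ∂Pr, Tendsto
        (fun n : ℕ => √(n : ℝ) * REM.corr β (fun x => H n x ω) (c n) t s)
        atTop (𝓝 (REM.limitValue β θ t s))) ∧
      (∀ᵐ ω ∂Pr, Tendsto
        (fun n : ℕ => REM.corr β (fun x => H n x ω) (c n) t s) atTop (𝓝 0))) ∧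
    (¬ Summable (fun n : ℕ => a n / 2 ^ n) →
      TendstoInMeasure Pr
        (fun (n : ℕ) ω => √(n : ℝ) * REM.corr β (fun x => H n x ω) (c n) t s)
        atTop (fun _ => REM.limitValue β θ t s) ∧
      TendstoInMeasure Pr
        (fun (n : ℕ) ω => REM.corr β (fun x => H n x ω) (c n) t s)
        atTop (fun _ => 0)) := by
  have hβ0 : 0 < β := by
    have := hc.pos
    have := Real.log_pos one_lt_two
    rw [hβ, REM.betaC]
    positivity
  obtain ⟨C, hC0, hC⟩ := ha.sqrt_mul_kseq_le hH hβ0 hc.diverges hθ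
  have hr : Tendsto (fun n : ℕ => √(n : ℝ) * REM.kseq β c n / 2 ^ n) atTop (𝓝 0) := by
    have h1 := hc.a_div.const_mul C
    rw [mul_zero] at h1
    refine tendsto_of_tendsto_of_tendsto_of_le_of_le' tendsto_const_nhds h1 ?_ hC
    filter_upwards [hc.diverges.eventually_gt_atTop 0, eventually_ge_atTop 1] with n hcn hn
    have := REM.kseq_pos hβ0 hn hcn
    positivity
  -- The rate `√n k / 2 ^ n` is exchanged for `a / 2 ^ n`, whose summability decides the mode of
  -- convergence.
  have h1 := fun (η : ℝ) (hη : 0 < η) =>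
    (REM.rare_corr_deviation hr hβ0 hc.diverges hθ ht hs hη).mono_bound hC0 hC
  have h2 := fun (η : ℝ) (hη : 0 < η) =>
    (REM.rare_corr hr hβ0 hc.diverges hθ ht hs hη).mono_bound hC0 hC
  exact ⟨fun hsum =>
    ⟨REM.ae_tendsto_of_rare (F := fun n E => √(n : ℝ) * REM.corr β E (c n) t s) hH hsum h1,
      REM.ae_tendsto_of_rare (F := fun n E => REM.corr β E (c n) t s) hH hsum h2⟩,
    fun _ => ⟨REM.tendstoInMeasure_of_rare
        (F := fun n E => √(n : ℝ) * REM.corr β E (c n) t s) hH hc.a_div h1,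
      REM.tendstoInMeasure_of_rare (F := fun n E => REM.corr β E (c n) t s) hH hc.a_div h2⟩⟩
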